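/- Let $M$ be a matroid on the ground set $S=\{1,\dots,m\}$, $m\ge 2$, of positive rank, with set of bases $\mathcal B$, given by an independence oracle: queried with a subset of $S$, it tells whether the subset is independent, and each query takes $F(m)$ time. Let $u_i\in\mathbb N_{>0}$ $(i\in S)$ be capacities. A (fractional) base packing is a vector $x=(x_I)_{I\in\mathcal B}\ge 0$ with $\sum_{I\in\mathcal B:\,i\in I}x_I\le u_i$ for all $i\in S$. For rational $\varepsilon\in(0,1)$, a base packing $x$ is $(1-\varepsilon)$-approximate for a linear objective if its objective value is at least $(1-\varepsilon)$ times that of every base packing. Algorithms are programs for a random access machine with rational arithmetic ($+,-,\cdot,/$ and comparisons at unit cost, no rounding) and oracle queries; they may use the matroid only through the oracle. They return a base packing as an explicit list of bases with weights. The constants hidden in $\mathcal O(\cdot)$ are absolute, and in each of the algorithms below all numbers that occur have an encoding length that is polynomially bounded in the encoding length of the input (and, in 2.-4., in $1/\varepsilon$). 1. (Minimizing oracle.) There is an algorithm that, given costs $d\in\mathbb Q^m$, returns in $\mathcal O(m\,F(m)+m\log m)$ time the result of the greedy algorithm (starting from $\emptyset$, go through the elements in an order of nondecreasing cost and add each element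 that keeps the set independent), and this is a base of minimum cost $\sum_{i\in I}d_i$ among all $I\in\mathcal B$. 2. (Maximum matroid base packing.) For the objective $\max\sum_{I\in\mathcal B}x_I$ there is an FPTAS (an algorithm that, given $u$ and $\varepsilon$, returns a $(1-\varepsilon)$-approximate base packing) that runs in strongly polynomial time $$\mathcal O\Big(\tfrac1{\varepsilon^2}\,m^2\log m\,\big(F(m)+\log m\big)\Big).$$ 3. (Maximum weighted matroid base packing, weakly polynomial.) Given in addition costs $c_i\in\mathbb Z$ of arbitrary sign, for the objective $\max\sum_{I\in\mathcal B}c(I)\,x_I$ with $c(I)=\sum_{i\in I}c_i$ there is an FPTAS that runs in time $$\mathcal O\Big(\big(m\,F(m)+m\log m\big)\cdot\big(\tfrac1{\varepsilon^2}\,m\log m+\log\log L-\log\tfrac1\varepsilon-\log m-\log\log m\big)\Big),$$ where $L=\max\{m,\max_i u_i,\max_i c_i\}$ is the largest integer in the input. 4. (Maximum weighted matroid base packing, strongly polynomial.) For the problem in 3. there is also an FPTAS that runs in time $$\mathcal O\Big(\tfrac1{\varepsilon^2}\,m^2\log m\,\big(F(m)+\log m\big)+\big(m\,F(m)+m\log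 m\big)^2\Big),$$ which is strongly polynomial whenever the independence oracle is (in particular for every strongly polynomial and strongly combinatorial independence oracle). -/

import Mathlib

/-! ## Matroid base packing -/

/-- A fractional base packing of the matroid `M` under the capacities `u`: nonnegative weights `x I`,
supported on the bases `I` of `M`, such that every element `i` carries a total weight of at most
`u i`. -/
structure IsBasePacking {m : ℕ} (M : Matroid (Fin m)) (u : Fin m → ℕ)
    (x : Finset (Fin m) → ℝ) : Prop where
  nonneg : ∀ I, 0 ≤ x I
  isBase_of_ne_zero : ∀ I, x I ≠ 0 → M.IsBase (I : Set (Fin m))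
  capacity : ∀ i, (∑ I : Finset (Fin m) with i ∈ I, x I) ≤ u i

/-- `x` is a feasible packing whose objective value `∑ I, w I * x I` is at least `1 - ε` times the
objective value of any feasible packing. -/
def IsApproxBasePacking {m : ℕ} (M : Matroid (Fin m)) (u : Fin m → ℕ)
    (w : Finset (Fin m) → ℝ) (ε : ℝ) (x : Finset (Fin m) → ℝ) : Prop :=
  IsBasePacking M u x ∧
    ∀ y, IsBasePacking M u y → (1 - ε) * ∑ I, w I * y I ≤ ∑ I, w I * x I

open Classical in
/-- The greedy algorithm: go through the list and add each element unless this destroys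
independence. -/
noncomputable def greedySet {m : ℕ} (M : Matroid (Fin m)) (l : List (Fin m)) : Finset (Fin m) :=
  l.foldl (fun I e => if M.Indep ((insert e I : Finset (Fin m)) : Set (Fin m)) then insert e I else I) ∅

/-- The largest integer of the input: the maximum of the capacities, of the costs and of the
number of elements. -/
def largestInput {m : ℕ} (u : Fin m → ℕ) (c : Fin m → ℤ) : ℕ :=
  max m (Finset.univ.sup fun i => max (u i) (c i).toNat)

/-! ## The machine model

A random access machine with two memories, one for natural numbers (indices and flags) and one for
rational numbers, both organised into arrays. It is programmed in a structured language; every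
elementary operation (memory access, arithmetic operation, comparison, assignment) costs one unit.
There is no rounding operation, and no rational number can be turned into an index. -/

namespace OracleRAM

/-- The contents of the memory: `idx a i` and `num a i` are the `i`-th entries of the arrays with
name `a`. Scalar variables are entries at position `0`. -/
structure Store where
  idx : ℕ → ℕ → ℕ
  num : ℕ → ℕ → ℚ

def Store.setIdx (s : Store) (a i v : ℕ) : Store :=
  { s with idx := Function.update s.idx a (Function.update (s.idx a) i v) }

def Store.setNum (s : Store) (a i : ℕ) (v : ℚ) : Store :=
  { s with num := Function.update s.num a (Function.update (s.num a) i v) }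

/-- Expressions for natural numbers; `sub` is truncated subtraction. -/
inductive IdxExpr where
  | const (n : ℕ)
  | get (a : ℕ) (i : IdxExpr)
  | add (e f : IdxExpr)
  | sub (e f : IdxExpr)
  | mul (e f : IdxExpr)

/-- Expressions for rational numbers; division by zero returns zero. -/
inductive NumExpr where
  | const (q : ℚ)
  | get (a : ℕ) (i : IdxExpr)
  | ofIdx (e : IdxExpr)
  | add (e f : NumExpr)
  | sub (e f : NumExpr)
  | mul (e f : NumExpr)
  | div (e f : NumExpr)

/-- Conditions, built from comparisons. -/
inductive Test where
  | idxLt (e f : IdxExpr)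
  | numLt (e f : NumExpr)
  | not (b : Test)
  | and (b c : Test)

/-- Programs. `query r a` asks the independence oracle about the set whose indicator is
the array `idx a` and stores the answer (`1` for yes, `0` for no) in `idx r 0`. -/
inductive Cmd where
  | skip
  | setIdx (a : ℕ) (i : IdxExpr) (e : IdxExpr)
  | setNum (a : ℕ) (i : IdxExpr) (e : NumExpr)
  | query (r a : ℕ)
  | seq (p q : Cmd)
  | ite (b : Test) (p q : Cmd)
  | while (b : Test) (p : Cmd)

/-- The encoding length of a rational number: binary lengths of numerator and denominator. -/
def ratSize (q : ℚ) : ℕ := Nat.size q.num.natAbs + Nat.size q.den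

def IdxExpr.val (s : Store) : IdxExpr → ℕ
  | const n => n
  | get a i => s.idx a (i.val s)
  | add e f => e.val s + f.val s
  | sub e f => e.val s - f.val s
  | mul e f => e.val s * f.val s

/-- The number of elementary operations in the evaluation of an expression. -/
def IdxExpr.cost : IdxExpr → ℕ
  | const _ => 1
  | get _ i => i.cost + 1
  | add e f => e.cost + f.cost + 1
  | sub e f => e.cost + f.cost + 1
  | mul e f => e.cost + f.cost + 1

/-- The largest encoding length among all values that occur in the evaluation. -/
def IdxExpr.peak (s : Store) : IdxExpr → ℕ
  | const n => Nat.size n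
  | get a i => max (i.peak s) (Nat.size ((get a i).val s))
  | add e f => max (max (e.peak s) (f.peak s)) (Nat.size ((add e f).val s))
  | sub e f => max (max (e.peak s) (f.peak s)) (Nat.size ((sub e f).val s))
  | mul e f => max (max (e.peak s) (f.peak s)) (Nat.size ((mul e f).val s))

def NumExpr.val (s : Store) : NumExpr → ℚ
  | const q => q
  | get a i => s.num a (i.val s)
  | ofIdx e => (e.val s : ℚ)
  | add e f => e.val s + f.val s
  | sub e f => e.val s - f.val s
  | mul e f => e.val s * f.val s
  | div e f => e.val s / f.val s

/-- The number of elementary operations in the evaluation of an expression. -/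
def NumExpr.cost : NumExpr → ℕ
  | const _ => 1
  | get _ i => i.cost + 1
  | ofIdx e => e.cost + 1
  | add e f => e.cost + f.cost + 1
  | sub e f => e.cost + f.cost + 1
  | mul e f => e.cost + f.cost + 1
  | div e f => e.cost + f.cost + 1

/-- The largest encoding length among all values that occur in the evaluation. -/
def NumExpr.peak (s : Store) : NumExpr → ℕ
  | const q => ratSize q
  | get a i => max (i.peak s) (ratSize ((get a i).val s))
  | ofIdx e => max (e.peak s) (ratSize ((ofIdx e).val s))
  | add e f => max (max (e.peak s) (f.peak s)) (ratSize ((add e f).val s))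
  | sub e f => max (max (e.peak s) (f.peak s)) (ratSize ((sub e f).val s))
  | mul e f => max (max (e.peak s) (f.peak s)) (ratSize ((mul e f).val s))
  | div e f => max (max (e.peak s) (f.peak s)) (ratSize ((div e f).val s))

def Test.holds (s : Store) : Test → Prop
  | idxLt e f => e.val s < f.val s
  | numLt e f => e.val s < f.val s
  | not b => ¬ b.holds s
  | and b c => b.holds s ∧ c.holds s

/-- The number of elementary operations in the evaluation of a condition. -/
def Test.cost : Test → ℕ
  | idxLt e f => e.cost + f.cost + 1
  | numLt e f => e.cost + f.cost + 1
  | not b => b.cost + 1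
  | and b c => b.cost + c.cost + 1

/-- The largest encoding length among all numbers that occur in the evaluation. -/
def Test.peak (s : Store) : Test → ℕ
  | idxLt e f => max (e.peak s) (f.peak s)
  | numLt e f => max (e.peak s) (f.peak s)
  | not b => b.peak s
  | and b c => max (b.peak s) (c.peak s)

open Classical in
/-- `Exec O F B p s s' t`: started in `s`, the program `p` halts in `s'` after `t` units of time,
and every number that occurs on the way has encoding length at most `B`. Here `O` is the oracle,
which is applied to the contents of an array, and each call of it takes `F` units of time. -/
inductive Exec (O : (ℕ → ℕ) → Prop) (F B : ℕ) : Cmd → Store → Store → ℕ → Prop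
  | skip (s : Store) : Exec O F B .skip s s 1
  | setIdx (s : Store) (a : ℕ) (i e : IdxExpr) (hi : i.peak s ≤ B) (he : e.peak s ≤ B) :
      Exec O F B (.setIdx a i e) s (s.setIdx a (i.val s) (e.val s)) (i.cost + e.cost + 1)
  | setNum (s : Store) (a : ℕ) (i : IdxExpr) (e : NumExpr) (hi : i.peak s ≤ B)
      (he : e.peak s ≤ B) :
      Exec O F B (.setNum a i e) s (s.setNum a (i.val s) (e.val s)) (i.cost + e.cost + 1)
  | query (s : Store) (r a : ℕ) :
      Exec O F B (.query r a) s (s.setIdx r 0 (if O (s.idx a) then 1 else 0)) (F + 1)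
  | seq {p q : Cmd} {s s₁ s₂ : Store} {t₁ t₂ : ℕ} (hp : Exec O F B p s s₁ t₁)
      (hq : Exec O F B q s₁ s₂ t₂) : Exec O F B (.seq p q) s s₂ (t₁ + t₂)
  | iteTrue {b : Test} {p q : Cmd} {s s₁ : Store} {t : ℕ} (hb : b.holds s) (hB : b.peak s ≤ B)
      (hp : Exec O F B p s s₁ t) : Exec O F B (.ite b p q) s s₁ (b.cost + t + 1)
  | iteFalse {b : Test} {p q : Cmd} {s s₁ : Store} {t : ℕ} (hb : ¬ b.holds s) (hB : b.peak s ≤ B)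
      (hq : Exec O F B q s s₁ t) : Exec O F B (.ite b p q) s s₁ (b.cost + t + 1)
  | whileTrue {b : Test} {p : Cmd} {s s₁ s₂ : Store} {t₁ t₂ : ℕ} (hb : b.holds s)
      (hB : b.peak s ≤ B) (hp : Exec O F B p s s₁ t₁) (hw : Exec O F B (.while b p) s₁ s₂ t₂) :
      Exec O F B (.while b p) s s₂ (b.cost + t₁ + t₂ + 1)
  | whileFalse {b : Test} {p : Cmd} {s : Store} (hb : ¬ b.holds s) (hB : b.peak s ≤ B) :
      Exec O F B (.while b p) s s (b.cost + 1)

/-! ### Input, output and oracle -/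

/-- The independence oracle of `M`, applied to the indicator array `f` of a set of elements. -/
def indepOracle {m : ℕ} (M : Matroid (Fin m)) (f : ℕ → ℕ) : Prop := M.Indep {i | f i ≠ 0}

/-- The initial memory: `m` in `idx 0 0`, `ε` in `num 0 0`, the capacities in `num 1`, the costs in
`num 2`, and zero everywhere else. -/
def inputStore {m : ℕ} (ε : ℚ) (u c : Fin m → ℚ) : Store where
  idx a i := if a = 0 ∧ i = 0 then m else 0
  num a i :=
    if a = 0 ∧ i = 0 then ε
    else if h : i < m then
      if a = 1 then u ⟨i, h⟩ else if a = 2 then c ⟨i, h⟩ else 0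
    else 0

/-- The encoding length of the input. -/
def inputLength {m : ℕ} (ε : ℚ) (u c : Fin m → ℚ) : ℕ :=
  m + ratSize ε + ∑ i, (ratSize (u i) + ratSize (c i))

/-- The set that a program returns as an indicator array in `idx 1`. -/
def Store.outputSet (m : ℕ) (s : Store) : Finset (Fin m) := {i | s.idx 1 i ≠ 0}

/-- The `l`-th member of the list of sets that a program returns in `idx 2`, as the rows of an
incidence matrix with `m` columns. -/
def Store.outputRow (m : ℕ) (s : Store) (l : ℕ) : Finset (Fin m) := {i | s.idx 2 (l * m + i) ≠ 0}

/-- The weighting of sets that a program returns, as a list of sets in `idx 2` with weights in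
`num 3`; the length of the list is in `idx 1 0`. -/
def Store.outputPacking (m : ℕ) (s : Store) (I : Finset (Fin m)) : ℝ :=
  ∑ l ∈ Finset.range (s.idx 1 0), if s.outputRow m l = I then (s.num 3 l : ℝ) else 0

/-- With oracle `O` of running time `F`, the program `p` halts on the input `s` within time `T`,
all numbers on the way have encoding length at most `B`, and the final memory satisfies `post`. -/
def RunsWithin (O : (ℕ → ℕ) → Prop) (F : ℕ) (p : Cmd) (s : Store) (T B : ℝ)
    (post : Store → Prop) : Prop :=
  ∃ (b t : ℕ) (s' : Store), Exec O F b p s s' t ∧ (b : ℝ) ≤ B ∧ (t : ℝ) ≤ T ∧ post s'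

end OracleRAM

/-! The scheme is a width-independent multiplicative weights method for packing linear programs. The
dual problem assigns lengths `y i > 0` to the elements, and its separation problem is to find a base
of smallest ratio `y(I) / c(I)` among the bases with `c(I) > 0`. Start with `y i = 1 / u i`, so that
`D = ∑ u i * y i` equals `m`, and keep a lower bound `α` for all these ratios. With `l = (1 + e) *
α`, one greedy run for the costs `y i - l * c i` either finds a base with `y(I) < l * c(I)` or
proves that `l` is a lower bound too (`IsMinBase.isLB_iff`). In the first case `I` receives the
weight `v / (J + 1)`, where `v` is the smallest capacity in `I`, and each `y i` with `i ∈ I` is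
multiplied by `1 + e * v / u i`. In the second case `α` is multiplied by `1 + e`. The loop ends when
`D` reaches `(1 + e) ^ J`, where `m ^ K ≤ (1 + e) ^ J` for `e = 1 / K` and `K = ⌈4 / ε⌉`.

Everything needed is in the invariant `PackInv`. Feasibility: `u i * y i` grows at least
exponentially in the relative load of `i`, yet stays below `(1 + e) ^ (J + 1)`. Quality: by weak
duality each augmentation multiplies `D` by at most the exponential of a multiple of the gained
value divided by the optimum, so a large final `D` forces a large value (`value_bound`). Running
time: every augmentation multiplies `u i * y i` by `1 + e` for a bottleneck element, so there are at
most `m * J` of them (`PackInv.R_le`). If `α` starts at the exact minimum ratio, there are at most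
`J` increases of `α` (`PackInv.p_le`). Since `J ≤ K * K * Nat.size m`, this makes order `m * log m /
ε ^ 2` greedy runs.

The exact initial ratio comes from a search among breakpoints. As `l` varies, the order of the costs
`y i - l * c i` changes only at the `m * m` quotients `(y i - y j) / (c i - c j)`. After sorting
these, a binary search with `O(log m)` greedy runs isolates a gap that contains the minimum ratio,
and the greedy base for the midpoint of the gap attains it (`isLB_ratio`). This costs no more than
the main loop, so a single strongly polynomial bound serves all packing claims. The other two bounds
for weighted packing dominate it, and unweighted packing is the case of unit costs, where all bases
have the same positive cost.

On the machine, sorting uses a tournament tree, so that greedy takes `m` queries and `O(m log m)`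
further operations. Encoding lengths are controlled by the subadditive measure `rs`: it suffices to
bound the values that are stored, because an expression of a fixed program enlarges them only by a
constant factor (`Cmd.exists_fits`, `Run.exec`). Program correctness is proved with total
correctness triples `Tri` that carry a time bound. -/

namespace OracleRAM

/-! ## Encoding lengths -/

/-- A subadditive variant of the encoding length of a rational number. -/
def rs (q : ℚ) : ℕ := max (Nat.size q.num.natAbs) (Nat.size q.den) + 1

theorem ratSize_le_rs (q : ℚ) : ratSize q ≤ 2 * rs q := by
  unfold ratSize rs; omega

theorem rs_le_ratSize (q : ℚ) : rs q ≤ ratSize q + 1 := by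
  unfold ratSize rs; omega

theorem two_le_rs (q : ℚ) : 2 ≤ rs q := by
  have := Nat.size_pos.2 q.pos
  unfold rs; omega

theorem rs_le_iff {q : ℚ} {k : ℕ} : rs q ≤ k + 1 ↔ q.num.natAbs < 2 ^ k ∧ q.den < 2 ^ k := by
  rw [rs, Nat.add_le_add_iff_right, max_le_iff, Nat.size_le, Nat.size_le]

/-- Cancelling common factors can only shrink numerator and denominator, so any unreduced fraction
gives a bound. -/
theorem rs_divInt_le {n d : ℤ} {k : ℕ} (hd : d ≠ 0) (hn : n.natAbs < 2 ^ k)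
    (hd' : d.natAbs < 2 ^ k) : rs (Rat.divInt n d) ≤ k + 1 := by
  rw [rs_le_iff]
  constructor
  · rcases eq_or_ne n 0 with rfl | h
    · simp
    · exact (Nat.le_of_dvd (Int.natAbs_pos.2 h) (Int.natAbs_dvd_natAbs.2 (Rat.num_dvd n hd))).trans_lt
        hn
  · have := Int.natAbs_dvd_natAbs.2 (Rat.den_dvd n d)
    exact (Nat.le_of_dvd (Int.natAbs_pos.2 hd) this).trans_lt hd'

theorem exists_rs_eq (q : ℚ) : ∃ k, rs q = k + 1 ∧ q.num.natAbs < 2 ^ k ∧ q.den < 2 ^ k :=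
  ⟨_, rfl, rs_le_iff.1 le_rfl⟩

/-- The common denominator has size at most `k + l`, and the numerator is a sum of two such
products. The extra `+ 1` in `rs` pays for the carry, which plain sizes could not. -/
theorem rs_add_le (a b : ℚ) : rs (a + b) ≤ rs a + rs b := by
  obtain ⟨k, hk, h1, h2⟩ := exists_rs_eq a
  obtain ⟨l, hl, h3, h4⟩ := exists_rs_eq b
  have e : a + b = Rat.divInt (a.num * b.den + b.num * a.den) (a.den * b.den) := by
    rw [Rat.divInt_eq_div]; push_cast
    nth_rw 1 [← Rat.num_div_den a, ← Rat.num_div_den b]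
    have := a.den_nz; have := b.den_nz
    field_simp
  have hp : (2 : ℕ) ^ (k + l + 1) = 2 ^ k * 2 ^ l + 2 ^ k * 2 ^ l := by ring
  rw [e, hk, hl, show k + 1 + (l + 1) = (k + l + 1) + 1 by ring]
  refine rs_divInt_le (by have := a.den_nz; have := b.den_nz; positivity) ?_ ?_
  · refine (Int.natAbs_add_le _ _).trans_lt ?_
    rw [Int.natAbs_mul, Int.natAbs_mul, Int.natAbs_natCast, Int.natAbs_natCast, hp]
    have := Nat.mul_lt_mul'' h1 h4
    have := Nat.mul_lt_mul'' h3 h2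
    rw [mul_comm (2 ^ l)] at this
    omega
  · rw [Int.natAbs_mul, Int.natAbs_natCast, Int.natAbs_natCast, hp]
    have := Nat.mul_lt_mul'' h2 h4
    omega

theorem rs_neg (a : ℚ) : rs (-a) = rs a := by simp [rs]

theorem rs_sub_le (a b : ℚ) : rs (a - b) ≤ rs a + rs b := by
  rw [sub_eq_add_neg, ← rs_neg b]; exact rs_add_le _ _

theorem rs_mul_le (a b : ℚ) : rs (a * b) ≤ rs a + rs b := by
  obtain ⟨k, hk, h1, h2⟩ := exists_rs_eq a
  obtain ⟨l, hl, h3, h4⟩ := exists_rs_eq b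
  have e : a * b = Rat.divInt (a.num * b.num) (a.den * b.den) := by
    rw [Rat.divInt_eq_div]; push_cast
    nth_rw 1 [← Rat.num_div_den a, ← Rat.num_div_den b]
    have := a.den_nz; have := b.den_nz
    field_simp
  have hp : (2 : ℕ) ^ (k + l) = 2 ^ k * 2 ^ l := by ring
  suffices rs (a * b) ≤ (k + l) + 1 by omega
  rw [e]
  refine rs_divInt_le (by have := a.den_nz; have := b.den_nz; positivity) ?_ ?_
  · rw [Int.natAbs_mul, hp]
    exact Nat.mul_lt_mul'' h1 h3
  · rw [Int.natAbs_mul, Int.natAbs_natCast, Int.natAbs_natCast, hp]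
    exact Nat.mul_lt_mul'' h2 h4

theorem rs_inv_le (a : ℚ) : rs a⁻¹ ≤ rs a := by
  rcases eq_or_ne a 0 with rfl | h
  · simp
  obtain ⟨k, hk, h1, h2⟩ := exists_rs_eq a
  have e : a⁻¹ = Rat.divInt a.den a.num := by
    rw [Rat.divInt_eq_div]
    nth_rw 1 [← Rat.num_div_den a]
    simp
  rw [e, hk]
  exact rs_divInt_le (Rat.num_ne_zero.2 h) (by simpa using h2) h1

theorem rs_div_le (a b : ℚ) : rs (a / b) ≤ rs a + rs b := by
  rw [div_eq_mul_inv]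
  exact (rs_mul_le _ _).trans (Nat.add_le_add_left (rs_inv_le b) _)

theorem rs_natCast_le_size (n : ℕ) : rs n ≤ Nat.size n + 2 := by
  have : Nat.size 1 = 1 := by decide
  simp only [rs, Rat.num_natCast, Int.natAbs_natCast, Rat.den_natCast, this]; omega

theorem size_le_self (n : ℕ) : Nat.size n ≤ n := Nat.size_le.2 Nat.lt_two_pow_self

theorem rs_natCast_le (n : ℕ) : rs n ≤ n + 2 :=
  (rs_natCast_le_size n).trans (Nat.add_le_add_right (size_le_self n) 2)

theorem rs_zero : rs 0 = 2 := by decide +kernel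

theorem rs_one : rs 1 = 2 := by decide +kernel

theorem rs_sum_le {ι : Type*} (t : Finset ι) (f : ι → ℚ) (b : ℕ) (h : ∀ i ∈ t, rs (f i) ≤ b) :
    rs (∑ i ∈ t, f i) ≤ t.card * b + 2 := by
  classical
  induction t using Finset.induction_on with
  | empty => simp [rs_zero]
  | insert a t ha ih =>
    rw [Finset.sum_insert ha, Finset.card_insert_of_notMem ha]
    have h1 := rs_add_le (f a) (∑ i ∈ t, f i)
    have h2 := ih fun i hi => h i (Finset.mem_insert_of_mem hi)
    have h3 := h a (Finset.mem_insert_self _ _)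
    have : (t.card + 1) * b = t.card * b + b := by ring
    omega

theorem size_add_le (a b : ℕ) : Nat.size (a + b) ≤ Nat.size a + Nat.size b + 1 := by
  rw [Nat.size_le]
  have h1 := Nat.lt_size_self a
  have h2 := Nat.lt_size_self b
  have : 2 ^ (a.size + b.size + 1) = 2 ^ a.size * 2 ^ b.size + 2 ^ a.size * 2 ^ b.size := by ring
  have := Nat.le_mul_of_pos_right (2 ^ a.size) (Nat.two_pow_pos b.size)
  have := Nat.le_mul_of_pos_left (2 ^ b.size) (Nat.two_pow_pos a.size)
  omega

theorem size_mul_le (a b : ℕ) : Nat.size (a * b) ≤ Nat.size a + Nat.size b := by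
  rw [Nat.size_le, pow_add]
  exact Nat.mul_lt_mul'' (Nat.lt_size_self a) (Nat.lt_size_self b)

/-! ## Bounded stores -/

/-- All numbers of the first memory are at most `N`, those of the second have size at most `β`. -/
def Store.Bdd (N β : ℕ) (s : Store) : Prop :=
  (∀ a i, s.idx a i ≤ N) ∧ ∀ a i, rs (s.num a i) ≤ β

theorem IdxExpr.size_val_le_peak (s : Store) (e : IdxExpr) : Nat.size (e.val s) ≤ e.peak s := by
  cases e <;> simp [IdxExpr.val, IdxExpr.peak]

theorem NumExpr.ratSize_val_le_peak (s : Store) (e : NumExpr) : ratSize (e.val s) ≤ e.peak s := by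
  cases e <;> simp [NumExpr.val, NumExpr.peak]

/-- Sizes are subadditive up to a constant under the operations, and the expression has a fixed
number of leaves. Hence `W` depends on the expression only. The size of an index is crudely bounded
by the index itself, hence by `N`. -/
theorem IdxExpr.exists_peak_le (e : IdxExpr) :
    ∃ W, ∀ N β s, Store.Bdd N β s → e.peak s ≤ W * (N + β + 1) := by
  induction e with
  | const n =>
    refine ⟨Nat.size n, fun N β s _ => ?_⟩
    exact Nat.le_mul_of_pos_right _ (by omega)
  | get a i ih =>
    obtain ⟨W, hW⟩ := ih
    refine ⟨W + 1, fun N β s hs => ?_⟩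
    have h1 := hW N β s hs
    have h2 := (size_le_self _).trans (hs.1 a (i.val s))
    simp only [IdxExpr.peak, IdxExpr.val]
    have : (W + 1) * (N + β + 1) = W * (N + β + 1) + (N + β + 1) := by ring
    omega
  | add e f he hf =>
    obtain ⟨W, hW⟩ := he
    obtain ⟨V, hV⟩ := hf
    refine ⟨W + V + 1, fun N β s hs => ?_⟩
    have h1 := hW N β s hs
    have h2 := hV N β s hs
    have h3 := e.size_val_le_peak s
    have h4 := f.size_val_le_peak s
    have h5 := size_add_le (e.val s) (f.val s)
    simp only [IdxExpr.peak, IdxExpr.val]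
    have : (W + V + 1) * (N + β + 1) = W * (N + β + 1) + V * (N + β + 1) + (N + β + 1) := by ring
    omega
  | sub e f he hf =>
    obtain ⟨W, hW⟩ := he
    obtain ⟨V, hV⟩ := hf
    refine ⟨W + V + 1, fun N β s hs => ?_⟩
    have h1 := hW N β s hs
    have h2 := hV N β s hs
    have h3 := e.size_val_le_peak s
    have h5 := Nat.size_le_size (Nat.sub_le (e.val s) (f.val s))
    simp only [IdxExpr.peak, IdxExpr.val]
    have : (W + V + 1) * (N + β + 1) = W * (N + β + 1) + V * (N + β + 1) + (N + β + 1) := by ring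
    omega
  | mul e f he hf =>
    obtain ⟨W, hW⟩ := he
    obtain ⟨V, hV⟩ := hf
    refine ⟨W + V + 1, fun N β s hs => ?_⟩
    have h1 := hW N β s hs
    have h2 := hV N β s hs
    have h3 := e.size_val_le_peak s
    have h4 := f.size_val_le_peak s
    have h5 := size_mul_le (e.val s) (f.val s)
    simp only [IdxExpr.peak, IdxExpr.val]
    have : (W + V + 1) * (N + β + 1) = W * (N + β + 1) + V * (N + β + 1) + (N + β + 1) := by ring
    omega

theorem NumExpr.exists_peak_le_of_binary (e f : NumExpr) (op : ℚ → ℚ → ℚ)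
    (hop : ∀ a b, rs (op a b) ≤ rs a + rs b)
    (he : ∃ W, ∀ N β s, Store.Bdd N β s → e.peak s ≤ W * (N + β + 1))
    (hf : ∃ W, ∀ N β s, Store.Bdd N β s → f.peak s ≤ W * (N + β + 1)) :
    ∃ W, ∀ N β s, Store.Bdd N β s →
      max (max (e.peak s) (f.peak s)) (ratSize (op (e.val s) (f.val s))) ≤ W * (N + β + 1) := by
  obtain ⟨W, hW⟩ := he
  obtain ⟨V, hV⟩ := hf
  refine ⟨2 * W + 2 * V + 4, fun N β s hs => ?_⟩
  have h1 := hW N β s hs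
  have h2 := hV N β s hs
  have h3 := (rs_le_ratSize _).trans (Nat.add_le_add_right (e.ratSize_val_le_peak s) 1)
  have h4 := (rs_le_ratSize _).trans (Nat.add_le_add_right (f.ratSize_val_le_peak s) 1)
  have h5 := hop (e.val s) (f.val s)
  have h6 := ratSize_le_rs (op (e.val s) (f.val s))
  have : (2 * W + 2 * V + 4) * (N + β + 1) =
    2 * (W * (N + β + 1)) + 2 * (V * (N + β + 1)) + 4 * (N + β + 1) := by ring
  omega

theorem NumExpr.exists_peak_le (e : NumExpr) :
    ∃ W, ∀ N β s, Store.Bdd N β s → e.peak s ≤ W * (N + β + 1) := by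
  induction e with
  | const q => exact ⟨ratSize q, fun N β s _ => Nat.le_mul_of_pos_right _ (by omega)⟩
  | get a i =>
    obtain ⟨W, hW⟩ := i.exists_peak_le
    refine ⟨W + 2, fun N β s hs => ?_⟩
    have h1 := hW N β s hs
    have h2 := hs.2 a (i.val s)
    have h3 := ratSize_le_rs (s.num a (i.val s))
    simp only [NumExpr.peak, NumExpr.val]
    have : (W + 2) * (N + β + 1) = W * (N + β + 1) + 2 * (N + β + 1) := by ring
    omega
  | ofIdx i =>
    obtain ⟨W, hW⟩ := i.exists_peak_le
    refine ⟨2 * W + 4, fun N β s hs => ?_⟩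
    have h1 := hW N β s hs
    have h2 := i.size_val_le_peak s
    have h3 := ratSize_le_rs (i.val s : ℚ)
    have h4 := rs_natCast_le_size (i.val s)
    simp only [NumExpr.peak, NumExpr.val]
    have : (2 * W + 4) * (N + β + 1) = 2 * (W * (N + β + 1)) + 4 * (N + β + 1) := by ring
    omega
  | add e f he hf => exact exists_peak_le_of_binary e f (· + ·) rs_add_le he hf
  | sub e f he hf => exact exists_peak_le_of_binary e f (· - ·) rs_sub_le he hf
  | mul e f he hf => exact exists_peak_le_of_binary e f (· * ·) rs_mul_le he hf
  | div e f he hf => exact exists_peak_le_of_binary e f (· / ·) rs_div_le he hf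

theorem exists_max_le {P Q : ℕ → ℕ → Store → ℕ}
    (he : ∃ W, ∀ N β s, Store.Bdd N β s → P N β s ≤ W * (N + β + 1))
    (hf : ∃ W, ∀ N β s, Store.Bdd N β s → Q N β s ≤ W * (N + β + 1)) :
    ∃ W, ∀ N β s, Store.Bdd N β s → max (P N β s) (Q N β s) ≤ W * (N + β + 1) := by
  obtain ⟨W, hW⟩ := he
  obtain ⟨V, hV⟩ := hf
  refine ⟨W + V, fun N β s hs => ?_⟩
  have h1 := hW N β s hs
  have h2 := hV N β s hs
  rw [add_mul]
  omega

theorem Test.exists_peak_le (b : Test) :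
    ∃ W, ∀ N β s, Store.Bdd N β s → b.peak s ≤ W * (N + β + 1) := by
  induction b with
  | idxLt e f => exact exists_max_le e.exists_peak_le f.exists_peak_le
  | numLt e f => exact exists_max_le e.exists_peak_le f.exists_peak_le
  | not b ih => exact ih
  | and b c hb hc => exact exists_max_le hb hc

/-! ## Executions with bounded memory -/

/-- The data of an execution: the oracle, its running time, and bounds for the two memories. -/
structure Env where
  O : (ℕ → ℕ) → Prop
  F : ℕ
  N : ℕ
  β : ℕ

open Classical in
/-- Execution of a program in which the size of the numbers is only checked when they are stored. -/
inductive Run (E : Env) : Cmd → Store → Store → ℕ → Prop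
  | skip (s : Store) : Run E .skip s s 1
  | setIdx (s : Store) (a : ℕ) (i e : IdxExpr) (he : e.val s ≤ E.N) :
      Run E (.setIdx a i e) s (s.setIdx a (i.val s) (e.val s)) (i.cost + e.cost + 1)
  | setNum (s : Store) (a : ℕ) (i : IdxExpr) (e : NumExpr) (he : rs (e.val s) ≤ E.β) :
      Run E (.setNum a i e) s (s.setNum a (i.val s) (e.val s)) (i.cost + e.cost + 1)
  | query (s : Store) (r a : ℕ) (h : 1 ≤ E.N) :
      Run E (.query r a) s (s.setIdx r 0 (if E.O (s.idx a) then 1 else 0)) (E.F + 1)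
  | seq {p q : Cmd} {s s₁ s₂ : Store} {t₁ t₂ : ℕ} (hp : Run E p s s₁ t₁)
      (hq : Run E q s₁ s₂ t₂) : Run E (.seq p q) s s₂ (t₁ + t₂)
  | iteTrue {b : Test} {p q : Cmd} {s s₁ : Store} {t : ℕ} (hb : b.holds s)
      (hp : Run E p s s₁ t) : Run E (.ite b p q) s s₁ (b.cost + t + 1)
  | iteFalse {b : Test} {p q : Cmd} {s s₁ : Store} {t : ℕ} (hb : ¬ b.holds s)
      (hq : Run E q s s₁ t) : Run E (.ite b p q) s s₁ (b.cost + t + 1)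
  | whileTrue {b : Test} {p : Cmd} {s s₁ s₂ : Store} {t₁ t₂ : ℕ} (hb : b.holds s)
      (hp : Run E p s s₁ t₁) (hw : Run E (.while b p) s₁ s₂ t₂) :
      Run E (.while b p) s s₂ (b.cost + t₁ + t₂ + 1)
  | whileFalse {b : Test} {p : Cmd} {s : Store} (hb : ¬ b.holds s) :
      Run E (.while b p) s s (b.cost + 1)

theorem Store.Bdd.setIdx {N β : ℕ} {s : Store} (hs : s.Bdd N β) {a i v : ℕ} (hv : v ≤ N) :
    (s.setIdx a i v).Bdd N β := by
  refine ⟨fun b j => ?_, hs.2⟩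
  simp only [Store.setIdx, Function.update_apply]
  split_ifs
  · simp only [Function.update_apply]; split_ifs
    exacts [hv, hs.1 _ _]
  · exact hs.1 _ _

theorem Store.Bdd.setNum {N β : ℕ} {s : Store} (hs : s.Bdd N β) {a i : ℕ} {v : ℚ} (hv : rs v ≤ β) :
    (s.setNum a i v).Bdd N β := by
  refine ⟨hs.1, fun b j => ?_⟩
  simp only [Store.setNum, Function.update_apply]
  split_ifs
  · simp only [Function.update_apply]; split_ifs
    exacts [hv, hs.2 _ _]
  · exact hs.2 _ _

theorem Run.bdd {E : Env} {p : Cmd} {s s' : Store} {t : ℕ} (h : Run E p s s' t) :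
    s.Bdd E.N E.β → s'.Bdd E.N E.β := by
  induction h with
  | skip => exact id
  | setIdx s a i e he => exact fun h => h.setIdx he
  | setNum s a i e he => exact fun h => h.setNum he
  | query s r a h => exact fun hs => hs.setIdx (by split_ifs <;> omega)
  | seq _ _ h1 h2 => exact h2 ∘ h1
  | iteTrue _ _ h => exact h
  | iteFalse _ _ h => exact h
  | whileTrue _ _ _ h1 h2 => exact h2 ∘ h1
  | whileFalse => exact id

/-- All expressions of the program have peak at most `B` in all bounded stores. -/
def Cmd.Fits (B N β : ℕ) : Cmd → Prop
  | .skip => True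
  | .setIdx _ i e => ∀ s, Store.Bdd N β s → i.peak s ≤ B ∧ e.peak s ≤ B
  | .setNum _ i e => ∀ s, Store.Bdd N β s → i.peak s ≤ B ∧ e.peak s ≤ B
  | .query _ _ => True
  | .seq p q => p.Fits B N β ∧ q.Fits B N β
  | .ite b p q => (∀ s, Store.Bdd N β s → b.peak s ≤ B) ∧ p.Fits B N β ∧ q.Fits B N β
  | .while b p => (∀ s, Store.Bdd N β s → b.peak s ≤ B) ∧ p.Fits B N β

theorem Cmd.Fits.mono {B B' N β : ℕ} (h : B ≤ B') : ∀ {p : Cmd}, p.Fits B N β → p.Fits B' N β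
  | .skip, _ => trivial
  | .setIdx _ _ _, hp => fun s hs => ⟨(hp s hs).1.trans h, (hp s hs).2.trans h⟩
  | .setNum _ _ _, hp => fun s hs => ⟨(hp s hs).1.trans h, (hp s hs).2.trans h⟩
  | .query _ _, _ => trivial
  | .seq _ _, hp => ⟨mono h hp.1, mono h hp.2⟩
  | .ite _ _ _, hp => ⟨fun s hs => (hp.1 s hs).trans h, mono h hp.2.1, mono h hp.2.2⟩
  | .while _ _, hp => ⟨fun s hs => (hp.1 s hs).trans h, mono h hp.2⟩

/-- The factor `W` depends on the program text only, which is what makes the constant in the final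
encoding bound absolute. -/
theorem Cmd.exists_fits (p : Cmd) : ∃ W, ∀ N β, p.Fits (W * (N + β + 1)) N β := by
  have key : ∀ {W V N β : ℕ} (U : ℕ), W * (N + β + 1) ≤ (W + V + U) * (N + β + 1) ∧
      V * (N + β + 1) ≤ (W + V + U) * (N + β + 1) ∧ U * (N + β + 1) ≤ (W + V + U) * (N + β + 1) :=
    fun U => ⟨Nat.mul_le_mul_right _ (by omega), Nat.mul_le_mul_right _ (by omega),
      Nat.mul_le_mul_right _ (by omega)⟩
  induction p with
  | skip => exact ⟨0, fun _ _ => trivial⟩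
  | setIdx a i e =>
    obtain ⟨W, hW⟩ := i.exists_peak_le
    obtain ⟨V, hV⟩ := e.exists_peak_le
    exact ⟨W + V + 0, fun N β s hs => ⟨(hW N β s hs).trans (key 0).1, (hV N β s hs).trans (key 0).2.1⟩⟩
  | setNum a i e =>
    obtain ⟨W, hW⟩ := i.exists_peak_le
    obtain ⟨V, hV⟩ := e.exists_peak_le
    exact ⟨W + V + 0, fun N β s hs => ⟨(hW N β s hs).trans (key 0).1, (hV N β s hs).trans (key 0).2.1⟩⟩
  | query => exact ⟨0, fun _ _ => trivial⟩
  | seq p q hp hq =>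
    obtain ⟨W, hW⟩ := hp
    obtain ⟨V, hV⟩ := hq
    exact ⟨W + V + 0, fun N β => ⟨(hW N β).mono (key 0).1, (hV N β).mono (key 0).2.1⟩⟩
  | ite b p q hp hq =>
    obtain ⟨W, hW⟩ := hp
    obtain ⟨V, hV⟩ := hq
    obtain ⟨U, hU⟩ := b.exists_peak_le
    exact ⟨W + V + U, fun N β => ⟨fun s hs => (hU N β s hs).trans (key U).2.2,
      (hW N β).mono (key U).1, (hV N β).mono (key U).2.1⟩⟩
  | _ b p hp =>
    obtain ⟨W, hW⟩ := hp
    obtain ⟨U, hU⟩ := b.exists_peak_le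
    exact ⟨W + 0 + U, fun N β => ⟨fun s hs => (hU N β s hs).trans (key U).2.2,
      (hW N β).mono (key U).1⟩⟩

/-- A run keeps the memory bounded, so `Fits` applies at every store reached and covers all
intermediate values as well. -/
theorem Run.exec {E : Env} {B : ℕ} {p : Cmd} {s s' : Store} {t : ℕ} (h : Run E p s s' t) :
    p.Fits B E.N E.β → s.Bdd E.N E.β → Exec E.O E.F B p s s' t := by
  induction h with
  | skip s => exact fun _ _ => .skip s
  | setIdx s a i e he => exact fun hp hs => .setIdx s a i e (hp s hs).1 (hp s hs).2
  | setNum s a i e he => exact fun hp hs => .setNum s a i e (hp s hs).1 (hp s hs).2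
  | query s r a h => exact fun _ _ => .query s r a
  | seq h1 h2 i1 i2 => exact fun hp hs => .seq (i1 hp.1 hs) (i2 hp.2 (h1.bdd hs))
  | iteTrue hb h ih => exact fun hp hs => .iteTrue hb (hp.1 _ hs) (ih hp.2.1 hs)
  | iteFalse hb h ih => exact fun hp hs => .iteFalse hb (hp.1 _ hs) (ih hp.2.2 hs)
  | whileTrue hb h1 h2 i1 i2 =>
    exact fun hp hs => .whileTrue hb (hp.1 _ hs) (i1 hp.2 hs) (i2 hp (h1.bdd hs))
  | whileFalse hb => exact fun hp hs => .whileFalse hb (hp.1 _ hs)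

/-! ## Frames -/

/-- Whether the program may write to the array `idx a`. -/
def Cmd.wI (a : ℕ) : Cmd → Bool
  | .skip => false
  | .setIdx b _ _ => b == a
  | .setNum _ _ _ => false
  | .query r _ => r == a
  | .seq p q => p.wI a || q.wI a
  | .ite _ p q => p.wI a || q.wI a
  | .while _ p => p.wI a

/-- Whether the program may write to the array `num a`. -/
def Cmd.wN (a : ℕ) : Cmd → Bool
  | .skip => false
  | .setIdx _ _ _ => false
  | .setNum b _ _ => b == a
  | .query _ _ => false
  | .seq p q => p.wN a || q.wN a
  | .ite _ p q => p.wN a || q.wN a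
  | .while _ p => p.wN a

/-- Outside of the arrays to which `p` may write, the two stores agree, and the bounds of the
memories are kept. -/
def Frame (E : Env) (p : Cmd) (s s' : Store) : Prop :=
  (∀ a, p.wI a = false → s'.idx a = s.idx a) ∧ (∀ a, p.wN a = false → s'.num a = s.num a) ∧
    (s.Bdd E.N E.β → s'.Bdd E.N E.β)

theorem Frame.refl (E : Env) (p : Cmd) (s : Store) : Frame E p s s :=
  ⟨fun _ _ => rfl, fun _ _ => rfl, id⟩

theorem Frame.trans {E : Env} {p : Cmd} {s s₁ s₂ : Store} (h : Frame E p s s₁)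
    (h' : Frame E p s₁ s₂) : Frame E p s s₂ :=
  ⟨fun a ha => (h'.1 a ha).trans (h.1 a ha), fun a ha => (h'.2.1 a ha).trans (h.2.1 a ha),
    h'.2.2 ∘ h.2.2⟩

theorem Frame.mono {E : Env} {p q : Cmd} {s s' : Store} (h : Frame E p s s')
    (hI : ∀ a, q.wI a = false → p.wI a = false) (hN : ∀ a, q.wN a = false → p.wN a = false) :
    Frame E q s s' :=
  ⟨fun a ha => h.1 a (hI a ha), fun a ha => h.2.1 a (hN a ha), h.2.2⟩

/-- Which arrays a program may write is a computable syntactic check. For concrete programs its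
instances hold by `rfl`, which is how values are carried across program parts below. -/
theorem Run.frame {E : Env} {p : Cmd} {s s' : Store} {t : ℕ} (h : Run E p s s' t) :
    Frame E p s s' := by
  refine ⟨?_, ?_, h.bdd⟩
  · induction h with
    | skip | whileFalse | setNum => exact fun _ _ => rfl
    | setIdx | query =>
      intro b hb
      simp only [Cmd.wI, beq_eq_false_iff_ne] at hb
      simp [Store.setIdx, Function.update_of_ne hb.symm]
    | seq h1 h2 i1 i2 =>
      intro b hb
      simp only [Cmd.wI, Bool.or_eq_false_iff] at hb
      rw [i2 b hb.2, i1 b hb.1]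
    | iteTrue _ _ ih | iteFalse _ _ ih =>
      intro b hb
      simp only [Cmd.wI, Bool.or_eq_false_iff] at hb
      simp [ih b, hb]
    | whileTrue _ _ _ i1 i2 => exact fun b hb => (i2 b hb).trans (i1 b hb)
  · induction h with
    | skip | whileFalse | setIdx | query => exact fun _ _ => rfl
    | setNum =>
      intro b hb
      simp only [Cmd.wN, beq_eq_false_iff_ne] at hb
      simp [Store.setNum, Function.update_of_ne hb.symm]
    | seq h1 h2 i1 i2 =>
      intro b hb
      simp only [Cmd.wN, Bool.or_eq_false_iff] at hb
      rw [i2 b hb.2, i1 b hb.1]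
    | iteTrue _ _ ih | iteFalse _ _ ih =>
      intro b hb
      simp only [Cmd.wN, Bool.or_eq_false_iff] at hb
      simp [ih b, hb]
    | whileTrue _ _ _ i1 i2 => exact fun b hb => (i2 b hb).trans (i1 b hb)

/-! ## Triples -/

/-- Started in `s`, the program halts within time `T` in a store that satisfies `Q`. -/
def Tri (E : Env) (p : Cmd) (s : Store) (T : ℕ) (Q : Store → Prop) : Prop :=
  ∃ s' t, Run E p s s' t ∧ t ≤ T ∧ Q s'

variable {E : Env} {p q : Cmd} {s : Store} {T T' : ℕ} {Q Q' : Store → Prop}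

theorem Tri.mono (h : Tri E p s T Q) (hT : T ≤ T') (hQ : ∀ s', Frame E p s s' → Q s' → Q' s') :
    Tri E p s T' Q' := by
  obtain ⟨s', t, h1, h2, h3⟩ := h
  exact ⟨s', t, h1, h2.trans hT, hQ _ h1.frame h3⟩

theorem Tri.seq {T₁ T₂ : ℕ} {Q₁ : Store → Prop} (hp : Tri E p s T₁ Q₁)
    (hq : ∀ s', Frame E p s s' → Q₁ s' → Tri E q s' T₂ Q) (hT : T₁ + T₂ ≤ T) :
    Tri E (.seq p q) s T Q := by
  obtain ⟨s₁, t₁, h1, h2, h3⟩ := hp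
  obtain ⟨s₂, t₂, h4, h5, h6⟩ := hq s₁ h1.frame h3
  exact ⟨s₂, t₁ + t₂, .seq h1 h4, by omega, h6⟩

theorem Tri.ite {b : Test} {T₁ : ℕ} (hp : b.holds s → Tri E p s T₁ Q)
    (hq : ¬ b.holds s → Tri E q s T₁ Q) (hT : b.cost + T₁ + 1 ≤ T) :
    Tri E (.ite b p q) s T Q := by
  by_cases hb : b.holds s
  · obtain ⟨s', t, h1, h2, h3⟩ := hp hb
    exact ⟨s', _, .iteTrue hb h1, by omega, h3⟩
  · obtain ⟨s', t, h1, h2, h3⟩ := hq hb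
    exact ⟨s', _, .iteFalse hb h1, by omega, h3⟩

/-- The rule for loops; the invariant is indexed by a bound for the number of iterations. -/
theorem Tri.whileLoop {b : Test} {T₁ : ℕ} (Inv : ℕ → Store → Prop) (n : ℕ) (h0 : Inv n s)
    (hstep : ∀ k s', Frame E p s s' → Inv k s' → b.holds s' →
      Tri E p s' T₁ fun s'' => ∃ k' < k, Inv k' s'')
    (hQ : ∀ k s', Frame E p s s' → Inv k s' → ¬ b.holds s' → Q s')
    (hT : n * (b.cost + T₁ + 1) + b.cost + 1 ≤ T) :
    Tri E (.while b p) s T Q := by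
  suffices H : ∀ n s', Frame E p s s' → Inv n s' →
      Tri E (.while b p) s' (n * (b.cost + T₁ + 1) + b.cost + 1) Q by
    exact (H n s (.refl _ _ _) h0).mono hT fun _ _ h => h
  intro n
  induction n using Nat.strong_induction_on with
  | _ n ih =>
    intro s' hf hI
    by_cases hb : b.holds s'
    · obtain ⟨s₁, t₁, h1, h2, k, hk, h3⟩ := hstep n s' hf hI hb
      obtain ⟨s₂, t₂, h4, h5, h6⟩ := ih k hk s₁ (hf.trans h1.frame) h3
      refine ⟨s₂, _, .whileTrue hb h1 h4, ?_, h6⟩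
      have : (k + 1) * (b.cost + T₁ + 1) ≤ n * (b.cost + T₁ + 1) := Nat.mul_le_mul_right _ hk
      have e : (k + 1) * (b.cost + T₁ + 1) = k * (b.cost + T₁ + 1) + (b.cost + T₁ + 1) := by ring
      omega
    · exact ⟨s', _, .whileFalse hb, by omega, hQ n s' hf hI hb⟩

/-- The scalar variable `a`. -/
abbrev V (a : ℕ) : IdxExpr := .get a (.const 0)

/-- The scalar variable `a`. -/
abbrev X (a : ℕ) : NumExpr := .get a (.const 0)

/-- The loop `for i < n do p`, where `n` is in the variable `b`. -/
def forC (i b : ℕ) (p : Cmd) : Cmd :=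
  .seq (.setIdx i (.const 0) (.const 0))
    (.while (.idxLt (V i) (V b)) (.seq p (.setIdx i (.const 0) (.add (V i) (.const 1)))))

/-- The invariant for `k + 1` is required after the counter has been increased. Each round costs the
body plus 12 (test 5, increment 6, loop 1); the remaining 9 are the initialisation and the last,
failing test. -/
theorem Tri.forLoop {i b n T₁ : ℕ} (Inv : ℕ → Store → Prop)
    (hn : s.idx b 0 = n) (hN : n ≤ E.N) (hib : i ≠ b) (hi : p.wI i = false) (hb : p.wI b = false)
    (h0 : Inv 0 (s.setIdx i 0 0))
    (hstep : ∀ k s', k < n → Frame E (forC i b p) s s' → s'.idx i 0 = k → s'.idx b 0 = n → Inv k s' →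
      Tri E p s' T₁ fun s'' => Inv (k + 1) (s''.setIdx i 0 (k + 1)))
    (hQ : ∀ s', Frame E (forC i b p) s s' → Inv n s' → Q s')
    (hT : n * (T₁ + 12) + 9 ≤ T) :
    Tri E (forC i b p) s T Q := by
  have hfr : ∀ {s₁ s₂}, Frame E (.seq p (.setIdx i (.const 0) (.add (V i) (.const 1)))) s₁ s₂ →
      Frame E (forC i b p) s₁ s₂ := fun h =>
    h.mono (fun a => by simp [forC, Cmd.wI]) (fun a => by simp [forC, Cmd.wN])
  have h1 : Run E (.setIdx i (.const 0) (.const 0)) s (s.setIdx i 0 0) 3 :=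
    .setIdx s i (.const 0) (.const 0) (Nat.zero_le _)
  have h2 : Frame E (forC i b p) s (s.setIdx i 0 0) :=
    h1.frame.mono (fun a => by simp +contextual [forC, Cmd.wI])
      (fun a => by simp +contextual [forC, Cmd.wN])
  refine Tri.seq (T₁ := 3) (T₂ := n * (T₁ + 12) + 6) ⟨_, _, h1, le_rfl, rfl⟩ ?_ (by omega)
  rintro _ - rfl
  refine Tri.whileLoop (T₁ := T₁ + 6)
    (fun k s' => ∃ j, k + j = n ∧ s'.idx i 0 = j ∧ s'.idx b 0 = n ∧ Inv j s') n
    ⟨0, by simp, by simp [Store.setIdx], by simp [Store.setIdx, hib.symm, hn], h0⟩ ?_ ?_ ?_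
  · rintro k s' hf ⟨j, hkj, hj, hbn, hI⟩ hlt
    simp only [Test.holds, IdxExpr.val, hj, hbn] at hlt
    obtain ⟨s₁, t₁, r1, r2, r3⟩ := hstep j s' hlt (h2.trans (hfr hf)) hj hbn hI
    have e : s₁.idx i 0 = j := by rw [r1.frame.1 i hi, hj]
    refine ⟨_, _, .seq r1 (.setIdx s₁ i (.const 0) (.add (V i) (.const 1)) ?_), ?_, ?_⟩
    · simp only [IdxExpr.val, e]; omega
    · simp only [IdxExpr.cost]; omega
    · refine ⟨k - 1, by omega, j + 1, by omega, ?_⟩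
      simp only [IdxExpr.val, e]
      refine ⟨by simp [Store.setIdx], ?_, r3⟩
      simp [Store.setIdx, hib.symm, r1.frame.1 b hb, hbn]
  · rintro k s' hf ⟨j, hkj, hj, hbn, hI⟩ hlt
    simp only [Test.holds, IdxExpr.val, hj, hbn] at hlt
    obtain rfl : j = n := by omega
    exact hQ s' (h2.trans (hfr hf)) hI
  · simp only [Test.cost, IdxExpr.cost]
    have : n * (1 + 1 + (1 + 1) + 1 + (T₁ + 6) + 1) = n * (T₁ + 12) := by ring
    omega

/-! ### Programs without loops -/

open Classical in
/-- The store `s` if `P` holds and `s'` otherwise. -/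
noncomputable def Store.sel (P : Prop) (s s' : Store) : Store := if P then s else s'

@[simp] theorem Store.sel_true (s s' : Store) : Store.sel True s s' = s := if_pos trivial

@[simp] theorem Store.sel_false (s s' : Store) : Store.sel False s s' = s' := if_neg id

theorem Store.sel_pos {P : Prop} (h : P) (s s' : Store) : Store.sel P s s' = s := if_pos h

theorem Store.sel_neg {P : Prop} (h : ¬ P) (s s' : Store) : Store.sel P s s' = s' := if_neg h

open Classical in
/-- The answer of the oracle. -/
noncomputable def Env.ans (E : Env) (f : ℕ → ℕ) : ℕ := if E.O f then 1 else 0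

/-- The final store of a program without loops. -/
noncomputable def Cmd.ev (E : Env) : Cmd → Store → Store
  | .skip, s => s
  | .setIdx a i e, s => s.setIdx a (i.val s) (e.val s)
  | .setNum a i e, s => s.setNum a (i.val s) (e.val s)
  | .query r a, s => s.setIdx r 0 (E.ans (s.idx a))
  | .seq p q, s => q.ev E (p.ev E s)
  | .ite b p q, s => Store.sel (b.holds s) (p.ev E s) (q.ev E s)
  | .while _ _, s => s

/-- The program has no loops and all numbers that it stores are small enough. -/
def Cmd.ok (E : Env) : Cmd → Store → Prop
  | .skip, _ => True
  | .setIdx _ _ e, s => e.val s ≤ E.N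
  | .setNum _ _ e, s => rs (e.val s) ≤ E.β
  | .query _ _, _ => 1 ≤ E.N
  | .seq p q, s => p.ok E s ∧ q.ok E (p.ev E s)
  | .ite b p q, s => (b.holds s → p.ok E s) ∧ (¬ b.holds s → q.ok E s)
  | .while _ _, _ => False

/-- The running time of a program without loops. -/
def Cmd.fee (F : ℕ) : Cmd → ℕ
  | .skip => 1
  | .setIdx _ i e => i.cost + e.cost + 1
  | .setNum _ i e => i.cost + e.cost + 1
  | .query _ _ => F + 1
  | .seq p q => p.fee F + q.fee F
  | .ite b p q => b.cost + max (p.fee F) (q.fee F) + 1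
  | .while _ _ => 0

theorem Cmd.ok.tri {p : Cmd} : ∀ {s : Store}, p.ok E s →
    Tri E p s (p.fee E.F) fun s' => s' = p.ev E s := by
  induction p with
  | skip => exact fun _ => ⟨_, _, .skip _, le_rfl, rfl⟩
  | setIdx a i e => exact fun h => ⟨_, _, .setIdx _ a i e h, le_rfl, rfl⟩
  | setNum a i e => exact fun h => ⟨_, _, .setNum _ a i e h, le_rfl, rfl⟩
  | query r a => exact fun h => ⟨_, _, .query _ r a h, le_rfl, rfl⟩
  | seq p q hp hq =>
    refine fun h => (hp h.1).seq ?_ le_rfl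
    rintro _ - rfl
    exact hq h.2
  | ite b p q hp hq =>
    intro s h
    refine Tri.ite (T₁ := max (p.fee E.F) (q.fee E.F)) (fun hb => ?_) (fun hb => ?_) le_rfl
    · exact (hp (h.1 hb)).mono (le_max_left _ _) fun s' _ e => by simp [e, Cmd.ev, hb]
    · exact (hq (h.2 hb)).mono (le_max_right _ _) fun s' _ e => by simp [e, Cmd.ev, hb]
  | _ => exact fun h => h.elim

/-- Symbolic execution of straight-line code: safety, cost and final store are all computed by
recursion on the program, so that `simp` can settle them. -/
theorem Tri.line (h : p.ok E s) (hT : p.fee E.F ≤ T) (hQ : Q (p.ev E s)) : Tri E p s T Q :=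
  h.tri.mono hT fun _ _ e => e ▸ hQ

theorem Tri.runsWithin {O : (ℕ → ℕ) → Prop} {F N β W : ℕ} (h : Tri ⟨O, F, N, β⟩ p s T Q)
    (hs : s.Bdd N β) (hW : p.Fits (W * (N + β + 1)) N β) {T' B : ℝ} (hT : (T : ℝ) ≤ T')
    (hB : ((W * (N + β + 1) : ℕ) : ℝ) ≤ B) : RunsWithin O F p s T' B Q := by
  obtain ⟨s', t, h1, h2, h3⟩ := h
  exact ⟨_, t, s', h1.exec hW hs, hB, le_trans (by exact_mod_cast h2) hT, h3⟩

/-! ### Access to updated stores -/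

@[simp] theorem Store.setIdx_num (s : Store) (a i v : ℕ) : (s.setIdx a i v).num = s.num := rfl

@[simp] theorem Store.setNum_idx (s : Store) (a i : ℕ) (v : ℚ) : (s.setNum a i v).idx = s.idx := rfl

theorem Store.setIdx_idx (s : Store) (a i v b : ℕ) :
    (s.setIdx a i v).idx b = if b = a then Function.update (s.idx a) i v else s.idx b := by
  simp only [Store.setIdx, Function.update_apply]

theorem Store.setNum_num (s : Store) (a i : ℕ) (v : ℚ) (b : ℕ) :
    (s.setNum a i v).num b = if b = a then Function.update (s.num a) i v else s.num b := by
  simp only [Store.setNum, Function.update_apply]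

/-! ## Sorting with a tournament tree -/

/-- The leaf value `a` beats the leaf value `b`; values that are not less than `n` are void. -/
def Beats (n : ℕ) (key : ℕ → ℚ) (a b : ℕ) : Prop := b < n → a < n ∧ key a ≤ key b

theorem Beats.refl {n : ℕ} {key : ℕ → ℚ} (a : ℕ) : Beats n key a a := fun h => ⟨h, le_rfl⟩

theorem Beats.trans {n : ℕ} {key : ℕ → ℚ} {a b c : ℕ} (h : Beats n key a b)
    (h' : Beats n key b c) : Beats n key a c :=
  fun hc => ⟨(h (h' hc).1).1, (h (h' hc).1).2.trans (h' hc).2⟩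

/-- At the node `v` of the tree `t` the better one of the values of the children is stored. -/
def Node (n : ℕ) (key : ℕ → ℚ) (t : ℕ → ℕ) (v : ℕ) : Prop :=
  (t v = t (2 * v) ∨ t v = t (2 * v + 1)) ∧ Beats n key (t v) (t (2 * v)) ∧
    Beats n key (t v) (t (2 * v + 1))

/-- Climb from `v` to the parent `v / 2` and use transitivity. The leaves are the positions from `n`
to `2 * n - 1`; `n` need not be a power of two. -/
theorem Node.root_beats {n : ℕ} {key : ℕ → ℚ} {t : ℕ → ℕ}
    (h : ∀ v, 1 ≤ v → v < n → Node n key t v) (v : ℕ) (hv : 1 ≤ v) (hv' : v < 2 * n) :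
    Beats n key (t 1) (t v) := by
  induction v using Nat.strong_induction_on with
  | _ v ih =>
    rcases eq_or_lt_of_le hv with rfl | h1
    · exact .refl _
    · have h2 := ih (v / 2) (by omega) (by omega) (by omega)
      have h3 := h (v / 2) (by omega) (by omega)
      rcases Nat.mod_two_eq_zero_or_one v with h4 | h4
      · have h5 := h3.2.1
        rw [show 2 * (v / 2) = v by omega] at h5
        exact h2.trans h5
      · have h5 := h3.2.2
        rw [show 2 * (v / 2) + 1 = v by omega] at h5
        exact h2.trans h5

/-- Descend from `v` to the child whose value it carries. The number `k` is fuel: positions grow on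
the way down and stay below `2 * n`. -/
theorem Node.exists_leaf {n : ℕ} {key : ℕ → ℚ} {t : ℕ → ℕ}
    (h : ∀ v, 1 ≤ v → v < n → Node n key t v) (k v : ℕ) (hk : 2 * n ≤ v + k) (hv : 1 ≤ v)
    (hv' : v < 2 * n) : ∃ x < n, t v = t (n + x) := by
  induction k generalizing v with
  | zero => omega
  | succ k ih =>
    rcases lt_or_ge v n with h1 | h1
    · rcases (h v hv h1).1 with h2 | h2
      · rw [h2]; exact ih _ (by omega) (by omega) (by omega)
      · rw [h2]; exact ih _ (by omega) (by omega) (by omega)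
    · exact ⟨v - n, by omega, by rw [Nat.add_sub_cancel' h1]⟩

/-- Recompute the entry of node `idx 15 0` of the tree. -/
def winner (κ : ℕ) : Cmd :=
  .seq (.setIdx 16 (.const 0) (.get 11 (.mul (.const 2) (V 15))))
  (.seq (.setIdx 17 (.const 0) (.get 11 (.add (.mul (.const 2) (V 15)) (.const 1))))
  (.ite (.and (.idxLt (V 17) (V 10)) (.not (.and (.idxLt (V 16) (V 10))
      (.not (.numLt (.get κ (V 17)) (.get κ (V 16)))))))
    (.setIdx 11 (V 15) (V 17)) (.setIdx 11 (V 15) (V 16))))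

theorem winner_tri {E : Env} (κ : ℕ) {s : Store} (hs : s.Bdd E.N E.β) {v n : ℕ}
    (hv : s.idx 15 0 = v) (hv1 : 1 ≤ v) (hn : s.idx 10 0 = n) :
    Tri E (winner κ) s 60 fun s' => s'.idx 15 0 = v ∧
      (∀ u, u ≠ v → s'.idx 11 u = s.idx 11 u) ∧ Node n (s.num κ) (s'.idx 11) v := by
  classical
  refine Tri.line ?_ ?_ ?_
  · simp only [winner, Cmd.ok, IdxExpr.val, Cmd.ev]
    refine ⟨hs.1 _ _, ?_, fun _ => ?_, fun _ => ?_⟩ <;>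
    simp [Store.setIdx_idx, hs.1]
  · simp [winner, Cmd.fee, Test.cost, IdxExpr.cost, NumExpr.cost]
  · have h1 : 2 * v ≠ v := by omega
    have h2 : 2 * v + 1 ≠ v := by omega
    -- The test of the program in positive form: the right child wins only if it is valid and the
    -- left one is void or strictly larger.
    by_cases h : s.idx 11 (2 * v + 1) < n ∧ (s.idx 11 (2 * v) < n →
        s.num κ (s.idx 11 (2 * v + 1)) < s.num κ (s.idx 11 (2 * v)))
    all_goals
      simp [winner, Cmd.ev, IdxExpr.val, NumExpr.val, Test.holds, Store.setIdx_idx, hv, hn]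
      first | simp only [Store.sel_pos h] | simp only [Store.sel_neg h]
      simp [Store.setIdx_idx]
      refine ⟨hv, fun u hu => by rw [Function.update_of_ne hu], ?_⟩
      simp only [Node, Function.update_self, Function.update_of_ne h1, Function.update_of_ne h2,
        true_or, or_true, true_and, Beats.refl, and_true]
    · exact fun h3 => ⟨h.1, (h.2 h3).le⟩
    · intro h3
      simp only [not_and, not_forall, not_lt, exists_prop] at h
      exact h h3

/-- Initialise the leaves of the tree and the table of halves. -/
def treeInit : Cmd :=
  forC 14 10 (.seq (.setIdx 11 (.add (V 10) (V 14)) (V 14))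
    (.seq (.setIdx 12 (.mul (.const 2) (V 14)) (V 14))
    (.setIdx 12 (.add (.mul (.const 2) (V 14)) (.const 1)) (V 14))))

theorem treeInit_tri {E : Env} {s : Store} {n : ℕ} (hn : s.idx 10 0 = n) (hN : n ≤ E.N) :
    Tri E treeInit s (n * 60 + 10) fun s' =>
      (∀ x < n, s'.idx 11 (n + x) = x) ∧ ∀ v < 2 * n, s'.idx 12 v = v / 2 := by
  refine Tri.forLoop (T₁ := 40) (fun k s => (∀ x < k, s.idx 11 (n + x) = x) ∧
    ∀ v < 2 * k, s.idx 12 v = v / 2) hn hN (by decide) rfl rfl (by simp) ?_ (fun _ _ h => h)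
    (by omega)
  rintro k s' hk hf hi hb ⟨h1, h2⟩
  refine Tri.line ?_ ?_ ?_
  · simp [Cmd.ok, IdxExpr.val, Cmd.ev, Store.setIdx_idx, hi]; omega
  · simp [Cmd.fee, IdxExpr.cost]
  · simp [IdxExpr.val, Cmd.ev, Store.setIdx_idx, hi, hb, Function.update_apply]
    refine ⟨fun x hx => ?_, fun v hv => ?_⟩
    · split_ifs with h
      · omega
      · exact h1 x (by omega)
    · split_ifs with h h'
      · omega
      · omega
      · exact h2 v (by omega)

/-- Compute the entries of all inner nodes of the tree. -/
def treeBuild (κ : ℕ) : Cmd :=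
  .seq (.setIdx 15 (.const 0) (V 10))
    (.while (.idxLt (.const 1) (V 15))
      (.seq (.setIdx 15 (.const 0) (.sub (V 15) (.const 1))) (winner κ)))

theorem treeBuild_tri {E : Env} (κ : ℕ) {s : Store} (hs : s.Bdd E.N E.β) {n : ℕ}
    (hn : s.idx 10 0 = n) (hn1 : 1 ≤ n) (h : ∀ x < n, s.idx 11 (n + x) = x) :
    Tri E (treeBuild κ) s (n * 80 + 20) fun s' =>
      (∀ x < n, s'.idx 11 (n + x) = x) ∧
        ∀ v, 1 ≤ v → v < n → Node n (s.num κ) (s'.idx 11) v := by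
  have hN : n ≤ E.N := hn ▸ hs.1 10 0
  refine Tri.seq (T₁ := 5) (T₂ := n * 74 + 5) (Q₁ := fun s' => s' = s.setIdx 15 0 n)
    (Tri.line ?_ ?_ ?_) ?_ ?_
  · simp [Cmd.ok, IdxExpr.val, hn, hN]
  · simp [Cmd.fee, IdxExpr.cost]
  · simp [Cmd.ev, IdxExpr.val, hn]
  · rintro _ - rfl
    -- Nodes are treated from right to left. Writing at `v - 1` cannot spoil a finished node, since
    -- such a node and its children have larger indices.
    refine Tri.whileLoop (T₁ := 69) (fun v s' => s'.idx 15 0 = v ∧ 1 ≤ v ∧ v ≤ n ∧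
      (∀ x < n, s'.idx 11 (n + x) = x) ∧
      ∀ u, v ≤ u → u < n → Node n (s.num κ) (s'.idx 11) u) n ?_ ?_ ?_ ?_
    · refine ⟨by simp [Store.setIdx_idx], hn1, le_rfl, by simpa [Store.setIdx_idx] using h, ?_⟩
      intro u _ _; omega
    · rintro v s' hf ⟨hv, hv1, hvn, h1, h2⟩ hb
      simp only [Test.holds, IdxExpr.val, hv] at hb
      have hs' : s'.Bdd E.N E.β := hf.2.2 (hs.setIdx hN)
      have hvN := hs'.1 15 0
      refine Tri.seq (T₁ := 9) (T₂ := 60) (Q₁ := fun s'' => s'' = s'.setIdx 15 0 (v - 1))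
        (Tri.line ?_ ?_ ?_) ?_ le_rfl
      · simp [Cmd.ok, IdxExpr.val]; omega
      · simp [Cmd.fee, IdxExpr.cost]
      · simp [Cmd.ev, IdxExpr.val, hv]
      · rintro _ - rfl
        refine (winner_tri κ (v := v - 1) (n := n) (hs'.setIdx (by omega))
          (by simp [Store.setIdx_idx]) (by omega) ?_).mono le_rfl ?_
        · simp [Store.setIdx_idx, hf.1 10 rfl, hn]
        · rintro s₁ - ⟨g1, g2, g3⟩
          simp only [Store.setIdx_num, hf.2.1 κ rfl] at g3
          have g2' : ∀ u, u ≠ v - 1 → s₁.idx 11 u = s'.idx 11 u := fun u hu => by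
            simp [g2 u hu, Store.setIdx_idx]
          refine ⟨v - 1, by omega, g1, by omega, by omega, fun x hx => ?_, fun u hu hun => ?_⟩
          · rcases eq_or_ne (n + x) (v - 1) with h3 | h3
            · omega
            · rw [g2' _ h3, h1 x hx]
          · rcases eq_or_ne u (v - 1) with rfl | h3
            · exact g3
            · have := h2 u (by omega) hun
              simp only [Node] at this ⊢
              rwa [g2' u (by omega), g2' (2 * u) (by omega), g2' (2 * u + 1) (by omega)]
    · rintro v s' hf ⟨hv, hv1, hvn, h1, h2⟩ hb
      simp only [Test.holds, IdxExpr.val, hv] at hb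
      obtain rfl : v = 1 := by omega
      exact ⟨h1, h2⟩
    · simp [Test.cost, IdxExpr.cost]
  · omega

/-- Move the winner of the tree to the end of the output and remove it from the tree. -/
def treePop (κ : ℕ) : Cmd :=
  .seq (.seq (.setIdx 13 (V 14) (.get 11 (.const 1)))
    (.seq (.setIdx 15 (.const 0) (.add (V 10) (.get 11 (.const 1))))
      (.setIdx 11 (V 15) (V 10))))
    (.while (.idxLt (.const 1) (V 15))
      (.seq (.setIdx 15 (.const 0) (.get 12 (V 15))) (winner κ)))

theorem treePop_tri {E : Env} (κ : ℕ) {s : Store} (hs : s.Bdd E.N E.β) {n k : ℕ}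
    (hn : s.idx 10 0 = n) (hN : 2 * n ≤ E.N) (hk : s.idx 14 0 = k)
    (half : ∀ v < 2 * n, s.idx 12 v = v / 2) (h : ∀ v, 1 ≤ v → v < n → Node n (s.num κ) (s.idx 11) v)
    (h1 : s.idx 11 1 < n) :
    Tri E (treePop κ) s (Nat.size n * 80 + 30) fun s' =>
      s'.idx 13 = Function.update (s.idx 13) k (s.idx 11 1) ∧
      (∀ x < n, s'.idx 11 (n + x) = if x = s.idx 11 1 then n else s.idx 11 (n + x)) ∧
        ∀ v, 1 ≤ v → v < n → Node n (s.num κ) (s'.idx 11) v := by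
  set r := s.idx 11 1 with hr
  refine Tri.seq (T₁ := 20) (T₂ := Nat.size n * 74 + 5)
    (Q₁ := fun s' => s'.idx 13 = Function.update (s.idx 13) k r ∧
      s'.idx 11 = Function.update (s.idx 11) (n + r) n ∧ s'.idx 15 0 = n + r)
    (Tri.line ?_ ?_ ?_) ?_ ?_
  · simp [Cmd.ok, Cmd.ev, IdxExpr.val, Store.setIdx_idx, hn, ← hr]; omega
  · simp [Cmd.fee, IdxExpr.cost]
  · simp [Cmd.ev, IdxExpr.val, Store.setIdx_idx, hn, hk, ← hr]
  · rintro s₁ hf₁ ⟨f1, f2, f3⟩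
    have hs₁ := hf₁.2.2 hs
    -- While climbing from the emptied leaf, only the parent of the current node `v` may be wrong.
    -- As `v < 2 ^ (f + 1)` and each step halves `v`, `Nat.size n` rounds reach the root.
    refine Tri.whileLoop (T₁ := 69) (fun f s' => ∃ v, s'.idx 15 0 = v ∧ 1 ≤ v ∧ v < 2 * n ∧
      v < 2 ^ (f + 1) ∧ (∀ x < n, s'.idx 11 (n + x) = if x = r then n else s.idx 11 (n + x)) ∧
      ∀ u, 1 ≤ u → u < n → u ≠ v / 2 → Node n (s.num κ) (s'.idx 11) u) (Nat.size n) ?_ ?_ ?_ ?_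
    · refine ⟨n + r, f3, by omega, by omega, ?_, fun x hx => ?_, fun u hu hun hu' => ?_⟩
      · have := Nat.lt_size_self n
        rw [pow_succ]; omega
      · simp [f2, Function.update_apply]
      · have := h u hu hun
        simp only [Node, f2] at this ⊢
        rwa [Function.update_of_ne (by omega), Function.update_of_ne (by omega),
          Function.update_of_ne (by omega)]
    · rintro f s' hf ⟨v, hv, hv1, hvn, hvf, g1, g2⟩ hb
      simp only [Test.holds, IdxExpr.val, hv] at hb
      have hs' : s'.Bdd E.N E.β := hf.2.2 hs₁
      have e12 : s'.idx 12 v = v / 2 := by rw [hf.1 12 rfl, hf₁.1 12 rfl, half v hvn]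
      refine Tri.seq (T₁ := 9) (T₂ := 60) (Q₁ := fun s'' => s'' = s'.setIdx 15 0 (v / 2))
        (Tri.line ?_ ?_ ?_) ?_ le_rfl
      · simp [Cmd.ok, IdxExpr.val, hs'.1]
      · simp [Cmd.fee, IdxExpr.cost]
      · simp [Cmd.ev, IdxExpr.val, hv, e12]
      · rintro _ - rfl
        refine (winner_tri κ (v := v / 2) (n := n) (hs'.setIdx (by omega))
          (by simp [Store.setIdx_idx]) (by omega) ?_).mono le_rfl ?_
        · simp [Store.setIdx_idx, hf.1 10 rfl, hf₁.1 10 rfl, hn]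
        · rintro s₂ - ⟨k1, k2, k3⟩
          simp only [Store.setIdx_num, hf.2.1 κ rfl, hf₁.2.1 κ rfl] at k3
          have k2' : ∀ u, u ≠ v / 2 → s₂.idx 11 u = s'.idx 11 u := fun u hu => by
            simp [k2 u hu, Store.setIdx_idx]
          obtain ⟨f, rfl⟩ : ∃ g, f = g + 1 := by
            refine Nat.exists_eq_succ_of_ne_zero ?_
            rintro rfl; omega
          refine ⟨f, by omega, v / 2, k1, by omega, by omega, ?_, fun x hx => ?_,
            fun u hu hun hu' => ?_⟩
          · rw [pow_succ] at hvf; omega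
          · rw [k2' _ (by omega), g1 x hx]
          · rcases eq_or_ne u (v / 2) with rfl | h3
            · exact k3
            · have := g2 u hu hun h3
              simp only [Node] at this ⊢
              rwa [k2' u (by omega), k2' (2 * u) (by omega), k2' (2 * u + 1) (by omega)]
    · rintro f s' hf ⟨v, hv, hv1, hvn, hvf, g1, g2⟩ hb
      simp only [Test.holds, IdxExpr.val, hv] at hb
      obtain rfl : v = 1 := by omega
      exact ⟨by rw [hf.1 13 rfl, f1], g1, fun u hu hun => g2 u hu hun (by omega)⟩
    · simp [Test.cost, IdxExpr.cost]
  · omega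

/-- Sort the indices below `idx 10 0` by the keys in the array `num κ`; the result is in `idx 13`. -/
def sort (κ : ℕ) : Cmd := .seq treeInit (.seq (treeBuild κ) (forC 14 10 (treePop κ)))

theorem sort_tri {E : Env} (κ : ℕ) {s : Store} (hs : s.Bdd E.N E.β) {n : ℕ}
    (hn : s.idx 10 0 = n) (hn1 : 1 ≤ n) (hN : 2 * n ≤ E.N) :
    Tri E (sort κ) s (310 * n * Nat.size n) fun s' =>
      (∀ i < n, s'.idx 13 i < n) ∧ (∀ i < n, ∀ j < i, s'.idx 13 j ≠ s'.idx 13 i) ∧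
        ∀ i < n, ∀ j < i, s.num κ (s'.idx 13 j) ≤ s.num κ (s'.idx 13 i) := by
  have hsz : 1 ≤ Nat.size n := Nat.size_pos.2 hn1
  refine Tri.seq (T₁ := n * 60 + 10) (T₂ := (n * 80 + 20) + (n * (Nat.size n * 80 + 30 + 12) + 9))
    (treeInit_tri hn (by omega)) ?_ ?_
  rintro s₁ hf₁ ⟨hl, hh⟩
  have hs₁ := hf₁.2.2 hs
  have hn₁ : s₁.idx 10 0 = n := by rw [hf₁.1 10 rfl, hn]
  refine Tri.seq (treeBuild_tri κ hs₁ hn₁ hn1 hl) ?_ le_rfl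
  rintro s₂ hf₂ ⟨hl₂, hb⟩
  have hs₂ := hf₂.2.2 hs₁
  have hn₂ : s₂.idx 10 0 = n := by rw [hf₂.1 10 rfl, hn₁]
  have hh₂ : ∀ v < 2 * n, s₂.idx 12 v = v / 2 := by rwa [hf₂.1 12 rfl]
  have hκ₂ : s₂.num κ = s.num κ := by rw [hf₂.2.1 κ rfl, hf₁.2.1 κ rfl]
  rw [hf₁.2.1 κ rfl] at hb
  -- Each element is either at its leaf and not yet output, or its leaf holds the void value `n` and
  -- it has been output. The last clause, that output keys do not exceed remaining ones, is what
  -- makes the output sorted.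
  refine Tri.forLoop (fun k s' =>
    (∀ v, 1 ≤ v → v < n → Node n (s.num κ) (s'.idx 11) v) ∧
    (∀ x < n, (s'.idx 11 (n + x) = x ∧ ∀ i < k, s'.idx 13 i ≠ x) ∨
      (s'.idx 11 (n + x) = n ∧ ∃ i < k, s'.idx 13 i = x)) ∧
    (∀ i < k, s'.idx 13 i < n) ∧ (∀ i < k, ∀ j < i, s'.idx 13 j ≠ s'.idx 13 i) ∧
    (∀ i < k, ∀ j < i, s.num κ (s'.idx 13 j) ≤ s.num κ (s'.idx 13 i)) ∧
    ∀ i < k, ∀ x < n, (∀ j < k, s'.idx 13 j ≠ x) → s.num κ (s'.idx 13 i) ≤ s.num κ x)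
    hn₂ (by omega) (by decide) rfl rfl ?_ ?_ (fun s' _ h => ⟨h.2.2.1, h.2.2.2.1, h.2.2.2.2.1⟩) le_rfl
  · simp only [Store.setIdx_idx]
    refine ⟨by simpa using hb, fun x hx => .inl ⟨by simpa using hl₂ x hx, by simp⟩, ?_⟩
    simp
  · rintro k s' hk hf hi hn' ⟨g1, g2, g3, g4, g5, g6⟩
    have hκ : s'.num κ = s.num κ := by rw [hf.2.1 κ rfl, hκ₂]
    -- Pigeonhole: fewer than `n` elements have been output, so one remains and the root is not
    -- void.
    obtain ⟨x, hx, hxk⟩ : ∃ x < n, ∀ i < k, s'.idx 13 i ≠ x := by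
      by_contra hcon
      push Not at hcon
      have := Finset.card_le_card (s := Finset.range n) (t := (Finset.range k).image (s'.idx 13))
        fun x hx => by simpa using hcon x (Finset.mem_range.1 hx)
      have h2 := this.trans Finset.card_image_le
      simp at h2
      omega
    have root := Node.root_beats g1
    obtain ⟨y, hy, hty⟩ := Node.exists_leaf g1 (2 * n) 1 (by omega) le_rfl (by omega)
    have hlt : s'.idx 11 1 < n := by
      refine (root (n + x) (by omega) (by omega) ?_).1
      rcases g2 x hx with h | ⟨-, i, hi, h⟩
      · omega
      · exact absurd h (hxk i hi)
    have hy' : s'.idx 11 1 = y ∧ ∀ i < k, s'.idx 13 i ≠ y := by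
      rcases g2 y hy with h | ⟨h, -⟩
      · rw [hty]; exact h
      · omega
    obtain ⟨hy1, hyk⟩ := hy'
    have hmin : ∀ x < n, (∀ i < k, s'.idx 13 i ≠ x) → s.num κ y ≤ s.num κ x := by
      intro x hx hxk
      rcases g2 x hx with h | ⟨-, i, hi, h⟩
      · have := root (n + x) (by omega) (by omega) (by omega)
        rw [h.1, hy1] at this
        exact this.2
      · exact absurd h (hxk i hi)
    refine (treePop_tri κ (hf.2.2 hs₂) hn' hN hi (by rwa [hf.1 12 rfl]) (by rwa [hκ]) hlt).mono
      le_rfl ?_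
    rintro s₃ - ⟨p1, p2, p3⟩
    rw [hκ] at p3
    simp only [hy1] at p1 p2
    have q : ∀ i < k, s₃.idx 13 i = s'.idx 13 i := fun i hi => by
      rw [p1, Function.update_of_ne hi.ne]
    have q' : s₃.idx 13 k = y := by rw [p1, Function.update_self]
    simp only [Store.setIdx_idx, show ¬ (13 = 14) by decide, show ¬ (11 = 14) by decide, if_false]
    refine ⟨p3, fun x hx => ?_, fun i hi => ?_, fun i hi j hj => ?_, fun i hi j hj => ?_,
      fun i hi x hx hxk => ?_⟩
    · rw [p2 x hx]
      split_ifs with hxy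
      · exact .inr ⟨rfl, k, by omega, by rw [q', hxy]⟩
      · rcases g2 x hx with h | ⟨h, i, hi, h'⟩
        · refine .inl ⟨h.1, fun i hi => ?_⟩
          rcases Nat.lt_succ_iff_lt_or_eq.1 hi with hi | rfl
          · rw [q i hi]; exact h.2 i hi
          · rw [q']; exact fun h => hxy h.symm
        · exact .inr ⟨h, i, by omega, by rw [q i hi, h']⟩
    · rcases Nat.lt_succ_iff_lt_or_eq.1 hi with hi | rfl
      · rw [q i hi]; exact g3 i hi
      · rw [q']; exact hy
    · rcases Nat.lt_succ_iff_lt_or_eq.1 hi with hi | rfl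
      · rw [q i hi, q j (by omega)]; exact g4 i hi j hj
      · rw [q', q j (by omega)]; exact hyk j hj
    · rcases Nat.lt_succ_iff_lt_or_eq.1 hi with hi | rfl
      · rw [q i hi, q j (by omega)]; exact g5 i hi j hj
      · rw [q', q j (by omega)]; exact g6 j hj y hy hyk
    · have hxk' : ∀ j < k, s'.idx 13 j ≠ x := fun j hj => by rw [← q j hj]; exact hxk j (by omega)
      rcases Nat.lt_succ_iff_lt_or_eq.1 hi with hi | rfl
      · rw [q i hi]; exact g6 i hi x hx hxk'
      · rw [q']; exact hmin x hx hxk'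
  · have h1 : n * (Nat.size n * 80 + 30 + 12) = 80 * (n * Nat.size n) + 42 * n := by ring
    have h2 : n ≤ n * Nat.size n := Nat.le_mul_of_pos_right _ hsz
    rw [h1, mul_assoc]
    omega

end OracleRAM

/-! ## The greedy algorithm for matroids -/

section Greedy

open Classical in
theorem greedySet_append_singleton {m : ℕ} (M : Matroid (Fin m)) (l : List (Fin m)) (e : Fin m) :
    greedySet M (l ++ [e]) = if M.Indep ((insert e (greedySet M l) : Finset (Fin m)) : Set (Fin m))
      then insert e (greedySet M l) else greedySet M l := by
  simp [greedySet, List.foldl_append]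

theorem greedySet_spec {m : ℕ} (M : Matroid (Fin m)) (l : List (Fin m)) :
    M.Indep (greedySet M l : Set (Fin m)) ∧ (∀ x ∈ greedySet M l, x ∈ l) ∧
      ∀ x ∈ l, x ∉ greedySet M l →
        ¬ M.Indep ((insert x (greedySet M l) : Finset (Fin m)) : Set (Fin m)) := by
  induction l using List.reverseRecOn with
  | nil => simp [greedySet]
  | append_singleton l e ih =>
    obtain ⟨h1, h2, h3⟩ := ih
    rw [greedySet_append_singleton]
    split_ifs with h
    · refine ⟨h, fun x hx => ?_, fun x hx hxn hI => ?_⟩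
      · rcases Finset.mem_insert.1 hx with rfl | hx
        · simp
        · simp [h2 x hx]
      · rw [Finset.mem_insert, not_or] at hxn
        rcases List.mem_append.1 hx with hx | hx
        · refine h3 x hx hxn.2 (hI.subset ?_)
          push_cast
          exact Set.insert_subset_insert (Set.subset_insert _ _)
        · exact hxn.1 (by simpa using hx)
    · refine ⟨h1, fun x hx => by simp [h2 x hx], fun x hx hxn => ?_⟩
      rcases List.mem_append.1 hx with hx | hx
      · exact h3 x hx hxn
      · obtain rfl : x = e := by simpa using hx
        exact h

/-- Otherwise the exchange axiom would add to the greedy set an element of the list that the greedy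
algorithm had rejected. -/
theorem greedySet_card_ge {m : ℕ} (M : Matroid (Fin m)) (l : List (Fin m)) {J : Finset (Fin m)}
    (hJ : M.Indep (J : Set (Fin m))) (hJl : ∀ x ∈ J, x ∈ l) : J.card ≤ (greedySet M l).card := by
  obtain ⟨h1, h2, h3⟩ := greedySet_spec M l
  by_contra! hlt
  obtain ⟨e, he, hI⟩ := h1.augment hJ (by simpa [Set.encard_coe_eq_coe_finsetCard] using hlt)
  refine h3 e (hJl e (by simpa using he.1)) (by simpa using he.2) ?_
  push_cast
  exact hI

/-- Summation by parts as an induction over prefixes: on every prefix the greedy set has at least as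
many elements as `J` does, and the surplus is charged at an upper bound `x` for the costs seen so
far. On the full list, with `J` a base, the surplus is zero and `x` disappears. -/
theorem sum_greedySet_le {m : ℕ} (M : Matroid (Fin m)) (d : Fin m → ℚ) (l : List (Fin m))
    (hn : l.Nodup) (hl : l.Pairwise fun i j => d i ≤ d j) {J : Finset (Fin m)}
    (hJ : M.Indep (J : Set (Fin m))) (x : ℚ) (hx : ∀ i ∈ l, d i ≤ x) :
    ∑ i ∈ greedySet M l, d i ≤ ∑ i ∈ J with i ∈ l, d i +
      ((greedySet M l).card - ({i ∈ J | i ∈ l} : Finset (Fin m)).card) * x := by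
  induction l using List.reverseRecOn generalizing x with
  | nil => simp [greedySet]
  | append_singleton l e ih =>
    rw [List.nodup_append] at hn
    rw [List.pairwise_append] at hl
    have hel : e ∉ l := fun h => hn.2.2 e h e (by simp) rfl
    have heG : e ∉ greedySet M l := fun h => hel ((greedySet_spec M l).2.1 e h)
    -- In the shorter prefix the surplus is charged at `d e`, the largest cost so far; `hmul` then
    -- raises the price from `d e` to `x`.
    have ih' := ih hn.1 hl.1 (d e) fun i hi => hl.2.2 i hi e (by simp)
    have hcard : (({i ∈ J | i ∈ l ++ [e]} : Finset (Fin m)).card : ℚ) ≤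
        (greedySet M (l ++ [e])).card := by
      exact_mod_cast greedySet_card_ge M (l ++ [e])
        (hJ.subset (by exact_mod_cast Finset.filter_subset _ _)) (fun i hi => (Finset.mem_filter.1 hi).2)
    have hmul := mul_le_mul_of_nonneg_left (hx e (by simp)) (sub_nonneg.2 hcard)
    refine le_trans ?_ (add_le_add_right hmul _)
    -- With every element charged relative to `d e`, the new element contributes zero on either
    -- side, whether or not it is chosen.
    have hJe : ∑ i ∈ J with i ∈ l ++ [e], d i - ({i ∈ J | i ∈ l ++ [e]} : Finset (Fin m)).card * d e
        = ∑ i ∈ J with i ∈ l, d i - ({i ∈ J | i ∈ l} : Finset (Fin m)).card * d e := by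
      by_cases heJ : e ∈ J
      · have : ({i ∈ J | i ∈ l ++ [e]} : Finset (Fin m)) = insert e {i ∈ J | i ∈ l} := by
          ext i; simp only [Finset.mem_filter, List.mem_append, List.mem_singleton,
            Finset.mem_insert]
          constructor
          · tauto
          · rintro (rfl | h)
            · exact ⟨heJ, .inr rfl⟩
            · exact ⟨h.1, .inl h.2⟩
        rw [this, Finset.sum_insert (by simp [hel]), Finset.card_insert_of_notMem (by simp [hel])]
        push_cast; ring
      · have : ({i ∈ J | i ∈ l ++ [e]} : Finset (Fin m)) = {i ∈ J | i ∈ l} := by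
          ext i; simp only [Finset.mem_filter, List.mem_append, List.mem_singleton]
          constructor
          · rintro ⟨h, h' | rfl⟩
            · exact ⟨h, h'⟩
            · exact absurd h heJ
          · tauto
        rw [this]
    have hGe : ∑ i ∈ greedySet M (l ++ [e]), d i - (greedySet M (l ++ [e])).card * d e
        = ∑ i ∈ greedySet M l, d i - (greedySet M l).card * d e := by
      rw [greedySet_append_singleton]
      split_ifs
      · rw [Finset.sum_insert heG, Finset.card_insert_of_notMem heG]
        push_cast; ring
      · rfl
    linarith

theorem greedySet_isBase {m : ℕ} {M : Matroid (Fin m)} {l : List (Fin m)}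
    (hl : ∀ i, i ∈ l) : M.IsBase (greedySet M l : Set (Fin m)) := by
  obtain ⟨h1, h2, h3⟩ := greedySet_spec M l
  refine h1.isBase_of_forall_insert fun e he => ?_
  have := h3 e (hl e) (by simpa using he.2)
  rwa [Finset.coe_insert] at this

theorem greedySet_min {m : ℕ} {M : Matroid (Fin m)} (d : Fin m → ℚ)
    {l : List (Fin m)} (hn : l.Nodup) (hl : ∀ i, i ∈ l) (hp : l.Pairwise fun i j => d i ≤ d j)
    {J : Finset (Fin m)} (hJ : M.IsBase (J : Set (Fin m))) :
    ∑ i ∈ greedySet M l, d i ≤ ∑ i ∈ J, d i := by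
  have hc : (greedySet M l).card = J.card := by
    have := (greedySet_isBase hl).ncard_eq_ncard_of_isBase hJ
    simpa using this
  obtain ⟨x, hx⟩ : ∃ x, ∀ i, d i ≤ x := by
    rcases Nat.eq_zero_or_pos m with rfl | h
    · exact ⟨0, fun i => i.elim0⟩
    · have : Nonempty (Fin m) := ⟨⟨0, h⟩⟩
      exact (Set.finite_range d).bddAbove.imp fun x hx i => hx ⟨i, rfl⟩
  have := sum_greedySet_le M d l hn hp hJ.indep x fun i _ => hx i
  simpa [hl, hc] using this

end Greedy

namespace OracleRAM

/-! ### The greedy algorithm on the machine. -/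

theorem Store.mem_outputSet {m : ℕ} {s : Store} {i : Fin m} :
    i ∈ s.outputSet m ↔ s.idx 1 i ≠ 0 := by
  simp [Store.outputSet]

/-- Try to add the `idx 18 0`-th element in the sorted order. -/
def greedyStep : Cmd :=
  .seq (.setIdx 20 (.const 0) (.get 13 (V 18)))
  (.seq (.setIdx 1 (V 20) (.const 1))
  (.seq (.query 19 1)
  (.ite (.idxLt (V 19) (.const 1)) (.setIdx 1 (V 20) (.const 0)) .skip)))

/-- The greedy algorithm for the costs in the array `num κ`; the result is in `idx 1`. -/
def greedy (κ : ℕ) : Cmd :=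
  .seq (.setIdx 10 (.const 0) (V 0))
  (.seq (sort κ)
  (.seq (forC 18 0 (.setIdx 1 (V 18) (.const 0)))
  (forC 18 0 greedyStep)))

theorem greedyStep_tri {m : ℕ} {M : Matroid (Fin m)} {F N β : ℕ} {s : Store} (hN : m ≤ N)
    {k : ℕ} (hk : s.idx 18 0 = k) {e : Fin m} (he : s.idx 13 k = e) (heI : e ∉ s.outputSet m)
    {l : List (Fin m)} (hl : s.outputSet m = greedySet M l) :
    Tri ⟨indepOracle M, F, N, β⟩ greedyStep s (F + 40) fun s' =>
      s'.outputSet m = greedySet M (l ++ [e]) := by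
  classical
  have hm := e.pos
  have hem := e.isLt
  have hins : {i : Fin m | Function.update (s.idx 1) e 1 i ≠ 0} =
      ((insert e (greedySet M l) : Finset (Fin m)) : Set (Fin m)) := by
    ext i
    rw [← hl]
    rcases eq_or_ne i e with rfl | h
    · simp
    · have h' : (i : ℕ) ≠ e := fun h' => h (Fin.ext h')
      simp [Function.update_of_ne h', h, Store.mem_outputSet]
  refine Tri.line ?_ ?_ ?_
  · simp [greedyStep, Cmd.ok, Cmd.ev, IdxExpr.val, Store.setIdx_idx, hk, he]
    omega
  · simp [greedyStep, Cmd.fee, Test.cost, IdxExpr.cost]; omega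
  · rw [greedySet_append_singleton]
    simp only [greedyStep, Cmd.ev, IdxExpr.val, Store.setIdx_idx, hk, he, Test.holds, Env.ans]
    simp only [indepOracle, if_true, Function.update_self, show ¬ (1 = 20) by decide,
      if_false, hins, show ¬ (20 = 1) by decide,
      show ¬ (20 = 19) by decide]
    split_ifs with h
    · simp only [lt_irrefl, Store.sel_false]
      ext i
      have := Set.ext_iff.1 hins i
      simpa [Store.mem_outputSet, Store.setIdx_idx] using this
    · simp only [zero_lt_one, Store.sel_true, ← hl]
      ext i
      rcases eq_or_ne i e with rfl | h
      · simpa [Store.mem_outputSet, Store.setIdx_idx] using heI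
      · have h' : (i : ℕ) ≠ e := fun h' => h (Fin.ext h')
        simp [Function.update_of_ne h', Store.mem_outputSet, Store.setIdx_idx]

theorem greedy_tri {m : ℕ} {M : Matroid (Fin m)} {F N β : ℕ} (κ : ℕ) {s : Store}
    (hs : s.Bdd N β) (hm : 1 ≤ m) (hsm : s.idx 0 0 = m) (hN : 2 * m ≤ N) :
    Tri ⟨indepOracle M, F, N, β⟩ (greedy κ) s (600 * (m * F + m * Nat.size m)) fun s' =>
      ∃ l : List (Fin m), l.Nodup ∧ (∀ i, i ∈ l) ∧
        l.Pairwise (fun i j : Fin m => s.num κ i ≤ s.num κ j) ∧ s'.outputSet m = greedySet M l := by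
  have hsz : 1 ≤ Nat.size m := Nat.size_pos.2 hm
  refine Tri.seq (T₁ := 4) (T₂ := 310 * m * Nat.size m + ((m * 20 + 9) + (m * (F + 60) + 9)))
    (Q₁ := fun s' => s' = s.setIdx 10 0 m) (Tri.line ?_ ?_ ?_) ?_ ?_
  · simp [Cmd.ok, IdxExpr.val, hsm]; omega
  · simp [Cmd.fee, IdxExpr.cost]
  · simp [Cmd.ev, IdxExpr.val, hsm]
  rintro _ hf₁ rfl
  have hs₁ := hf₁.2.2 hs
  refine Tri.seq (sort_tri κ hs₁ (n := m) (by simp [Store.setIdx_idx]) hm hN) ?_ le_rfl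
  rintro s₂ hf₂ ⟨ho1, ho2, ho3⟩
  have hm₂ : s₂.idx 0 0 = m := by rw [hf₂.1 0 rfl, hf₁.1 0 rfl, hsm]
  refine Tri.seq (T₂ := m * (F + 60) + 9) (Q₁ := fun s' => ∀ x < m, s'.idx 1 x = 0)
    (Tri.forLoop (T₁ := 8) (fun k s' => ∀ x < k, s'.idx 1 x = 0) hm₂ (by simp; omega) (by decide)
      rfl rfl (by simp) ?_ (fun _ _ h => h) (by omega)) ?_ le_rfl
  · rintro k s' hk hf hi hb h
    refine Tri.line (by simp [Cmd.ok, IdxExpr.val]) (by simp [Cmd.fee, IdxExpr.cost]) ?_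
    simp [Cmd.ev, IdxExpr.val, Store.setIdx_idx, hi, Function.update_apply]
    intro x hx hxk
    exact h x (by omega)
  rintro s₃ hf₃ h0
  have ho : s₃.idx 13 = s₂.idx 13 := hf₃.1 13 rfl
  rw [← ho] at ho1 ho2 ho3
  -- The sorted order as a function into `Fin m`; the default value does not occur for `k < m`.
  set o : ℕ → Fin m := fun k => if h : s₃.idx 13 k < m then ⟨s₃.idx 13 k, h⟩ else ⟨0, hm⟩ with hodef
  have ho' : ∀ k < m, (o k : ℕ) = s₃.idx 13 k := fun k hk => by simp [hodef, ho1 k hk]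
  have hinj : ∀ i < m, ∀ j < m, o i = o j → i = j := by
    intro i hi j hj hij
    have := congrArg Fin.val hij
    rw [ho' i hi, ho' j hj] at this
    rcases lt_trichotomy i j with h | h | h
    · exact absurd this (ho2 j hj i h)
    · exact h
    · exact absurd this.symm (ho2 i hi j h)
  refine Tri.forLoop (T₁ := F + 40) (fun k s' => s'.outputSet m = greedySet M ((List.range k).map o))
    (n := m) (by rw [hf₃.1 0 rfl, hm₂]) (by simp; omega) (by decide) rfl rfl ?_ ?_ ?_ (by
      exact Nat.add_le_add_right (Nat.mul_le_mul_left _ (by simp)) _)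
  · ext i
    simp [Store.mem_outputSet, Store.setIdx_idx, h0, greedySet]
  · rintro k s' hk hf hi hb h
    refine (greedyStep_tri (M := M) (e := o k) (by omega) hi ?_ ?_ h).mono le_rfl ?_
    · rw [hf.1 13 rfl, ho' k hk]
    · rw [h]
      intro hmem
      have := (greedySet_spec M _).2.1 _ hmem
      simp only [List.mem_map, List.mem_range] at this
      obtain ⟨j, hj, hjk⟩ := this
      exact absurd (hinj j (by omega) k hk hjk) (by omega)
    · rintro s'' - h''
      rw [List.range_succ, List.map_append, List.map_singleton, ← h'']
      ext i
      simp [Store.mem_outputSet, Store.setIdx_idx]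
  · rintro s' - h
    refine ⟨_, ?_, fun i => ?_, ?_, h⟩
    · rw [List.nodup_map_iff_inj_on List.nodup_range]
      intro i hi j hj
      simp only [List.mem_range] at hi hj
      exact hinj i hi j hj
    -- The sorted order is an injective self-map of a finite set, so every element is visited.
    · have hsurj : Function.Surjective fun k : Fin m => o k :=
        Finite.surjective_of_injective fun a b hab => Fin.ext (hinj a a.2 b b.2 hab)
      obtain ⟨k, hk⟩ := hsurj i
      exact List.mem_map.2 ⟨k, by simp, hk⟩
    · rw [List.pairwise_map]
      refine List.pairwise_lt_range.imp_of_mem fun {i j} hi hj hij => ?_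
      simp only [List.mem_range] at hi hj
      rw [ho' i hi, ho' j hj]
      exact ho3 j hj i hij
  · have h2 : m ≤ m * Nat.size m := Nat.le_mul_of_pos_right _ hsz
    have h3 : m * (F + 60) = m * F + m * 60 := by ring
    have h4 : 310 * m * Nat.size m = 310 * (m * Nat.size m) := by ring
    have h5 : 600 * (m * F + m * Nat.size m) = 600 * (m * F) + 600 * (m * Nat.size m) := by ring
    omega

/-! ## Bases of minimum parametric cost -/

/-- The sum of the entries of `f` over the set `I`. -/
def tot {m : ℕ} (f : ℕ → ℚ) (I : Finset (Fin m)) : ℚ := ∑ i ∈ I, f i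

/-- The elements of `I` that are less than `k`. -/
def below {m : ℕ} (k : ℕ) (I : Finset (Fin m)) : Finset (Fin m) := {i ∈ I | i.val < k}

theorem below_zero {m : ℕ} (I : Finset (Fin m)) : below 0 I = ∅ := by simp [below]

theorem below_self {m : ℕ} (I : Finset (Fin m)) : below m I = I := by simp [below]

theorem mem_below {m k : ℕ} {I : Finset (Fin m)} {i : Fin m} : i ∈ below k I ↔ i ∈ I ∧ i.val < k :=
  Finset.mem_filter

theorem below_succ_of_mem {m k : ℕ} {I : Finset (Fin m)} (hk : k < m) (h : ⟨k, hk⟩ ∈ I) :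
    below (k + 1) I = insert ⟨k, hk⟩ (below k I) := by
  ext i
  simp only [mem_below, Finset.mem_insert, Fin.ext_iff]
  constructor
  · rintro ⟨h1, h2⟩
    rcases Nat.lt_succ_iff_lt_or_eq.1 h2 with h2 | h2
    exacts [.inr ⟨h1, h2⟩, .inl h2]
  · rintro (h1 | h1)
    · obtain rfl : i = ⟨k, hk⟩ := Fin.ext h1
      exact ⟨h, Nat.lt_succ_self k⟩
    · exact ⟨h1.1, by omega⟩

theorem below_succ_of_notMem {m k : ℕ} {I : Finset (Fin m)} (hk : k < m) (h : ⟨k, hk⟩ ∉ I) :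
    below (k + 1) I = below k I := by
  ext i
  simp only [mem_below]
  refine and_congr_right fun hi => ⟨fun h2 => ?_, fun h2 => by omega⟩
  rcases Nat.lt_succ_iff_lt_or_eq.1 h2 with h2 | h2
  · exact h2
  · exact absurd (show i = ⟨k, hk⟩ from Fin.ext h2) (fun h' => h (h' ▸ hi))

theorem tot_insert_below {m k : ℕ} (f : ℕ → ℚ) {I : Finset (Fin m)} (hk : k < m) :
    tot f (insert ⟨k, hk⟩ (below k I)) = tot f (below k I) + f k := by
  rw [tot, Finset.sum_insert (by simp [mem_below]), add_comm]; rfl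

theorem rs_tot_le {m : ℕ} {f : ℕ → ℚ} {b : ℕ} (h : ∀ i < m, rs (f i) ≤ b) (I : Finset (Fin m)) :
    rs (tot f I) ≤ m * b + 2 :=
  (rs_sum_le I _ b fun i _ => h i i.2).trans
    (Nat.add_le_add_right (Nat.mul_le_mul_right _ ((Finset.card_le_univ _).trans (by simp))) _)

/-- Write the parametric costs `μ * y i - l * c i` to `num 5`. -/
def paramCosts : Cmd :=
  forC 21 0 (.setNum 5 (V 21) (.sub (.mul (X 6) (.get 4 (V 21))) (.mul (X 7) (.get 2 (V 21)))))

/-- Add up the entries of `num 4` and of `num 2` over the set in `idx 1`. -/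
def sumUp : Cmd :=
  .seq (.seq (.setNum 8 (.const 0) (.const 0)) (.setNum 9 (.const 0) (.const 0)))
  (forC 21 0 (.ite (.idxLt (.const 0) (.get 1 (V 21)))
    (.seq (.setNum 8 (.const 0) (.add (X 8) (.get 4 (V 21))))
      (.setNum 9 (.const 0) (.add (X 9) (.get 2 (V 21))))) .skip))

/-- Find a base that minimizes `μ * y(I) - l * c(I)`, and compute `y(I)` and `c(I)`. -/
def minBase : Cmd := .seq paramCosts (.seq (greedy 5) sumUp)

theorem paramCosts_tri {E : Env} {m b : ℕ} {s : Store} (hsm : s.idx 0 0 = m) (hN : m ≤ E.N)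
    (hy : ∀ i < m, rs (s.num 4 i) ≤ b) (hc : ∀ i < m, rs (s.num 2 i) ≤ b)
    (hμ : rs (s.num 6 0) ≤ b) (hl : rs (s.num 7 0) ≤ b) (hβ : 4 * b ≤ E.β) :
    Tri E paramCosts s (m * 40 + 9) fun s' =>
      ∀ i < m, s'.num 5 i = s.num 6 0 * s.num 4 i - s.num 7 0 * s.num 2 i := by
  refine Tri.forLoop (T₁ := 20) (fun k s' => ∀ i < k, s'.num 5 i =
    s.num 6 0 * s.num 4 i - s.num 7 0 * s.num 2 i) hsm hN (by decide) rfl rfl (by simp) ?_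
    (fun _ _ h => h) (by omega)
  intro k s' hk hf hi hb h
  refine Tri.line ?_ (by simp [Cmd.fee, IdxExpr.cost, NumExpr.cost]) ?_
  · simp only [Cmd.ok, IdxExpr.val, NumExpr.val, hi, hf.2.1 4 rfl, hf.2.1 2 rfl, hf.2.1 6 rfl,
      hf.2.1 7 rfl]
    have h1 := rs_sub_le (s.num 6 0 * s.num 4 k) (s.num 7 0 * s.num 2 k)
    have h2 := rs_mul_le (s.num 6 0) (s.num 4 k)
    have h3 := rs_mul_le (s.num 7 0) (s.num 2 k)
    have := hy k hk
    have := hc k hk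
    omega
  · simp only [Cmd.ev, IdxExpr.val, NumExpr.val, hi, hf.2.1 4 rfl, hf.2.1 2 rfl, hf.2.1 6 rfl,
      hf.2.1 7 rfl, Store.setIdx_num, Store.setNum_num, if_true, Function.update_apply]
    intro i hik
    split_ifs with h'
    · rw [h']
    · exact h i (by omega)

theorem sumUp_tri {E : Env} {m b : ℕ} {s : Store} (hsm : s.idx 0 0 = m) (hN : m ≤ E.N)
    (hy : ∀ i < m, rs (s.num 4 i) ≤ b) (hc : ∀ i < m, rs (s.num 2 i) ≤ b)
    (hβ : m * b + 2 ≤ E.β) :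
    Tri E sumUp s (m * 60 + 20) fun s' =>
      s'.num 8 0 = tot (s.num 4) (s.outputSet m) ∧ s'.num 9 0 = tot (s.num 2) (s.outputSet m) := by
  set I := s.outputSet m with hI
  refine Tri.seq (T₁ := 6) (T₂ := m * 60 + 9) (Q₁ := fun s' => s'.num 8 0 = 0 ∧ s'.num 9 0 = 0)
    (Tri.line ?_ ?_ ?_) ?_ (by omega)
  · simp [Cmd.ok, NumExpr.val, rs_zero]; omega
  · simp [Cmd.fee, IdxExpr.cost, NumExpr.cost]
  · simp [Cmd.ev, NumExpr.val, IdxExpr.val, Store.setNum_num]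
  rintro s₁ hf₁ ⟨h8, h9⟩
  refine Tri.forLoop (T₁ := 40) (fun k s' => s'.num 8 0 = tot (s.num 4) (below k I) ∧
    s'.num 9 0 = tot (s.num 2) (below k I)) (by rw [hf₁.1 0 rfl, hsm]) hN (by decide) rfl rfl
    (by simp [below_zero, tot, h8, h9]) ?_ (fun s' _ h => by rwa [below_self] at h) (by omega)
  rintro k s' hk hf hi hb ⟨g8, g9⟩
  have e4 : s'.num 4 = s.num 4 := by rw [hf.2.1 4 rfl, hf₁.2.1 4 rfl]
  have e2 : s'.num 2 = s.num 2 := by rw [hf.2.1 2 rfl, hf₁.2.1 2 rfl]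
  have e1 : s'.idx 1 = s.idx 1 := by rw [hf.1 1 rfl, hf₁.1 1 rfl]
  have hmem : (⟨k, hk⟩ : Fin m) ∈ I ↔ s.idx 1 k ≠ 0 := Store.mem_outputSet
  refine Tri.ite (T₁ := 20) (fun ht => ?_) (fun ht => ?_) (by simp [Test.cost, IdxExpr.cost])
  · have hk1 : 0 < s'.idx 1 k := by simpa [Test.holds, IdxExpr.val, hi] using ht
    rw [below_succ_of_mem hk (hmem.2 (by rw [← e1]; omega)), tot_insert_below, tot_insert_below,
      ← g8, ← g9, ← e4, ← e2]
    refine Tri.line ?_ (by simp [Cmd.fee, IdxExpr.cost, NumExpr.cost]) ?_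
    · simp only [Cmd.ok, Cmd.ev, IdxExpr.val, NumExpr.val, hi, Store.setNum_num, Store.setNum_idx,
        show ¬ (9 = 8) by decide, show ¬ (2 = 8) by decide, if_false, g8, g9, e4, e2,
        ← tot_insert_below (I := I) _ hk]
      exact ⟨(rs_tot_le hy _).trans hβ, (rs_tot_le hc _).trans hβ⟩
    · simp [Cmd.ev, IdxExpr.val, NumExpr.val, hi, Store.setNum_num]
  · have hk1 : s'.idx 1 k = 0 := by simpa [Test.holds, IdxExpr.val, hi] using ht
    rw [below_succ_of_notMem hk (fun h => hmem.1 h (by rw [← e1]; omega)), ← g8, ← g9]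
    exact Tri.line trivial (by simp [Cmd.fee]) ⟨rfl, rfl⟩

/-- `I` is a base that minimizes `μ * y(I) - l * c(I)`. -/
def IsMinBase {m : ℕ} (M : Matroid (Fin m)) (y c : ℕ → ℚ) (μ l : ℚ) (I : Finset (Fin m)) : Prop :=
  M.IsBase (I : Set (Fin m)) ∧ ∀ J : Finset (Fin m), M.IsBase (J : Set (Fin m)) →
    μ * tot y I - l * tot c I ≤ μ * tot y J - l * tot c J

/-- `I` is the result of the greedy algorithm for the costs `w`. -/
def IsGreedy {m : ℕ} (M : Matroid (Fin m)) (w : ℕ → ℚ) (I : Finset (Fin m)) : Prop :=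
  ∃ l : List (Fin m), l.Nodup ∧ (∀ i, i ∈ l) ∧ l.Pairwise (fun i j : Fin m => w i ≤ w j) ∧
    I = greedySet M l

/-- Greedy depends only on the order of its costs, so one run is optimal for every parameter whose
costs are ordered compatibly with `w`. -/
theorem IsGreedy.isMinBase {m : ℕ} {M : Matroid (Fin m)} {w y c : ℕ → ℚ} {μ l : ℚ}
    {I : Finset (Fin m)} (h : IsGreedy M w I)
    (hw : ∀ i < m, ∀ j < m, w i ≤ w j → μ * y i - l * c i ≤ μ * y j - l * c j) :
    IsMinBase M y c μ l I := by
  obtain ⟨L, h1, h2, h3, rfl⟩ := h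
  refine ⟨greedySet_isBase h2, fun J hJ => ?_⟩
  have := greedySet_min (fun i : Fin m => μ * y i - l * c i) h1 h2
    (h3.imp fun h => hw _ (Fin.is_lt _) _ (Fin.is_lt _) h) hJ
  simpa only [tot, Finset.sum_sub_distrib, ← Finset.mul_sum] using this

/-- The bound `(m + 4) * b` covers the parametric costs, of size at most `4 * b`, and the sums over
a base, of size at most `m * b + 2`. -/
theorem minBase_tri {m : ℕ} {M : Matroid (Fin m)} {F N β b : ℕ} {s : Store} (hs : s.Bdd N β)
    (hm : 1 ≤ m) (hsm : s.idx 0 0 = m) (hN : 2 * m ≤ N)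
    (hy : ∀ i < m, rs (s.num 4 i) ≤ b) (hc : ∀ i < m, rs (s.num 2 i) ≤ b)
    (hμ : rs (s.num 6 0) ≤ b) (hl : rs (s.num 7 0) ≤ b) (hβ : (m + 4) * b ≤ β) :
    Tri ⟨indepOracle M, F, N, β⟩ minBase s (800 * (m * F + m * Nat.size m)) fun s' =>
      IsGreedy M (fun i => s.num 6 0 * s.num 4 i - s.num 7 0 * s.num 2 i) (s'.outputSet m) ∧
      s'.num 8 0 = tot (s.num 4) (s'.outputSet m) ∧
      s'.num 9 0 = tot (s.num 2) (s'.outputSet m) := by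
  have hsz : 1 ≤ Nat.size m := Nat.size_pos.2 hm
  have hb2 : 2 ≤ b := (two_le_rs _).trans hμ
  rw [add_mul] at hβ
  refine Tri.seq (T₂ := 600 * (m * F + m * Nat.size m) + (m * 60 + 20))
    (paramCosts_tri (b := b) hsm (by simp; omega) hy hc hμ hl (by simp; omega)) ?_ ?_
  · intro s₁ hf₁ h₁
    have hm₁ : s₁.idx 0 0 = m := by rw [hf₁.1 0 rfl, hsm]
    refine Tri.seq (greedy_tri 5 (hf₁.2.2 hs) hm hm₁ hN) ?_ le_rfl
    rintro s₂ hf₂ ⟨L, L1, L2, L3, L4⟩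
    have e4 : s₂.num 4 = s.num 4 := by rw [hf₂.2.1 4 rfl, hf₁.2.1 4 rfl]
    have e2 : s₂.num 2 = s.num 2 := by rw [hf₂.2.1 2 rfl, hf₁.2.1 2 rfl]
    refine (sumUp_tri (m := m) (b := b) (by rw [hf₂.1 0 rfl, hm₁]) (by simp; omega)
      (by rwa [e4]) (by rwa [e2]) (by simp; omega)).mono le_rfl ?_
    rintro s₃ hf₃ ⟨h8, h9⟩
    have e1 : s₃.outputSet m = s₂.outputSet m := by simp [Store.outputSet, hf₃.1 1 rfl]
    rw [e1, h8, h9, e4, e2]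
    refine ⟨⟨L, L1, L2, L3.imp fun {i j} h => ?_, L4⟩, rfl, rfl⟩
    rwa [h₁ i i.2, h₁ j j.2] at h
  · have h2 : m ≤ m * Nat.size m := Nat.le_mul_of_pos_right _ hsz
    omega

/-! ## Minimum ratios -/

/-- `l` is a lower bound for the ratios `y(J) / c(J)` of the bases `J` with `0 < c(J)`. -/
def IsLB {m : ℕ} (M : Matroid (Fin m)) (y c : ℕ → ℚ) (l : ℚ) : Prop :=
  ∀ J : Finset (Fin m), M.IsBase (J : Set (Fin m)) → l * tot c J ≤ tot y J

theorem tot_nonneg {m : ℕ} {y : ℕ → ℚ} (hy : ∀ i < m, 0 < y i) (I : Finset (Fin m)) : 0 ≤ tot y I :=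
  Finset.sum_nonneg fun i _ => (hy i i.2).le

theorem tot_pos_of_tot_ne_zero {m : ℕ} {y c : ℕ → ℚ} (hy : ∀ i < m, 0 < y i) {I : Finset (Fin m)}
    (hI : tot c I ≠ 0) : 0 < tot y I := by
  refine Finset.sum_pos (fun i _ => hy i i.2) (Finset.nonempty_iff_ne_empty.2 ?_)
  rintro rfl
  simp [tot] at hI

/-- The minimizer has the smallest value of `y(J) - l * c(J)`, so its sign there decides for all
bases. This turns a greedy run into a test of `l`. -/
theorem IsMinBase.isLB_iff {m : ℕ} {M : Matroid (Fin m)} {y c : ℕ → ℚ} {l : ℚ}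
    {I : Finset (Fin m)} (h : IsMinBase M y c 1 l I) :
    IsLB M y c l ↔ ¬ tot y I < l * tot c I := by
  constructor
  · exact fun h' => not_lt.2 (h' I h.1)
  · intro h' J hJ
    have := h.2 J hJ
    linarith

/-- For bases of negative cost the inequality needs `0 ≤ l'`: then the left side is nonpositive and
the right side nonnegative. -/
theorem IsLB.mono {m : ℕ} {M : Matroid (Fin m)} {y c : ℕ → ℚ} {l l' : ℚ} (hy : ∀ i < m, 0 < y i)
    (h : IsLB M y c l) (h0 : 0 ≤ l') (hl : l' ≤ l) : IsLB M y c l' := by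
  intro J hJ
  rcases le_total 0 (tot c J) with hc | hc
  · exact (mul_le_mul_of_nonneg_right hl hc).trans (h J hJ)
  · exact (mul_nonpos_of_nonneg_of_nonpos h0 hc).trans (tot_nonneg hy J)

/-- If the order of the costs does not change between `lo` and `hi`, then the greedy algorithm for
any parameter in between finds a base of minimum ratio. -/
theorem isLB_ratio {m : ℕ} {M : Matroid (Fin m)} {y c : ℕ → ℚ} (hy : ∀ i < m, 0 < y i)
    {lo mid hi : ℚ} (h0 : 0 ≤ lo) (h1 : lo < mid) (h2 : mid < hi) (hlo : IsLB M y c lo)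
    (hhi : ¬ IsLB M y c hi)
    (hkey : ∀ i < m, ∀ j < m, ∀ x, lo < x → x < hi → c i ≠ c j → (y i - y j) / (c i - c j) ≠ x)
    {I : Finset (Fin m)} (hI : IsGreedy M (fun i => 1 * y i - mid * c i) I) :
    0 < tot c I ∧ IsLB M y c (tot y I / tot c I) := by
  have key : ∀ l, lo ≤ l → l ≤ hi → IsMinBase M y c 1 l I := by
    intro l hl hl'
    refine hI.isMinBase fun i hi' j hj hij => ?_
    -- If the order of `i` and `j` at `mid` is violated at `l`, then the difference of their costs,
    -- which is affine in the parameter, vanishes at a point `x` strictly between `lo` and `hi`,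
    -- contrary to `hkey`.
    by_contra! hlt
    have hne : c i ≠ c j := by
      intro h
      rw [h] at hij hlt
      linarith
    have hd : c i - c j ≠ 0 := sub_ne_zero.2 hne
    set x := (y i - y j) / (c i - c j) with hx
    have hxe : y i - y j = x * (c i - c j) := by rw [hx, div_mul_cancel₀ _ hd]
    have e1 : (x - mid) * (c i - c j) ≤ 0 := by linarith
    have e2 : 0 < (x - l) * (c i - c j) := by linarith
    rcases lt_or_gt_of_ne hd with h | h
    · have e3 : mid ≤ x := by nlinarith
      have e4 : x < l := by nlinarith
      exact hkey i hi' j hj x (by linarith) (by linarith) hne rfl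
    · have e3 : x ≤ mid := by nlinarith
      have e4 : l < x := by nlinarith
      exact hkey i hi' j hj x (by linarith) (by linarith) hne rfl
  -- Since `hi` is no lower bound and `I` is optimal there, `y(I) < hi * c(I)`. This forces `c(I) >
  -- 0` and puts the ratio of `I` below `hi`; it is at least `lo` because `lo` is a lower bound. At
  -- the ratio itself `I` is still optimal, with value zero.
  have hhi' := key hi (by linarith) le_rfl
  rw [hhi'.isLB_iff, not_not] at hhi
  have hY := tot_nonneg hy I
  have hC : 0 < tot c I := by
    by_contra! hC
    nlinarith
  refine ⟨hC, ?_⟩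
  have := key (tot y I / tot c I) ((le_div_iff₀ hC).2 (hlo I (key lo le_rfl (by linarith)).1))
    ((div_le_iff₀ hC).2 hhi.le)
  rw [this.isLB_iff, div_mul_cancel₀ _ hC.ne']
  exact lt_irrefl _

/-! ## The multiplicative weights argument -/

/-- Weak duality. -/
theorem _root_.IsBasePacking.weak_duality {m : ℕ} {M : Matroid (Fin m)} {U : Fin m → ℕ}
    {z : Finset (Fin m) → ℝ} (hz : IsBasePacking M U z) {y c : ℕ → ℚ} (hy : ∀ i < m, 0 < y i)
    {l : ℚ} (hl : IsLB M y c l) :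
    (l : ℝ) * ∑ I : Finset (Fin m), (tot c I : ℝ) * z I ≤ ∑ i : Fin m, (U i : ℝ) * y i := by
  calc (l : ℝ) * ∑ I : Finset (Fin m), (tot c I : ℝ) * z I
      ≤ ∑ I : Finset (Fin m), (tot y I : ℝ) * z I := by
        rw [Finset.mul_sum]
        refine Finset.sum_le_sum fun I _ => ?_
        rcases eq_or_ne (z I) 0 with h | h
        · simp [h]
        · rw [← mul_assoc]
          refine mul_le_mul_of_nonneg_right ?_ (hz.nonneg I)
          exact_mod_cast hl I (hz.isBase_of_ne_zero I h)
    _ = ∑ i : Fin m, (∑ I : Finset (Fin m) with i ∈ I, z I) * y i := by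
        simp only [tot, Rat.cast_sum, Finset.sum_mul, Finset.sum_filter]
        rw [Finset.sum_comm' (t' := Finset.univ) (s' := fun i => {I | i ∈ I}) (by simp)]
        refine Finset.sum_congr rfl fun i _ => ?_
        rw [Finset.sum_filter]
        refine Finset.sum_congr rfl fun I _ => ?_
        split_ifs <;> ring
    _ ≤ ∑ i : Fin m, (U i : ℝ) * y i := by
        refine Finset.sum_le_sum fun i _ => mul_le_mul_of_nonneg_right (hz.capacity i) ?_
        exact_mod_cast (hy i i.2).le

/-- The invariants of the packing algorithm: `y` are the dual lengths, `D = ∑ u i * y i`, `α` is a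
lower bound for the minimum ratio, and the `R` bases `row l` with weights `wt l` are the packing
found so far. -/
structure PackInv {m : ℕ} (M : Matroid (Fin m)) (U : Fin m → ℕ) (c : ℕ → ℚ) (e α₀ : ℚ) (J : ℕ)
    (y : ℕ → ℚ) (D α : ℚ) (R p : ℕ) (row : ℕ → Finset (Fin m)) (wt : ℕ → ℚ) : Prop where
  y_pos : ∀ i < m, 0 < y i
  D_eq : D = ∑ i : Fin m, U i * y i
  lb : IsLB M y c α
  α_eq : α = α₀ * (1 + e) ^ p
  isBase : ∀ l < R, M.IsBase (row l : Set (Fin m))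
  wt_nonneg : ∀ l < R, 0 ≤ wt l
  cost_pos : ∀ l < R, 0 < tot c (row l)
  load : ∀ i : Fin m, ((1 + e : ℚ) : ℝ) ^
    ((((J + 1) * ∑ l ∈ Finset.range R with i ∈ row l, wt l) / U i : ℚ) : ℝ) ≤ ((U i * y i : ℚ) : ℝ)
  value : ∀ z, IsBasePacking M U z → 0 < ∑ I : Finset (Fin m), (tot c I : ℝ) * z I →
    (D : ℝ) ≤ m * Real.exp (e * (1 + e) * (J + 1) * ((∑ l ∈ Finset.range R, wt l * tot c (row l) : ℚ) : ℝ)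
      / ∑ I : Finset (Fin m), (tot c I : ℝ) * z I)
  saturated : ∃ n : Fin m → ℕ, ∑ i, n i = R ∧ ∀ i, (1 + e) ^ n i ≤ U i * y i
  D_lt : D < (1 + e) ^ (J + 1)

section PackInv

variable {m : ℕ} {M : Matroid (Fin m)} {U : Fin m → ℕ} {c : ℕ → ℚ} {e α₀ : ℚ} {J : ℕ}
  {y : ℕ → ℚ} {D α : ℚ} {R p : ℕ} {row : ℕ → Finset (Fin m)} {wt : ℕ → ℚ}

theorem PackInv.init (hU : ∀ i, 0 < U i) (hy : ∀ i : Fin m, y i = 1 / U i) (hα : IsLB M y c α₀)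
    (hD : (m : ℚ) < (1 + e) ^ (J + 1)) :
    PackInv M U c e α₀ J y m α₀ 0 0 row wt := by
  have h1 : ∀ i : Fin m, (U i : ℚ) * y i = 1 := fun i => by
    rw [hy, mul_one_div_cancel]; exact_mod_cast (hU i).ne'
  refine ⟨fun i hi => ?_, by simp [h1], hα, by simp, by simp, by simp, by simp, fun i => ?_,
    fun z hz hZ => by simp, ⟨fun _ => 0, by simp, fun i => by simp [h1]⟩, hD⟩
  · have := hU ⟨i, hi⟩
    rw [hy ⟨i, hi⟩]; positivity
  · rw [h1]; simp

theorem PackInv.phase (h : PackInv M U c e α₀ J y D α R p row wt)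
    (hlb : IsLB M y c ((1 + e) * α)) :
    PackInv M U c e α₀ J y D ((1 + e) * α) R (p + 1) row wt :=
  { h with
    lb := hlb
    α_eq := by rw [h.α_eq]; ring }

theorem PackInv.le_D (h : PackInv M U c e α₀ J y D α R p row wt) (i : Fin m) : U i * y i ≤ D := by
  rw [h.D_eq]
  exact Finset.single_le_sum (f := fun i : Fin m => (U i : ℚ) * y i)
    (fun i _ => mul_nonneg (Nat.cast_nonneg _) (h.y_pos i i.2).le) (Finset.mem_univ i)

/-- The number `n i` counts how often `i` was the chosen bottleneck. Each time `u i * y i` was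
multiplied by `1 + e`, and it stays below `(1 + e) ^ (J + 1)`, so `n i ≤ J`. -/
theorem PackInv.R_le (h : PackInv M U c e α₀ J y D α R p row wt) (he : 0 < e) : R ≤ m * J := by
  obtain ⟨n, h1, h2⟩ := h.saturated
  have : ∀ i, n i ≤ J := fun i => by
    have := ((h2 i).trans (h.le_D i)).trans_lt h.D_lt
    exact Nat.lt_succ_iff.1 ((pow_lt_pow_iff_right₀ (by linarith)).1 this)
  rw [← h1]
  exact (Finset.sum_le_card_nsmul _ _ J fun i _ => this i).trans (by simp)

/-- Compare `α` with the ratio of a base `I` that attains `α₀` at the start. Each length is at most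
`D` times its initial value, so `α * c(I) ≤ y(I) ≤ D * α₀ * c(I)`, hence `(1 + e) ^ p ≤ D`. -/
theorem PackInv.p_le (h : PackInv M U c e α₀ J y D α R p row wt) (he : 0 < e) (hU : ∀ i, 0 < U i)
    {y₀ : ℕ → ℚ} (hy₀ : ∀ i : Fin m, y₀ i = 1 / U i) {I : Finset (Fin m)}
    (hI : M.IsBase (I : Set (Fin m))) (hc : 0 < tot c I) (hα : 0 < α₀)
    (hα₀ : tot y₀ I = α₀ * tot c I) : p ≤ J := by
  have h1 := h.lb I hI
  have h2 : tot y I ≤ D * tot y₀ I := by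
    rw [tot, tot, Finset.mul_sum]
    refine Finset.sum_le_sum fun i _ => ?_
    rw [hy₀, mul_one_div, le_div_iff₀ (by exact_mod_cast hU i), mul_comm]
    exact h.le_D i
  rw [h.α_eq, mul_right_comm, ← hα₀] at h1
  have h3 : 0 < tot y₀ I := by rw [hα₀]; positivity
  have h4 : (1 + e) ^ p ≤ D := by
    have := h1.trans h2
    rw [mul_comm] at this
    exact le_of_mul_le_mul_right this h3
  exact Nat.lt_succ_iff.1 ((pow_lt_pow_iff_right₀ (by linarith)).1 (h4.trans_lt h.D_lt))

/-- The lengths only grow, so `α` stays a lower bound. The substantial points are the load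
(Bernoulli's inequality), the value (weak duality), the bottleneck count, and the growth of `D` by
at most the factor `1 + e`. -/
theorem PackInv.augment (h : PackInv M U c e α₀ J y D α R p row wt) (he : 0 < e) (hα : 0 < α)
    (hU : ∀ i, 0 < U i)
    (hD : D < (1 + e) ^ J) {I : Finset (Fin m)} (hI : M.IsBase (I : Set (Fin m)))
    (hlt : tot y I < (1 + e) * α * tot c I) {v : ℚ} (hv : ∀ i ∈ I, v ≤ U i)
    (hv' : ∃ i ∈ I, v = U i) {y' : ℕ → ℚ} {row' : ℕ → Finset (Fin m)} {wt' : ℕ → ℚ}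
    (hy1 : ∀ i : Fin m, i ∈ I → y' i = y i * (1 + e * (v / U i)))
    (hy2 : ∀ i : Fin m, i ∉ I → y' i = y i)
    (hr : ∀ l < R, row' l = row l) (hr' : row' R = I)
    (hw : ∀ l < R, wt' l = wt l) (hw' : wt' R = v / (J + 1)) :
    PackInv M U c e α₀ J y' (D + e * v * tot y I) α (R + 1) p row' wt' := by
  have hU' : ∀ i, (0 : ℚ) < U i := fun i => by exact_mod_cast hU i
  obtain ⟨i₀, hi₀, hvi₀⟩ := hv'
  have hv0 : 0 < v := hvi₀ ▸ hU' i₀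
  have hJ : (0 : ℚ) < J + 1 := by positivity
  have hyy : ∀ i : Fin m, y i ≤ y' i := fun i => by
    by_cases hi : i ∈ I
    · rw [hy1 i hi]
      have := hU' i
      exact le_mul_of_one_le_right (h.y_pos i i.2).le (by simp; positivity)
    · rw [hy2 i hi]
  have hYnn := tot_nonneg h.y_pos I
  have hC : 0 < tot c I := by
    by_contra! hC
    have : (1 + e) * α * tot c I ≤ 0 := mul_nonpos_of_nonneg_of_nonpos (by positivity) hC
    linarith
  have hYD : v * tot y I ≤ D := by
    rw [h.D_eq, tot, Finset.mul_sum]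
    calc ∑ i ∈ I, v * y i ≤ ∑ i ∈ I, U i * y i :=
          Finset.sum_le_sum fun i hi => mul_le_mul_of_nonneg_right (hv i hi) (h.y_pos i i.2).le
      _ ≤ _ := Finset.sum_le_sum_of_subset_of_nonneg (Finset.subset_univ _) fun i _ _ =>
          mul_nonneg (hU' i).le (h.y_pos i i.2).le
  have hrow : ∀ l < R + 1, (l < R ∧ row' l = row l ∧ wt' l = wt l) ∨
      (l = R ∧ row' l = I ∧ wt' l = v / (J + 1)) := fun l hl => by
    rcases Nat.lt_succ_iff_lt_or_eq.1 hl with hl | rfl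
    · exact .inl ⟨hl, hr l hl, hw l hl⟩
    · exact .inr ⟨rfl, hr', hw'⟩
  have hload : ∀ i : Fin m, ∑ l ∈ Finset.range (R + 1) with i ∈ row' l, wt' l =
      (∑ l ∈ Finset.range R with i ∈ row l, wt l) + if i ∈ I then v / (J + 1) else 0 := fun i => by
    rw [Finset.sum_filter, Finset.sum_filter, Finset.sum_range_succ, hr', hw']
    congr 1
    refine Finset.sum_congr rfl fun l hl => ?_
    rw [hr l (Finset.mem_range.1 hl), hw l (Finset.mem_range.1 hl)]
  have hval : ∑ l ∈ Finset.range (R + 1), wt' l * tot c (row' l) =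
      (∑ l ∈ Finset.range R, wt l * tot c (row l)) + v / (J + 1) * tot c I := by
    rw [Finset.sum_range_succ, hr', hw']
    congr 1
    refine Finset.sum_congr rfl fun l hl => ?_
    rw [hr l (Finset.mem_range.1 hl), hw l (Finset.mem_range.1 hl)]
  refine ⟨fun i hi => (h.y_pos i hi).trans_le (hyy ⟨i, hi⟩), ?_, fun K hK =>
    (h.lb K hK).trans (Finset.sum_le_sum fun i _ => hyy i), h.α_eq, fun l hl => ?_, fun l hl => ?_,
    fun l hl => ?_, fun i => ?_, fun z hz hZ => ?_, ?_, ?_⟩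
  · have : ∀ i : Fin m, U i * y' i = U i * y i + if i ∈ I then e * v * y i else 0 := fun i => by
      split_ifs with hi
      · rw [hy1 i hi]
        have := (hU' i).ne'
        field_simp
      · rw [hy2 i hi, add_zero]
    simp only [this, Finset.sum_add_distrib, ← h.D_eq, Finset.sum_ite_mem, Finset.univ_inter, tot,
      Finset.mul_sum]
  · rcases hrow l hl with ⟨h1, h2, h3⟩ | ⟨h1, h2, h3⟩
    · rw [h2]; exact h.isBase l h1
    · rwa [h2]
  · rcases hrow l hl with ⟨h1, h2, h3⟩ | ⟨h1, h2, h3⟩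
    · rw [h3]; exact h.wt_nonneg l h1
    · rw [h3]; positivity
  · rcases hrow l hl with ⟨h1, h2, h3⟩ | ⟨h1, h2, h3⟩
    · rw [h2]; exact h.cost_pos l h1
    · rwa [h2]
  · rw [hload]
    by_cases hi : i ∈ I
    · have hb : (0 : ℝ) < ((1 + e : ℚ) : ℝ) := by exact_mod_cast (by linarith : 0 < 1 + e)
      have hUi := hU' i
      rw [if_pos hi, mul_add, mul_div_cancel₀ _ hJ.ne', add_div, Rat.cast_add (_ / _), Real.rpow_add hb,
        hy1 i hi, ← mul_assoc, Rat.cast_mul (_ * _)]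
      refine mul_le_mul (h.load i) ?_ (Real.rpow_nonneg hb.le _) ?_
      · have h1 : v / U i ≤ 1 := (div_le_one hUi).2 (hv i hi)
        have h2 : 0 ≤ v / U i := by positivity
        -- Bernoulli for an exponent in `[0, 1]`: `(1 + e) ^ (v / u i) ≤ 1 + e * (v / u i)`. Here
        -- `v` must not exceed the capacity.
        have := rpow_one_add_le_one_add_mul_self (s := (e : ℝ)) (p := ((v / U i : ℚ) : ℝ))
          (by have : (0 : ℝ) < e := by exact_mod_cast he
              linarith) (by exact_mod_cast h2) (by exact_mod_cast h1)
        push_cast at this ⊢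
        linarith
      · exact_mod_cast mul_nonneg hUi.le (h.y_pos i i.2).le
    · rw [if_neg hi, add_zero, hy2 i hi]
      exact h.load i
  · set Z := ∑ I : Finset (Fin m), (tot c I : ℝ) * z I with hZdef
    have hwd := hz.weak_duality h.y_pos h.lb
    rw [← hZdef] at hwd
    have hDr : (D : ℝ) = ∑ i : Fin m, (U i : ℝ) * y i := by rw [h.D_eq]; push_cast; rfl
    rw [← hDr] at hwd
    have he' : (0 : ℝ) < e := by exact_mod_cast he
    have hv0' : (0 : ℝ) < v := by exact_mod_cast hv0
    have hC' : (0 : ℝ) < tot c I := by exact_mod_cast hC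
    have hlt' : (tot y I : ℝ) ≤ (1 + e) * α * tot c I := by exact_mod_cast hlt.le
    have hDpos : (0 : ℝ) < D := lt_of_lt_of_le (mul_pos (by exact_mod_cast hα) hZ) hwd
    -- The relative growth of `D` is at most `x`: combine `y(I) < (1 + e) * α * c(I)` with `α * Z ≤
    -- D` from weak duality. Then `1 + x ≤ exp x` turns the product over all steps into the
    -- exponential of a sum.
    set x : ℝ := e * (1 + e) * v * tot c I / Z with hx
    have h1 : ((D + e * v * tot y I : ℚ) : ℝ) ≤ D * (1 + x) := by
      have e1 : (tot y I : ℝ) * Z ≤ (1 + e) * tot c I * D := by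
        calc (tot y I : ℝ) * Z ≤ (1 + e) * α * tot c I * Z := mul_le_mul_of_nonneg_right hlt' hZ.le
          _ = (1 + e) * tot c I * (α * Z) := by ring
          _ ≤ _ := mul_le_mul_of_nonneg_left hwd (by positivity)
      have e2 : (e : ℝ) * v * tot y I ≤ D * x := by
        rw [hx, mul_div_assoc', le_div_iff₀ hZ]
        calc (e : ℝ) * v * tot y I * Z = e * v * (tot y I * Z) := by ring
          _ ≤ e * v * ((1 + e) * tot c I * D) := mul_le_mul_of_nonneg_left e1 (by positivity)
          _ = _ := by ring
      push_cast
      linarith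
    have h2 : 1 + x ≤ Real.exp x := by linarith [Real.add_one_le_exp x]
    refine h1.trans ((mul_le_mul (h.value z hz hZ) h2 (by positivity) (by positivity)).trans
      (le_of_eq ?_))
    rw [mul_assoc, ← Real.exp_add, hval, ← hZdef]
    congr 2
    have : (J : ℝ) + 1 ≠ 0 := by positivity
    rw [hx]
    push_cast
    field_simp
  · obtain ⟨n, h1, h2⟩ := h.saturated
    -- For the bottleneck `i₀` the factor `1 + e * (v / u i₀)` is exactly `1 + e`.
    refine ⟨Function.update n i₀ (n i₀ + 1), ?_, fun i => ?_⟩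
    · rw [← h1, Finset.sum_update_of_mem (Finset.mem_univ _), ← Finset.add_sum_erase _ n
        (Finset.mem_univ i₀), Finset.sdiff_singleton_eq_erase]
      ring
    · rcases eq_or_ne i i₀ with rfl | hne
      · rw [Function.update_self, hy1 i hi₀, hvi₀, div_self (hU' i).ne', pow_succ, ← mul_assoc, mul_one]
        exact mul_le_mul_of_nonneg_right (h2 i) (by linarith)
      · rw [Function.update_of_ne hne]
        exact (h2 i).trans (mul_le_mul_of_nonneg_left (hyy i) (hU' i).le)
  -- This uses `v * y(I) ≤ D`, true since `v` is at most every capacity in `I`, and that `D` was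
  -- still below the threshold.
  · calc D + e * v * tot y I = D + e * (v * tot y I) := by ring
      _ ≤ D + e * D := by linarith [mul_le_mul_of_nonneg_left hYD he.le]
      _ = (1 + e) * D := by ring
      _ < (1 + e) * (1 + e) ^ J := mul_lt_mul_of_pos_left hD (by linarith)
      _ = _ := by ring

end PackInv

/-- The final estimate for the approximation guarantee. -/
theorem value_bound {K m J : ℕ} {e ε G Z D : ℝ} (hK : 2 ≤ K) (he : e = 1 / K) (hε : 4 * e ≤ ε)
    (hm : 2 ≤ m) (hJ : (m : ℝ) ^ K ≤ (1 + e) ^ J) (hD : (1 + e) ^ J ≤ D) (hZ : 0 < Z)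
    (h : D ≤ m * Real.exp (e * (1 + e) * (J + 1) * G / Z)) : (1 - ε) * Z ≤ G := by
  have hK0 : (0 : ℝ) < K := by positivity
  have he0 : 0 < e := by rw [he]; positivity
  have hK2 : (2 : ℝ) ≤ K := by exact_mod_cast hK
  have he1 : e ≤ 1 / 2 := by
    rw [he]; exact one_div_le_one_div_of_le (by norm_num) hK2
  have hKe : K * e = 1 := by rw [he]; field_simp
  have hm2 : (2 : ℝ) ≤ m := by exact_mod_cast hm
  -- Because `1 + e ≤ 2 ≤ m`, already `(1 + e) ^ K ≤ m ^ K`.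
  have hJK : K ≤ J := by
    have h1 : (1 + e) ^ K ≤ (1 + e) ^ J :=
      le_trans (pow_le_pow_left₀ (by linarith) (by linarith) K) hJ
    exact (pow_le_pow_iff_right₀ (by linarith)).1 h1
  have hJK' : (K : ℝ) ≤ J := by exact_mod_cast hJK
  -- In logarithms, the threshold makes `log m` at most `e * J * Λ`. So the initial value `m` of `D`
  -- costs only a fraction `e` of its logarithmic growth.
  set Λ := Real.log (1 + e) with hΛ
  have h1 : K * Real.log m ≤ J * Λ := by
    have := Real.log_le_log (by positivity) hJ
    rwa [Real.log_pow, Real.log_pow] at this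
  have h2 : J * Λ ≤ Real.log m + e * (1 + e) * (J + 1) * G / Z := by
    have := Real.log_le_log (by positivity) (hD.trans h)
    rwa [Real.log_pow, Real.log_mul (by positivity) (by positivity), Real.log_exp] at this
  have h3 : e / (1 + e) ≤ Λ := by
    have := Real.one_sub_inv_le_log_of_pos (show 0 < 1 + e by linarith)
    refine le_trans (le_of_eq ?_) this
    field_simp; ring
  have h4 : Real.log m ≤ e * (J * Λ) := by
    have := mul_le_mul_of_nonneg_left h1 he0.le
    rwa [← mul_assoc, mul_comm e, hKe, one_mul] at this
  set X := G / Z with hX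
  have h5 : (1 - e) * (J * Λ) ≤ e * (1 + e) * (J + 1) * X := by
    rw [hX, mul_div_assoc']; linarith
  have h6 : (1 - e) * (J * (e / (1 + e))) ≤ e * (1 + e) * (J + 1) * X :=
    le_trans (mul_le_mul_of_nonneg_left (mul_le_mul_of_nonneg_left h3 (by positivity))
      (by linarith)) h5
  have h7 : (1 - e) * J ≤ (1 + e) ^ 2 * (J + 1) * X := by
    have e1 : (1 - e) * (J * (e / (1 + e))) = (e / (1 + e)) * ((1 - e) * J) := by ring
    have e2 : e * (1 + e) * (J + 1) * X = (e / (1 + e)) * ((1 + e) ^ 2 * (J + 1) * X) := by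
      field_simp
    rw [e1, e2] at h6
    exact le_of_mul_le_mul_left h6 (by positivity)
  -- The loss from dividing by `J + 1` instead of `J`; it is at most a factor `1 - e`, because `J ≥
  -- K = 1 / e`.
  have h8 : (1 - e) * (J + 1) ≤ J := by
    have : 1 ≤ e * (J + 1) := by
      calc (1 : ℝ) = K * e := hKe.symm
        _ ≤ (J + 1) * e := mul_le_mul_of_nonneg_right (by linarith) he0.le
        _ = _ := by ring
    linarith
  have h9 : (1 - e) ^ 2 ≤ (1 + e) ^ 2 * X := by
    have e1 : (1 - e) ^ 2 * (J + 1) ≤ ((1 + e) ^ 2 * X) * (J + 1) := by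
      calc (1 - e) ^ 2 * (J + 1) = (1 - e) * ((1 - e) * (J + 1)) := by ring
        _ ≤ (1 - e) * J := mul_le_mul_of_nonneg_left h8 (by linarith)
        _ ≤ _ := by linarith
    exact le_of_mul_le_mul_right e1 (by positivity)
  have h10 : 1 - 4 * e ≤ X := by
    -- The four losses of order `e` add up to `4 * e`; this is where the 4 in `⌈4 / ε⌉` comes from.
    have e1 : (1 - 4 * e) * (1 + e) ^ 2 ≤ (1 - e) ^ 2 := by nlinarith [sq_nonneg e, mul_pos he0 he0]
    nlinarith [sq_nonneg (1 + e)]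
  rw [hX, le_div_iff₀ hZ] at h10
  exact le_trans (mul_le_mul_of_nonneg_right (by linarith) hZ.le) h10

/-- The bound for the number of phases. -/
theorem pow_le_of_le_mul {K m J : ℕ} {e : ℚ} (hK : 0 < K) (he : e = 1 / K)
    (hJ : K * K * Nat.size m ≤ J) : (m : ℚ) ^ K ≤ (1 + e) ^ J := by
  have he0 : 0 < e := by rw [he]; positivity
  -- Bernoulli again: `K` factors double, so `K * Nat.size m` blocks of `K` factors exceed `m ^ K`.
  have h2 : (2 : ℚ) ≤ (1 + e) ^ K := by
    have := one_add_mul_le_pow (show -2 ≤ e by linarith) K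
    have hKe : K * e = 1 := by rw [he]; field_simp
    linarith
  calc (m : ℚ) ^ K ≤ (2 ^ Nat.size m) ^ K :=
        pow_le_pow_left₀ (by positivity) (by exact_mod_cast (Nat.lt_size_self m).le) K
    _ = 2 ^ (K * Nat.size m) := by rw [← pow_mul, mul_comm]
    _ ≤ ((1 + e) ^ K) ^ (K * Nat.size m) := pow_le_pow_left₀ (by positivity) h2 _
    _ = (1 + e) ^ (K * K * Nat.size m) := by rw [← pow_mul, mul_assoc]
    _ ≤ _ := pow_le_pow_right₀ (by linarith) hJ

/-! ### Reading the packing off the final memory. -/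

theorem sum_outputPacking {m : ℕ} (s : Store) (w : Finset (Fin m) → ℝ) :
    ∑ I, w I * s.outputPacking m I =
      ∑ l ∈ Finset.range (s.idx 1 0), w (s.outputRow m l) * s.num 3 l := by
  simp only [Store.outputPacking, Finset.mul_sum]
  rw [Finset.sum_comm]
  refine Finset.sum_congr rfl fun l _ => ?_
  simp

/-- Feasibility: `load` together with `u i * y i ≤ D < (1 + e) ^ (J + 1)` compares exponents and
bounds the load of `i` by `u i`; the weights already carry the factor `1 / (J + 1)`. Optimality is
`value_bound`. -/
theorem PackInv.isApproxBasePacking {m : ℕ} {M : Matroid (Fin m)} {U : Fin m → ℕ} {c : ℕ → ℚ}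
    {α₀ : ℚ} {J K : ℕ} {y : ℕ → ℚ} {D α : ℚ} {R p : ℕ} {s : Store} {ε : ℚ}
    (h : PackInv M U c (1 / K) α₀ J y D α R p (s.outputRow m) (s.num 3))
    (hR : s.idx 1 0 = R) (hU : ∀ i, 0 < U i) (hm : 2 ≤ m) (hK : 2 ≤ K) (hε : 4 ≤ K * ε)
    (hε1 : ε < 1)
    (hJ : (m : ℚ) ^ K ≤ (1 + 1 / K) ^ J) (hD : (1 + 1 / K) ^ J ≤ D) :
    IsApproxBasePacking M U (fun I => (tot c I : ℝ)) ε (s.outputPacking m) := by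
  have hKr : (0 : ℝ) < K := by positivity
  have hKq : (0 : ℚ) < K := by positivity
  refine ⟨⟨fun I => ?_, fun I hI => ?_, fun i => ?_⟩, fun z hz => ?_⟩
  · refine Finset.sum_nonneg fun l hl => ?_
    split_ifs
    · exact_mod_cast h.wt_nonneg l (hR ▸ Finset.mem_range.1 hl)
    · exact le_rfl
  · obtain ⟨l, hl, hne⟩ := Finset.exists_ne_zero_of_sum_ne_zero hI
    have : s.outputRow m l = I := by by_contra hcon; simp [hcon] at hne
    rw [← this]
    exact h.isBase l (hR ▸ Finset.mem_range.1 hl)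
  · have hsum : (∑ I : Finset (Fin m) with i ∈ I, s.outputPacking m I) =
        ((∑ l ∈ Finset.range R with i ∈ s.outputRow m l, s.num 3 l : ℚ) : ℝ) := by
      have := sum_outputPacking s (fun I : Finset (Fin m) => if i ∈ I then (1 : ℝ) else 0)
      simp only [ite_mul, one_mul, zero_mul, ← Finset.sum_filter, hR] at this
      rw [this]
      push_cast
      rfl
    rw [hsum]
    have hUi : (0 : ℚ) < U i := by exact_mod_cast hU i
    have hD1 := ((h.le_D i).trans_lt h.D_lt)
    have h1 := (h.load i).trans_lt (by exact_mod_cast hD1 : ((U i * y i : ℚ) : ℝ) <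
      (((1 + 1 / K : ℚ) ^ (J + 1) : ℚ) : ℝ))
    rw [Rat.cast_pow, ← Real.rpow_natCast, Real.rpow_lt_rpow_left_iff (by
      push_cast
      have : (0 : ℝ) < 1 / K := by positivity
      linarith)] at h1
    have h2 : ((J + 1) * ∑ l ∈ Finset.range R with i ∈ s.outputRow m l, s.num 3 l) / (U i : ℚ) <
        ((J + 1 : ℕ) : ℚ) := by exact_mod_cast h1
    rw [div_lt_iff₀ hUi] at h2
    push_cast at h2
    have h3 := lt_of_mul_lt_mul_left h2 (by positivity)
    exact_mod_cast h3.le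
  · rw [sum_outputPacking, hR]
    have hG : (0 : ℝ) ≤ ∑ l ∈ Finset.range R, (tot c (s.outputRow m l) : ℝ) * s.num 3 l := by
      refine Finset.sum_nonneg fun l hl => mul_nonneg ?_ ?_
      · exact_mod_cast (h.cost_pos l (Finset.mem_range.1 hl)).le
      · exact_mod_cast h.wt_nonneg l (Finset.mem_range.1 hl)
    have hε1' : (ε : ℝ) < 1 := by exact_mod_cast hε1
    -- Costs may be negative. Against a competitor of nonpositive value it suffices that the listed
    -- bases have positive cost.
    rcases le_or_gt (∑ I, (tot c I : ℝ) * z I) 0 with hZ | hZ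
    · exact (mul_nonpos_of_nonneg_of_nonpos (by linarith) hZ).trans hG
    · have hv := h.value z hz hZ
      have hJr := (Rat.cast_le (K := ℝ)).2 hJ
      have hDr := (Rat.cast_le (K := ℝ)).2 hD
      push_cast at hJr hDr
      refine value_bound (D := D) (J := J) hK rfl ?_ hm hJr hDr
        hZ (hv.trans (le_of_eq ?_))
      · have : (4 : ℝ) ≤ K * ε := by exact_mod_cast hε
        rw [mul_one_div, div_le_iff₀ hKr]; linarith
      · push_cast
        congr 6
        exact funext fun l => mul_comm _ _

theorem isApproxBasePacking_zero {m : ℕ} {M : Matroid (Fin m)} {U : Fin m → ℕ} {c : ℕ → ℚ}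
    {s : Store} {ε : ℚ} (hR : s.idx 1 0 = 0) (hε1 : ε < 1)
    (hc : ∀ J : Finset (Fin m), M.IsBase (J : Set (Fin m)) → tot c J ≤ 0) :
    IsApproxBasePacking M U (fun I => (tot c I : ℝ)) ε (s.outputPacking m) := by
  have h0 : s.outputPacking m = fun _ => 0 := by ext I; simp [Store.outputPacking, hR]
  rw [h0]
  refine ⟨⟨by simp, by simp, by simp⟩, fun z hz => ?_⟩
  have hε1' : (ε : ℝ) < 1 := by exact_mod_cast hε1
  simp only [mul_zero, Finset.sum_const_zero]
  refine mul_nonpos_of_nonneg_of_nonpos (by linarith) (Finset.sum_nonpos fun I _ => ?_)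
  rcases eq_or_ne (z I) 0 with h | h
  · simp [h]
  · exact mul_nonpos_of_nonpos_of_nonneg (by exact_mod_cast hc I (hz.isBase_of_ne_zero I h))
      (hz.nonneg I)

/-! ## Preparations of the packing algorithm -/

/-- Compute `K = ⌈4 / ε⌉` and `1 / K`. -/
def initK : Cmd :=
  .seq (.setIdx 29 (.const 0) (.const 1))
  (.seq (.while (.numLt (.mul (.ofIdx (V 29)) (X 0)) (.const 4))
    (.setIdx 29 (.const 0) (.add (V 29) (.const 1))))
  (.setNum 13 (.const 0) (.div (.const 1) (.ofIdx (V 29)))))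

/-- There is no rounding operation, so the ceiling is found by counting up. The `K` rounds are
affordable next to a main loop whose bound is quadratic in `K`. -/
theorem initK_tri {E : Env} {s : Store} {ε : ℚ} (hε : s.num 0 0 = ε) (hε0 : 0 < ε) {K : ℕ}
    (hK : K = ⌈4 / ε⌉₊) (hN : K ≤ E.N) (hβ : K + 4 ≤ E.β) :
    Tri E initK s (K * 20 + 40) fun s' => s'.idx 29 0 = K ∧ s'.num 13 0 = 1 / K := by
  have hKpos : 1 ≤ K := by rw [hK]; exact Nat.ceil_pos.2 (by positivity)
  have hlt : ∀ j : ℕ, j < K ↔ (j : ℚ) * ε < 4 := fun j => by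
    rw [hK, Nat.lt_ceil, lt_div_iff₀ hε0]
  refine Tri.seq (T₁ := 3) (T₂ := K * 15 + 30) (Q₁ := fun s' => s'.idx 29 0 = 1)
    (Tri.line ?_ (by simp [Cmd.fee, IdxExpr.cost]) (by simp [Cmd.ev, IdxExpr.val, Store.setIdx_idx]))
    ?_ (by omega)
  · simp [Cmd.ok, IdxExpr.val]; omega
  rintro s₁ hf₁ h₁
  refine Tri.seq (T₁ := K * 15 + 10) (T₂ := 7) (Q₁ := fun s' => s'.idx 29 0 = K)
    (Tri.whileLoop (T₁ := 6) (fun f s' => ∃ j, s'.idx 29 0 = j ∧ j + f = K) (K - 1)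
      ⟨1, h₁, by omega⟩ ?_ ?_ ?_) ?_ (by omega)
  · rintro f s' hf ⟨j, hj, hjf⟩ hb
    have e0 : s'.num 0 0 = ε := by rw [hf.2.1 0 rfl, hf₁.2.1 0 rfl, hε]
    have hjK : j < K := by
      rw [hlt]
      simpa [Test.holds, NumExpr.val, IdxExpr.val, hj, e0] using hb
    refine Tri.line ?_ (by simp [Cmd.fee, IdxExpr.cost]) ?_
    · simp [Cmd.ok, IdxExpr.val, hj]; omega
    · refine ⟨f - 1, by omega, j + 1, ?_, by omega⟩
      simp [Cmd.ev, IdxExpr.val, Store.setIdx_idx, hj]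
  · rintro f s' hf ⟨j, hj, hjf⟩ hb
    have e0 : s'.num 0 0 = ε := by rw [hf.2.1 0 rfl, hf₁.2.1 0 rfl, hε]
    have hjK : ¬ j < K := by
      rw [hlt]
      simpa [Test.holds, NumExpr.val, IdxExpr.val, hj, e0] using hb
    rw [hj]; omega
  · simp [Test.cost, NumExpr.cost, IdxExpr.cost]; omega
  · rintro s₂ hf₂ h₂
    refine Tri.line ?_ (by simp [Cmd.fee, IdxExpr.cost, NumExpr.cost]) ?_
    · simp only [Cmd.ok, NumExpr.val, IdxExpr.val, h₂]
      have h1 := rs_div_le 1 (K : ℚ)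
      have h2 := rs_natCast_le K
      rw [rs_one] at h1
      omega
    · simp [Cmd.ev, NumExpr.val, IdxExpr.val, h₂, Store.setNum_num]

/-- Initialise the dual lengths. -/
def initLengths : Cmd := forC 24 0 (.setNum 4 (V 24) (.div (.const 1) (.get 1 (V 24))))

theorem initLengths_tri {E : Env} {m b : ℕ} {s : Store} (hsm : s.idx 0 0 = m) (hN : m ≤ E.N)
    (hu : ∀ i < m, rs (s.num 1 i) ≤ b) (hβ : b + 2 ≤ E.β) :
    Tri E initLengths s (m * 30 + 9) fun s' => ∀ i < m, s'.num 4 i = 1 / s.num 1 i := by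
  refine Tri.forLoop (T₁ := 10) (fun k s' => ∀ i < k, s'.num 4 i = 1 / s.num 1 i) hsm hN
    (by decide) rfl rfl (by simp) ?_ (fun _ _ h => h) (by omega)
  intro k s' hk hf hi hb h
  refine Tri.line ?_ (by simp [Cmd.fee, IdxExpr.cost, NumExpr.cost]) ?_
  · simp only [Cmd.ok, IdxExpr.val, NumExpr.val, hi, hf.2.1 1 rfl]
    have h1 := rs_div_le 1 (s.num 1 k)
    rw [rs_one] at h1
    have := hu k hk
    omega
  · simp only [Cmd.ev, IdxExpr.val, NumExpr.val, hi, hf.2.1 1 rfl,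
      Store.setIdx_num, Store.setNum_num, if_true, Function.update_apply]
    intro i hik
    split_ifs with h'
    · rw [h']
    · exact h i (by omega)

/-- Write the critical parameters, at which the order of the parametric costs changes, to `num 15`. -/
def fillKeys : Cmd :=
  forC 24 0 (forC 25 0 (.setNum 15 (.add (.mul (V 24) (V 0)) (V 25))
    (.div (.sub (.get 4 (V 24)) (.get 4 (V 25))) (.sub (.get 2 (V 24)) (.get 2 (V 25))))))

theorem mul_add_inj {m i j k l : ℕ} (hj : j < m) (hl : l < m) (h : i * m + j = k * m + l) :
    i = k ∧ j = l := by
  have hi : i = k := by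
    rcases lt_trichotomy i k with h' | h' | h'
    · have := Nat.mul_le_mul_right m h'
      rw [Nat.succ_mul] at this
      omega
    · exact h'
    · have := Nat.mul_le_mul_right m h'
      rw [Nat.succ_mul] at this
      omega
  subst hi
  exact ⟨rfl, by omega⟩

/-- Pairs of equal cost give division by zero, hence the key 0. This is harmless, and 0 is wanted
among the keys anyway. -/
theorem fillKeys_tri {E : Env} {m b : ℕ} {s : Store} (hsm : s.idx 0 0 = m) (hN : m ≤ E.N)
    (hy : ∀ i < m, rs (s.num 4 i) ≤ b) (hc : ∀ i < m, rs (s.num 2 i) ≤ b) (hβ : 4 * b ≤ E.β) :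
    Tri E fillKeys s (m * m * 60 + 30 * m + 9) fun s' => ∀ i < m, ∀ j < m,
      s'.num 15 (i * m + j) = (s.num 4 i - s.num 4 j) / (s.num 2 i - s.num 2 j) := by
  refine Tri.forLoop (T₁ := m * 60 + 9) (fun k s' => ∀ i < k, ∀ j < m,
      s'.num 15 (i * m + j) = (s.num 4 i - s.num 4 j) / (s.num 2 i - s.num 2 j)) hsm hN
    (by decide) rfl rfl (by simp) ?_ (fun _ _ h => h) ?_
  · intro k s₁ hk hf₁ hi hb h
    refine Tri.forLoop (T₁ := 30) (fun l s' => ∀ i j, j < m → i < k ∨ i = k ∧ j < l →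
        s'.num 15 (i * m + j) = (s.num 4 i - s.num 4 j) / (s.num 2 i - s.num 2 j)) hb hN
      (by decide) rfl rfl ?_ ?_ ?_ (by omega)
    · intro i j hj hij
      exact h i (by omega) j hj
    · intro l s' hl hf hj hb' h'
      have e24 : s'.idx 24 0 = k := by rw [hf.1 24 rfl, hi]
      have e4 : s'.num 4 = s.num 4 := by rw [hf.2.1 4 rfl, hf₁.2.1 4 rfl]
      have e2 : s'.num 2 = s.num 2 := by rw [hf.2.1 2 rfl, hf₁.2.1 2 rfl]
      refine Tri.line ?_ (by simp [Cmd.fee, IdxExpr.cost, NumExpr.cost]) ?_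
      · simp only [Cmd.ok, IdxExpr.val, NumExpr.val, e24, e4, e2, hj]
        have h1 := rs_div_le (s.num 4 k - s.num 4 l) (s.num 2 k - s.num 2 l)
        have h2 := rs_sub_le (s.num 4 k) (s.num 4 l)
        have h3 := rs_sub_le (s.num 2 k) (s.num 2 l)
        have := hy k hk
        have := hc k hk
        have := hy l hl
        have := hc l hl
        omega
      · simp only [Cmd.ev, IdxExpr.val, NumExpr.val, e24, e4, e2, hj, hb', Store.setIdx_num,
          Store.setNum_num, if_true, Function.update_apply]
        intro i j hjm hij
        split_ifs with heq
        · obtain ⟨rfl, rfl⟩ := mul_add_inj hjm hl heq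
          rfl
        · refine h' i j hjm ?_
          rcases hij with hij | ⟨rfl, hij⟩
          · exact .inl hij
          · refine .inr ⟨rfl, ?_⟩
            rcases Nat.lt_succ_iff_lt_or_eq.1 hij with hij | rfl
            · exact hij
            · exact absurd rfl heq
    · intro s' hf h' i hi' j hj
      exact h' i j hj (by omega)
  · have : m * (m * 60 + 9 + 12) = m * m * 60 + m * 21 := by ring
    omega

/-- Copy the sorted keys to `num 16` and make a table of halves in `idx 31`. -/
def copyKeys : Cmd :=
  forC 24 10 (.seq (.setNum 16 (V 24) (.get 15 (.get 13 (V 24))))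
    (.seq (.setIdx 31 (.mul (.const 2) (V 24)) (V 24))
    (.setIdx 31 (.add (.mul (.const 2) (V 24)) (.const 1)) (V 24))))

/-- The copy and the fresh table of halves are needed because every greedy run during the search
sorts again and overwrites the arrays of the sorting routine. -/
theorem copyKeys_tri {E : Env} {n : ℕ} {s : Store} (hs : s.Bdd E.N E.β) (hn : s.idx 10 0 = n) :
    Tri E copyKeys s (n * 40 + 9) fun s' =>
      (∀ i < n, s'.num 16 i = s.num 15 (s.idx 13 i)) ∧ ∀ v < 2 * n, s'.idx 31 v = v / 2 := by
  refine Tri.forLoop (T₁ := 28) (fun k s' => (∀ i < k, s'.num 16 i = s.num 15 (s.idx 13 i)) ∧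
    ∀ v < 2 * k, s'.idx 31 v = v / 2) hn (hn ▸ hs.1 10 0) (by decide) rfl rfl (by simp) ?_
    (fun _ _ h => h) (by omega)
  rintro k s' hk hf hi hb ⟨h1, h2⟩
  have hs' := hf.2.2 hs
  refine Tri.line ?_ (by simp [Cmd.fee, IdxExpr.cost, NumExpr.cost]) ?_
  · simp only [Cmd.ok, IdxExpr.val, NumExpr.val]
    exact ⟨hs'.2 _ _, hs'.1 _ _, (hs'.setNum (hs'.2 _ _) |>.setIdx (hs'.1 _ _)).1 _ _⟩
  · simp only [Cmd.ev, IdxExpr.val, NumExpr.val, hi, hf.2.1 15 rfl, hf.1 13 rfl, Store.setIdx_num,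
      Store.setNum_num, Store.setIdx_idx, Store.setNum_idx, if_true, Function.update_apply,
      show ¬ (24 = 31) by decide, show ¬ (31 = 24) by decide, if_false]
    refine ⟨fun i hik => ?_, fun v hv => ?_⟩
    · split_ifs with h'
      · rw [h']
      · exact h1 i (by omega)
    · split_ifs
      · omega
      · omega
      · exact h2 v (by omega)

/-- Sort the critical parameters, together with an upper bound for the minimum ratio. -/
def prepareKeys : Cmd :=
  .seq (.seq (.setNum 18 (.const 0) (.add (.div (X 8) (X 9)) (.const 1)))
    (.setNum 6 (.const 0) (.const 1)))
  (.seq fillKeys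
  (.seq (.seq (.setNum 15 (.const 0) (X 18)) (.setIdx 10 (.const 0) (.mul (V 0) (V 0))))
  (.seq (sort 15) copyKeys)))

theorem prepareKeys_tri {E : Env} {m b : ℕ} {s : Store} (hs : s.Bdd E.N E.β) (hm : 2 ≤ m)
    (hsm : s.idx 0 0 = m) (hN : 2 * (m * m) ≤ E.N)
    (hy : ∀ i < m, rs (s.num 4 i) ≤ b) (hc : ∀ i < m, rs (s.num 2 i) ≤ b) {B : ℕ}
    (hhi : rs (s.num 8 0 / s.num 9 0 + 1) ≤ B) (hbB : 4 * b ≤ B) (hβ : B ≤ E.β) :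
    Tri E prepareKeys s (500 * (m * m) * Nat.size (m * m)) fun s' =>
      s'.idx 10 0 = m * m ∧ s'.num 6 0 = 1 ∧ (∀ v < 2 * (m * m), s'.idx 31 v = v / 2) ∧
      (∀ i < m * m, ∀ j < i, s'.num 16 j ≤ s'.num 16 i) ∧
      (∀ i < m * m, rs (s'.num 16 i) ≤ B) ∧
      (∃ k < m * m, s'.num 16 k = s.num 8 0 / s.num 9 0 + 1) ∧ (∃ k < m * m, s'.num 16 k = 0) ∧
      ∀ i < m, ∀ j < m, s.num 2 i ≠ s.num 2 j →
        ∃ k < m * m, s'.num 16 k = (s.num 4 i - s.num 4 j) / (s.num 2 i - s.num 2 j) := by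
  have hmm : m ≤ m * m := Nat.le_mul_of_pos_left _ (by omega)
  have hsz : 1 ≤ Nat.size (m * m) := Nat.size_pos.2 (by omega)
  have hb0 : 2 ≤ b := (two_le_rs _).trans (hc 0 (by omega))
  set hi := s.num 8 0 / s.num 9 0 + 1 with hhidef
  refine Tri.seq (T₁ := 15) (T₂ := (m * m * 60 + 30 * m + 9) +
    (15 + (310 * (m * m) * Nat.size (m * m) + (m * m * 40 + 9)))) (Q₁ := fun s' =>
      s'.num 18 0 = hi ∧ s'.num 6 0 = 1) (Tri.line ?_ (by simp [Cmd.fee, IdxExpr.cost, NumExpr.cost])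
      (by simp [Cmd.ev, NumExpr.val, IdxExpr.val, Store.setNum_num, ← hhidef])) ?_ ?_
  · simp only [Cmd.ok, NumExpr.val, IdxExpr.val, rs_one]
    exact ⟨hhi.trans hβ, by omega⟩
  rintro s₁ hf₁ ⟨h18, h6⟩
  have hs₁ := hf₁.2.2 hs
  have hm₁ : s₁.idx 0 0 = m := by rw [hf₁.1 0 rfl, hsm]
  have e4 : s₁.num 4 = s.num 4 := hf₁.2.1 4 rfl
  have e2 : s₁.num 2 = s.num 2 := hf₁.2.1 2 rfl
  refine Tri.seq (fillKeys_tri (b := b) hm₁ (by omega) (by rwa [e4]) (by rwa [e2]) (by omega)) ?_ le_rfl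
  rintro s₂ hf₂ h₂
  rw [e4, e2] at h₂
  have hs₂ := hf₂.2.2 hs₁
  have hm₂ : s₂.idx 0 0 = m := by rw [hf₂.1 0 rfl, hm₁]
  have h18₂ : s₂.num 18 0 = hi := by rw [hf₂.2.1 18 rfl, h18]
  refine Tri.seq (Q₁ := fun s' => s'.idx 10 0 = m * m ∧
      s'.num 15 = Function.update (s₂.num 15) 0 hi) (Tri.line ?_
      (by simp [Cmd.fee, IdxExpr.cost, NumExpr.cost])
      (by simp [Cmd.ev, NumExpr.val, IdxExpr.val, Store.setNum_num, Store.setIdx_idx, hm₂, h18₂])) ?_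
      le_rfl
  · simp only [Cmd.ok, NumExpr.val, IdxExpr.val, hm₂, h18₂, Cmd.ev, Store.setNum_idx]
    exact ⟨hhi.trans hβ, by omega⟩
  rintro s₃ hf₃ ⟨h10, h15⟩
  have hs₃ := hf₃.2.2 hs₂
  have key0 : s₃.num 15 0 = hi := by rw [h15, Function.update_self]
  -- The slot of the useless pair `(0, 0)` now holds the upper bound `hi`; all others are untouched.
  have key : ∀ i < m, ∀ j < m, (i ≠ 0 ∨ j ≠ 0) → s₃.num 15 (i * m + j) =
      (s.num 4 i - s.num 4 j) / (s.num 2 i - s.num 2 j) := by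
    intro i hi j hj hij
    rw [h15, Function.update_of_ne, h₂ i hi j hj]
    intro h0
    have := mul_add_inj (m := m) (k := 0) (l := 0) hj (by omega) (by rw [h0, zero_mul])
    omega
  refine Tri.seq (sort_tri 15 hs₃ h10 (by omega) hN) ?_ le_rfl
  rintro s₄ hf₄ ⟨o1, o2, o3⟩
  have hs₄ := hf₄.2.2 hs₃
  have e15 : s₄.num 15 = s₃.num 15 := hf₄.2.1 15 rfl
  refine (copyKeys_tri hs₄ (n := m * m) (by rw [hf₄.1 10 rfl, h10])).mono le_rfl ?_
  rintro s₅ hf₅ ⟨k1, k2⟩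
  rw [e15] at k1
  -- Sorting permutes the positions, so no key is lost.
  have surj : ∀ x < m * m, ∃ k < m * m, s₅.num 16 k = s₃.num 15 x := by
    intro x hx
    have hsurj : Function.Surjective fun k : Fin (m * m) => (⟨s₄.idx 13 k, o1 k k.2⟩ : Fin (m * m)) := by
      refine Finite.surjective_of_injective fun a b hab => ?_
      have hab' : s₄.idx 13 a = s₄.idx 13 b := congrArg Fin.val hab
      rcases lt_trichotomy a.val b.val with h | h | h
      · exact absurd hab' (o2 b b.2 a h)
      · exact Fin.ext h
      · exact absurd hab'.symm (o2 a a.2 b h)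
    obtain ⟨k, hk⟩ := hsurj ⟨x, hx⟩
    exact ⟨k, k.2, by rw [k1 k k.2, show s₄.idx 13 k = x from congrArg Fin.val hk]⟩
  have hlt : ∀ i < m, ∀ j < m, i * m + j < m * m := by
    intro i hi j hj
    have := Nat.mul_le_mul_right m hi
    rw [Nat.succ_mul] at this
    omega
  refine ⟨?_, ?_, k2, fun i hi j hj => ?_, fun i hi' => ?_, ?_, ?_, fun i hi j hj hne => ?_⟩
  · rw [hf₅.1 10 rfl, hf₄.1 10 rfl, h10]
  · rw [hf₅.2.1 6 rfl, hf₄.2.1 6 rfl, hf₃.2.1 6 rfl, hf₂.2.1 6 rfl, h6]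
  · rw [k1 i hi, k1 j (by omega)]; exact o3 i hi j hj
  · rw [k1 i hi']
    have hx := o1 i hi'
    set x := s₄.idx 13 i
    rcases Nat.eq_zero_or_pos x with h | h
    · rw [h, key0]; exact hhi
    · have hmx : x / m < m := Nat.div_lt_of_lt_mul hx
      have hmx' : x % m < m := Nat.mod_lt _ (by omega)
      have hxe : x / m * m + x % m = x := by rw [mul_comm]; exact Nat.div_add_mod x m
      rw [← hxe, key _ hmx _ hmx' (by
        by_contra! h0
        rw [h0.1, h0.2] at hxe
        omega)]
      refine le_trans ?_ hbB
      have h1 := rs_div_le (s.num 4 (x / m) - s.num 4 (x % m)) (s.num 2 (x / m) - s.num 2 (x % m))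
      have h2 := rs_sub_le (s.num 4 (x / m)) (s.num 4 (x % m))
      have h3 := rs_sub_le (s.num 2 (x / m)) (s.num 2 (x % m))
      have := hy _ hmx
      have := hc _ hmx
      have := hy _ hmx'
      have := hc _ hmx'
      omega
  · obtain ⟨k, hk, h⟩ := surj 0 (by omega)
    exact ⟨k, hk, by rw [h, key0]⟩
  -- The key 0 comes from the pair `(1, 1)`, which exists because `2 ≤ m`.
  · obtain ⟨k, hk, h⟩ := surj (1 * m + 1) (hlt 1 (by omega) 1 (by omega))
    exact ⟨k, hk, by rw [h, key 1 (by omega) 1 (by omega) (by omega)]; simp⟩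
  · obtain ⟨k, hk, h⟩ := surj (i * m + j) (hlt i hi j hj)
    refine ⟨k, hk, h.trans (key i hi j hj ?_)⟩
    by_contra! h0
    rw [h0.1, h0.2] at hne
    exact hne rfl
  · have h1 : m * m ≤ m * m * Nat.size (m * m) := Nat.le_mul_of_pos_right _ hsz
    have h2 : 4 ≤ m * m := Nat.mul_le_mul hm hm
    rw [mul_assoc 310, mul_assoc 500]
    omega

/-! ## The initial minimum ratio -/

/-- Halve the interval of the candidates `idx 26 0 ≤ k < idx 27 0` for the first key that exceeds the
minimum ratio. -/
def searchStep : Cmd :=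
  .seq (.seq (.setIdx 28 (.const 0) (.get 31 (.add (V 26) (V 27))))
    (.setNum 7 (.const 0) (.get 16 (V 28))))
  (.seq minBase
  (.ite (.and (.numLt (.const 0) (X 7)) (.numLt (X 8) (.mul (X 7) (X 9))))
    (.setIdx 27 (.const 0) (V 28)) (.setIdx 26 (.const 0) (.add (V 28) (.const 1)))))

/-- Binary search for the first key that exceeds the minimum ratio. -/
def searchKeys : Cmd :=
  .seq (.seq (.setIdx 26 (.const 0) (.const 0)) (.setIdx 27 (.const 0) (V 10)))
  (.while (.idxLt (V 26) (V 27)) searchStep)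

/-- Compute the minimum ratio. -/
def minRatio : Cmd :=
  .seq searchKeys
  (.seq (.setNum 7 (.const 0) (.div
    (.add (.get 16 (.sub (V 26) (.const 1))) (.get 16 (V 26))) (.const 2)))
  (.seq minBase
  (.setNum 10 (.const 0) (.div (X 8) (X 9)))))

/-- The parameter `l` does not exceed the minimum ratio. -/
def Low {m : ℕ} (M : Matroid (Fin m)) (y c : ℕ → ℚ) (l : ℚ) : Prop := l ≤ 0 ∨ IsLB M y c l

section Search

variable {m : ℕ} {M : Matroid (Fin m)} {F N β b : ℕ} {s : Store}

theorem searchStep_tri (hs : s.Bdd N β)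
    (hm : 1 ≤ m) (hsm : s.idx 0 0 = m) (hN : 2 * m ≤ N)
    (hy : ∀ i < m, rs (s.num 4 i) ≤ b) (hc : ∀ i < m, rs (s.num 2 i) ≤ b)
    (hμ : s.num 6 0 = 1) {k : ℕ} (hk : s.idx 31 (s.idx 26 0 + s.idx 27 0) = k) (hkN : k + 1 ≤ N)
    (hl : rs (s.num 16 k) ≤ b) (hβ : (m + 4) * b ≤ β) :
    Tri ⟨indepOracle M, F, N, β⟩ searchStep s (900 * (m * F + m * Nat.size m)) fun s' =>
      (¬ Low M (s.num 4) (s.num 2) (s.num 16 k) ∧ s'.idx 26 0 = s.idx 26 0 ∧ s'.idx 27 0 = k) ∨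
      (Low M (s.num 4) (s.num 2) (s.num 16 k) ∧ s'.idx 26 0 = k + 1 ∧ s'.idx 27 0 = s.idx 27 0) := by
  have hsz : 1 ≤ Nat.size m := Nat.size_pos.2 hm
  have h2 : m ≤ m * Nat.size m := Nat.le_mul_of_pos_right _ hsz
  refine Tri.seq (T₁ := 20) (T₂ := 800 * (m * F + m * Nat.size m) + 30) (Q₁ := fun s' =>
    s'.idx 28 0 = k ∧ s'.num 7 0 = s.num 16 k) (Tri.line ?_
      (by simp [Cmd.fee, IdxExpr.cost, NumExpr.cost]) ?_) ?_ (by omega)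
  · simp only [Cmd.ok, IdxExpr.val, NumExpr.val, hk, Cmd.ev, Store.setIdx_num]
    exact ⟨by omega, hs.2 _ _⟩
  · simp [Cmd.ev, IdxExpr.val, NumExpr.val, Store.setIdx_idx, Store.setNum_num, hk]
  rintro s₁ hf₁ ⟨h28, h7⟩
  have hs₁ := hf₁.2.2 hs
  have e4 : s₁.num 4 = s.num 4 := hf₁.2.1 4 rfl
  have e2 : s₁.num 2 = s.num 2 := hf₁.2.1 2 rfl
  have e6 : s₁.num 6 0 = 1 := by rw [hf₁.2.1 6 rfl, hμ]
  refine Tri.seq (minBase_tri (b := b) hs₁ hm (by rw [hf₁.1 0 rfl, hsm]) hN (by rwa [e4])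
    (by rwa [e2]) (by rw [e6, rs_one]; exact (two_le_rs _).trans hl) (by rwa [h7]) hβ) ?_ le_rfl
  rintro s₂ hf₂ ⟨g1, g2, g3⟩
  have e26 : s₂.idx 26 0 = s.idx 26 0 := by rw [hf₂.1 26 rfl, hf₁.1 26 rfl]
  have e27 : s₂.idx 27 0 = s.idx 27 0 := by rw [hf₂.1 27 rfl, hf₁.1 27 rfl]
  have e28 : s₂.idx 28 0 = k := by rw [hf₂.1 28 rfl, h28]
  have e7 : s₂.num 7 0 = s.num 16 k := by rw [hf₂.2.1 7 rfl, h7]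
  rw [e4, e2, e6, h7] at g1
  rw [e4] at g2
  rw [e2] at g3
  have hmin := g1.isMinBase (y := s.num 4) (c := s.num 2) fun _ _ _ _ h => h
  -- The test of the program decides `Low`: nonpositive keys are low by convention, the others are
  -- settled by the minimizer.
  have hlow : Low M (s.num 4) (s.num 2) (s.num 16 k) ↔
      ¬ (0 < s.num 16 k ∧ s₂.num 8 0 < s.num 16 k * s₂.num 9 0) := by
    rw [Low, hmin.isLB_iff, g2, g3, not_and_or, not_lt, not_lt]
  refine Tri.ite (T₁ := 10) (fun ht => ?_) (fun ht => ?_)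
    (by simp [Test.cost, IdxExpr.cost, NumExpr.cost])
  · simp only [Test.holds, NumExpr.val, IdxExpr.val, e7] at ht
    refine Tri.line ?_ (by simp [Cmd.fee, IdxExpr.cost]) (.inl ⟨?_, ?_, ?_⟩)
    · simp only [Cmd.ok, IdxExpr.val, e28]; omega
    · rw [hlow, not_not]; exact ht
    · simp [Cmd.ev, IdxExpr.val, Store.setIdx_idx, e26]
    · simp [Cmd.ev, IdxExpr.val, Store.setIdx_idx, e28]
  · simp only [Test.holds, NumExpr.val, IdxExpr.val, e7] at ht
    refine Tri.line ?_ (by simp [Cmd.fee, IdxExpr.cost]) (.inr ⟨?_, ?_, ?_⟩)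
    · simp only [Cmd.ok, IdxExpr.val, e28]; omega
    · rwa [hlow]
    · simp [Cmd.ev, IdxExpr.val, Store.setIdx_idx, e28]
    · simp [Cmd.ev, IdxExpr.val, Store.setIdx_idx, e27]

theorem searchKeys_tri (hs : s.Bdd N β)
    (hm : 1 ≤ m) (hsm : s.idx 0 0 = m) {n : ℕ} (hN : 2 * m ≤ N) (hN' : n + 1 ≤ N)
    (hy : ∀ i < m, rs (s.num 4 i) ≤ b) (hc : ∀ i < m, rs (s.num 2 i) ≤ b)
    (hμ : s.num 6 0 = 1) (hn : s.idx 10 0 = n)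
    (hhalf : ∀ v < 2 * n, s.idx 31 v = v / 2)
    (hl : ∀ k < n, rs (s.num 16 k) ≤ b) (hβ : (m + 4) * b ≤ β) :
    Tri ⟨indepOracle M, F, N, β⟩ searchKeys s
      (Nat.size n * (920 * (m * F + m * Nat.size m)) + 30) fun s' =>
      ∃ a ≤ n, s'.idx 26 0 = a ∧ (a = 0 ∨ Low M (s.num 4) (s.num 2) (s.num 16 (a - 1))) ∧
        (a = n ∨ ¬ Low M (s.num 4) (s.num 2) (s.num 16 a)) := by
  have hsz : 1 ≤ Nat.size m := Nat.size_pos.2 hm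
  have h2 : m ≤ m * Nat.size m := Nat.le_mul_of_pos_right _ hsz
  refine Tri.seq (T₁ := 10) (T₂ := Nat.size n * (920 * (m * F + m * Nat.size m)) + 10)
    (Q₁ := fun s' => s'.idx 26 0 = 0 ∧ s'.idx 27 0 = n) (Tri.line ?_
      (by simp [Cmd.fee, IdxExpr.cost]) ?_) ?_ (by omega)
  · simp only [Cmd.ok, Cmd.ev, IdxExpr.val, Store.setIdx_idx, show ¬ (10 = 26) by decide, if_false, hn]
    omega
  · simp [Cmd.ev, IdxExpr.val, Store.setIdx_idx, hn]
  rintro s₁ hf₁ ⟨h26, h27⟩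
  -- The key before `a` is low and the key at `b` is not, with the ends of the array exempt. The
  -- length `b - a` is less than `2 ^ f`, so `Nat.size n` halvings suffice.
  refine Tri.whileLoop (T₁ := 900 * (m * F + m * Nat.size m)) (fun f s' => ∃ a b, a ≤ b ∧ b ≤ n ∧
    b - a < 2 ^ f ∧ s'.idx 26 0 = a ∧ s'.idx 27 0 = b ∧
    (a = 0 ∨ Low M (s.num 4) (s.num 2) (s.num 16 (a - 1))) ∧
    (b = n ∨ ¬ Low M (s.num 4) (s.num 2) (s.num 16 b))) (Nat.size n)
    ⟨0, n, Nat.zero_le _, le_rfl, by simpa using Nat.lt_size_self n, h26, h27, .inl rfl, .inl rfl⟩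
    ?_ ?_ ?_
  · rintro f s' hf ⟨a, b', hab, hbn, hbf, ha, hb, ia, ib⟩ ht
    simp only [Test.holds, IdxExpr.val, ha, hb] at ht
    have hs' : s'.Bdd N β := hf.2.2 (hf₁.2.2 hs)
    have e4 : s'.num 4 = s.num 4 := by rw [hf.2.1 4 rfl, hf₁.2.1 4 rfl]
    have e2 : s'.num 2 = s.num 2 := by rw [hf.2.1 2 rfl, hf₁.2.1 2 rfl]
    have e16 : s'.num 16 = s.num 16 := by rw [hf.2.1 16 rfl, hf₁.2.1 16 rfl]
    refine (searchStep_tri (b := b) (k := (a + b') / 2) hs' hm (by rw [hf.1 0 rfl, hf₁.1 0 rfl, hsm])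
      hN (by rwa [e4]) (by rwa [e2]) (by rw [hf.2.1 6 rfl, hf₁.2.1 6 rfl, hμ]) ?_ (by omega)
      (by rw [e16]; exact hl _ (by omega)) hβ).mono le_rfl ?_
    · rw [ha, hb, hf.1 31 rfl, hf₁.1 31 rfl]
      exact hhalf _ (by omega)
    · rw [e4, e2, e16]
      obtain ⟨f, rfl⟩ : ∃ g, f = g + 1 := by
        refine Nat.exists_eq_succ_of_ne_zero ?_
        rintro rfl; omega
      rw [pow_succ] at hbf
      rintro s'' - (⟨h1, h2, h3⟩ | ⟨h1, h2, h3⟩)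
      · exact ⟨f, by omega, a, (a + b') / 2, by omega, by omega, by omega, by rw [h2, ha], h3, ia,
          .inr h1⟩
      · exact ⟨f, by omega, (a + b') / 2 + 1, b', by omega, by omega, by omega, h2, by rw [h3, hb],
          .inr (by simpa using h1), ib⟩
  · rintro f s' hf ⟨a, b', hab, hbn, hbf, ha, hb, ia, ib⟩ ht
    simp only [Test.holds, IdxExpr.val, ha, hb] at ht
    obtain rfl : a = b' := by omega
    exact ⟨a, hbn, ha, ia, ib⟩
  · simp only [Test.cost, IdxExpr.cost]
    have : Nat.size n * (1 + 1 + (1 + 1) + 1 + 900 * (m * F + m * Nat.size m) + 1) ≤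
      Nat.size n * (920 * (m * F + m * Nat.size m)) := Nat.mul_le_mul_left _ (by omega)
    omega

/-- The search ends at adjacent distinct keys `lo < up` with `lo` low and `up` not. No breakpoint
lies strictly between them, so `isLB_ratio` applies to the greedy base for the midpoint. A midpoint
is used rather than a key, because at a key ties could be broken the wrong way for one side. -/
theorem minRatio_tri (hs : s.Bdd N β)
    (hm : 1 ≤ m) (hsm : s.idx 0 0 = m) {n : ℕ} (hN : 2 * m ≤ N) (hN' : n + 1 ≤ N)
    (hy : ∀ i < m, rs (s.num 4 i) ≤ b) (hc : ∀ i < m, rs (s.num 2 i) ≤ b)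
    (hμ : s.num 6 0 = 1) (hn : s.idx 10 0 = n)
    (hhalf : ∀ v < 2 * n, s.idx 31 v = v / 2)
    (hl : ∀ k < n, 2 * rs (s.num 16 k) + 4 ≤ b) (hβ : (m + 4) * b ≤ β)
    (hypos : ∀ i < m, 0 < s.num 4 i)
    (hsort : ∀ i < n, ∀ j < i, s.num 16 j ≤ s.num 16 i)
    {A : ℕ} (hA : ∀ I : Finset (Fin m), rs (tot (s.num 4) I) + rs (tot (s.num 2) I) ≤ A) (hAβ : A ≤ β)
    {hi : ℚ} (hhi : ∃ k < n, s.num 16 k = hi) (hhi0 : ¬ Low M (s.num 4) (s.num 2) hi)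
    (hzero : ∃ k < n, s.num 16 k = 0)
    (hkeys : ∀ i < m, ∀ j < m, s.num 2 i ≠ s.num 2 j →
        ∃ k < n, s.num 16 k = (s.num 4 i - s.num 4 j) / (s.num 2 i - s.num 2 j)) :
    Tri ⟨indepOracle M, F, N, β⟩ minRatio s
      (Nat.size n * (920 * (m * F + m * Nat.size m)) + 900 * (m * F + m * Nat.size m)) fun s' =>
      IsLB M (s.num 4) (s.num 2) (s'.num 10 0) ∧ rs (s'.num 10 0) ≤ A ∧ ∃ I : Finset (Fin m), M.IsBase (I : Set (Fin m)) ∧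
        0 < tot (s.num 2) I ∧ s'.num 10 0 = tot (s.num 4) I / tot (s.num 2) I := by
  have hsz : 1 ≤ Nat.size m := Nat.size_pos.2 hm
  have h2 : m ≤ m * Nat.size m := Nat.le_mul_of_pos_right _ hsz
  have hb : m * b + 4 * b ≤ β := by rwa [add_mul] at hβ
  have hrs2 : rs 2 = 3 := by decide +kernel
  refine Tri.seq (T₂ := 800 * (m * F + m * Nat.size m) + 50)
    (searchKeys_tri (b := b) hs hm hsm hN hN' hy hc hμ hn hhalf
    (fun k hk => by have := hl k hk; omega) hβ) ?_ (by omega)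
  rintro s₁ hf₁ ⟨a, han, ha, ia, ib⟩
  have hs₁ := hf₁.2.2 hs
  have e4 : s₁.num 4 = s.num 4 := hf₁.2.1 4 rfl
  have e2 : s₁.num 2 = s.num 2 := hf₁.2.1 2 rfl
  have e16 : s₁.num 16 = s.num 16 := hf₁.2.1 16 rfl
  have e6 : s₁.num 6 0 = 1 := by rw [hf₁.2.1 6 rfl, hμ]
  have hmono : ∀ i < n, ∀ j ≤ i, s.num 16 j ≤ s.num 16 i := fun i hi j hj => by
    rcases eq_or_lt_of_le hj with rfl | h
    exacts [le_rfl, hsort i hi j h]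
  -- This is why `Low` includes all nonpositive parameters: `IsLB` alone need not pass to negative
  -- ones when there are bases of negative cost.
  have hlowmono : ∀ {l l'}, Low M (s.num 4) (s.num 2) l → l' ≤ l → Low M (s.num 4) (s.num 2) l' := by
    intro l l' hl hll
    rcases le_or_gt l' 0 with h0 | h0
    · exact .inl h0
    · rcases hl with hl | hl
      · linarith
      · exact .inr (hl.mono hypos h0.le hll)
  -- The key 0 guarantees a low key and the key `hi` one that is not low, so the exempt ends of the
  -- array do not occur.
  have ha0 : a ≠ 0 := by
    rintro rfl
    obtain ⟨k, hk, hk0⟩ := hzero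
    rcases ib with ib | ib
    · omega
    · exact ib (.inl (hk0 ▸ hmono k hk 0 (Nat.zero_le _)))
  have han' : a ≠ n := by
    rintro rfl
    obtain ⟨k, hk, rfl⟩ := hhi
    rcases ia with ia | ia
    · exact ha0 ia
    · exact hhi0 (hlowmono ia (hmono _ (by omega) k (by omega)))
  replace ia := ia.resolve_left ha0
  replace ib := ib.resolve_left han'
  set lo := s.num 16 (a - 1) with hlo
  set up := s.num 16 a with hup
  have hlohi : lo < up := by
    by_contra! hcon
    exact ib (hlowmono ia hcon)
  have hgap : ∀ k < n, s.num 16 k ≤ lo ∨ up ≤ s.num 16 k := by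
    intro k hk
    rcases lt_or_ge k a with h | h
    · exact .inl (hmono _ (by omega) k (by omega))
    · exact .inr (hmono k hk a h)
  have hup0 : 0 < up := by
    by_contra! h
    exact ib (.inl h)
  have hlo0 : 0 ≤ lo := by
    obtain ⟨k, hk, hk0⟩ := hzero
    rcases hgap k hk with h | h <;> rw [hk0] at h
    · exact h
    · linarith
  have hloLB : IsLB M (s.num 4) (s.num 2) lo := by
    rcases ia with ia | ia
    · rw [show lo = 0 from le_antisymm ia hlo0]
      intro J _
      rw [zero_mul]
      exact tot_nonneg hypos J
    · exact ia
  have hmid : rs ((lo + up) / 2) ≤ b := by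
    have h1 := rs_div_le (lo + up) 2
    have h3 := rs_add_le lo up
    have h4 := hl (a - 1) (by omega)
    have h5 := hl a (by omega)
    rw [← hlo] at h4
    rw [← hup] at h5
    omega
  refine Tri.seq (T₁ := 20) (T₂ := 800 * (m * F + m * Nat.size m) + 20) (Q₁ := fun s' =>
    s'.num 7 0 = (lo + up) / 2) (Tri.line ?_ (by simp [Cmd.fee, IdxExpr.cost, NumExpr.cost])
    (by simp [Cmd.ev, NumExpr.val, IdxExpr.val, Store.setNum_num, ha, e16, hlo, hup])) ?_ (by omega)
  · simp only [Cmd.ok, NumExpr.val, IdxExpr.val, ha, e16]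
    exact hmid.trans (show b ≤ β by omega)
  rintro s₂ hf₂ h7
  have e4' : s₂.num 4 = s.num 4 := by rw [hf₂.2.1 4 rfl, e4]
  have e2' : s₂.num 2 = s.num 2 := by rw [hf₂.2.1 2 rfl, e2]
  have e6' : s₂.num 6 0 = 1 := by rw [hf₂.2.1 6 rfl, e6]
  refine Tri.seq (minBase_tri (b := b) (hf₂.2.2 hs₁) hm (by rw [hf₂.1 0 rfl, hf₁.1 0 rfl, hsm]) hN
    (by rwa [e4']) (by rwa [e2']) (by rw [e6', rs_one]; exact (two_le_rs _).trans hmid)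
    (by rwa [h7]) hβ) ?_ le_rfl
  rintro s₃ hf₃ ⟨g1, g2, g3⟩
  rw [e4', e2', e6', h7] at g1
  rw [e4'] at g2
  rw [e2'] at g3
  set I := s₃.outputSet m with hI
  obtain ⟨r1, r2⟩ := isLB_ratio hypos hlo0 (mid := (lo + up) / 2) (by linarith) (by linarith) hloLB
    (fun h => ib (.inr h)) (fun i hi' j hj x hx1 hx2 hne hxe => by
      obtain ⟨k, hk, hk'⟩ := hkeys i hi' j hj hne
      rw [hxe] at hk'
      rcases hgap k hk with h | h <;> rw [hk'] at h <;> linarith) g1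
  refine Tri.line ?_ (by simp [Cmd.fee, IdxExpr.cost, NumExpr.cost]) ?_
  · simp only [Cmd.ok, NumExpr.val, IdxExpr.val, g2, g3]
    exact ((rs_div_le _ _).trans (hA I)).trans hAβ
  · simp only [Cmd.ev, NumExpr.val, IdxExpr.val, Store.setNum_num, g2, g3, if_true,
      Function.update_self]
    exact ⟨r2, (rs_div_le _ _).trans (hA I), I, (g1.isMinBase (y := s.num 4) (c := s.num 2) fun _ _ _ _ h => h).1, r1, rfl⟩

end Search

/-! ## The packing loop -/

/-- Compute the threshold `(1 + 1 / K) ^ J`, where `J` is minimal with `m ^ K ≤ (1 + 1 / K) ^ J`. -/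
def initThreshold : Cmd :=
  .seq (.setNum 17 (.const 0) (.const 1))
  (.seq (forC 24 29 (.setNum 17 (.const 0) (.mul (X 17) (.ofIdx (V 0)))))
  (.seq (.seq (.setNum 12 (.const 0) (.const 1)) (.setIdx 22 (.const 0) (.const 0)))
  (.seq (.while (.numLt (X 12) (X 17))
    (.seq (.setNum 12 (.const 0) (.mul (X 12) (.add (.const 1) (X 13))))
      (.setIdx 22 (.const 0) (.add (V 22) (.const 1)))))
  (.seq (.setNum 11 (.const 0) (.ofIdx (V 0))) (.setIdx 23 (.const 0) (.const 0))))))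

theorem rs_natCast_pow_le (m k : ℕ) : rs ((m : ℚ) ^ k) ≤ k * (m + 2) + 2 := by
  induction k with
  | zero => simp [rs_one]
  | succ k ih =>
    rw [pow_succ, add_mul]
    have := rs_mul_le ((m : ℚ) ^ k) m
    have := rs_natCast_le m
    omega

theorem rs_pow_le {q : ℚ} {b : ℕ} (h : rs q ≤ b) (k : ℕ) : rs (q ^ k) ≤ k * b + 2 := by
  induction k with
  | zero => simp [rs_one]
  | succ k ih =>
    rw [pow_succ, add_mul]
    have := rs_mul_le (q ^ k) q
    omega

theorem rs_one_add_inv_le (K : ℕ) : rs (1 + 1 / (K : ℚ)) ≤ K + 6 := by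
  have h1 := rs_add_le 1 (1 / (K : ℚ))
  have h2 := rs_div_le 1 (K : ℚ)
  have h3 := rs_natCast_le K
  rw [rs_one] at h1 h2
  omega

theorem initThreshold_tri {E : Env} {m K : ℕ} {s : Store} (hm : 1 ≤ m) (hsm : s.idx 0 0 = m)
    (hK : s.idx 29 0 = K) (hK1 : 1 ≤ K) (he : s.num 13 0 = 1 / K) (hKN : K ≤ E.N)
    (hN : K * K * Nat.size m ≤ E.N) (hβ1 : K * (m + 2) + 2 ≤ E.β) (hβm : m + 2 ≤ E.β)
    (hβ2 : K * K * Nat.size m * (K + 6) + 2 ≤ E.β) :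
    Tri E initThreshold s (K * K * Nat.size m * 40 + K * 30 + 60) fun s' =>
      ∃ J ≤ K * K * Nat.size m, s'.idx 22 0 = J ∧ s'.num 12 0 = (1 + 1 / K) ^ J ∧
        (m : ℚ) ^ K ≤ (1 + 1 / K) ^ J ∧ s'.num 11 0 = m ∧ s'.idx 23 0 = 0 := by
  set L := K * K * Nat.size m with hL
  have hmul : ∀ k ≤ K, rs ((m : ℚ) ^ k) ≤ E.β := fun k hk =>
    (rs_natCast_pow_le m k).trans (by have := Nat.mul_le_mul_right (m + 2) hk; omega)
  have hpow : ∀ k ≤ L, rs ((1 + 1 / (K : ℚ)) ^ k) ≤ E.β := fun k hk =>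
    (rs_pow_le (rs_one_add_inv_le K) k).trans
      (by have := Nat.mul_le_mul_right (K + 6) hk; omega)
  refine Tri.seq (T₁ := 3) (T₂ := (K * 30 + 9) + (10 + ((L * 30 + 10) + 10)))
    (Q₁ := fun s' => s'.num 17 0 = 1)
    (Tri.line ?_ (by simp [Cmd.fee, IdxExpr.cost, NumExpr.cost])
      (by simp [Cmd.ev, NumExpr.val, IdxExpr.val, Store.setNum_num])) ?_ (by omega)
  · simp only [Cmd.ok, NumExpr.val, rs_one]; omega
  rintro s₁ hf₁ h17
  have hm₁ : s₁.idx 0 0 = m := by rw [hf₁.1 0 rfl, hsm]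
  refine Tri.seq (Q₁ := fun s' => s'.num 17 0 = (m : ℚ) ^ K)
    (Tri.forLoop (T₁ := 10) (n := K) (fun k s' => s'.num 17 0 = (m : ℚ) ^ k)
      (by rw [hf₁.1 29 rfl, hK]) hKN (by decide) rfl rfl (by simp [h17]) ?_ (fun _ _ h => h)
      (by omega)) ?_ le_rfl
  · intro k s' hk hf hi hb h
    have e0 : s'.idx 0 0 = m := by rw [hf.1 0 rfl, hm₁]
    refine Tri.line ?_ (by simp [Cmd.fee, IdxExpr.cost, NumExpr.cost])
      (by simp [Cmd.ev, NumExpr.val, IdxExpr.val, Store.setNum_num, h, e0, pow_succ])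
    simp only [Cmd.ok, NumExpr.val, IdxExpr.val, h, e0, ← pow_succ]
    exact hmul _ hk
  rintro s₂ hf₂ h17₂
  refine Tri.seq (Q₁ := fun s' => s'.num 12 0 = 1 ∧ s'.idx 22 0 = 0)
    (Tri.line ?_ (by simp [Cmd.fee, IdxExpr.cost, NumExpr.cost])
      (by simp [Cmd.ev, NumExpr.val, IdxExpr.val, Store.setNum_num, Store.setIdx_idx])) ?_ le_rfl
  · simp only [Cmd.ok, NumExpr.val, rs_one, IdxExpr.val]; omega
  rintro s₃ hf₃ ⟨h12, h22⟩
  have h17₃ : s₃.num 17 0 = (m : ℚ) ^ K := by rw [hf₃.2.1 17 rfl, h17₂]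
  have h13₃ : s₃.num 13 0 = 1 / K := by rw [hf₃.2.1 13 rfl, hf₂.2.1 13 rfl, hf₁.2.1 13 rfl, he]
  have hm₃ : s₃.idx 0 0 = m := by rw [hf₃.1 0 rfl, hf₂.1 0 rfl, hm₁]
  refine Tri.seq (T₁ := L * 30 + 10) (T₂ := 10) (Q₁ := fun s' => ∃ J ≤ L, s'.idx 22 0 = J ∧
    s'.num 12 0 = (1 + 1 / K) ^ J ∧ (m : ℚ) ^ K ≤ (1 + 1 / K) ^ J)
    (Tri.whileLoop (T₁ := 20) (fun f s' => ∃ J, J + f = L ∧ s'.idx 22 0 = J ∧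
      s'.num 12 0 = (1 + 1 / K) ^ J) L ⟨0, by simp, h22, by simpa using h12⟩ ?_ ?_ ?_) ?_ le_rfl
  · rintro f s' hf ⟨J, hJf, hJ, hT⟩ hb
    have e17 : s'.num 17 0 = (m : ℚ) ^ K := by rw [hf.2.1 17 rfl, h17₃]
    have e13 : s'.num 13 0 = 1 / K := by rw [hf.2.1 13 rfl, h13₃]
    simp only [Test.holds, NumExpr.val, IdxExpr.val, hT, e17] at hb
    -- At exponent `L = K * K * Nat.size m` the threshold is certainly reached, so the loop is still
    -- below it.
    have hJL : J < L := by
      by_contra! hcon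
      exact absurd hb (not_lt.2 (pow_le_of_le_mul hK1 rfl (hL ▸ hcon)))
    refine Tri.line ?_ (by simp [Cmd.fee, IdxExpr.cost, NumExpr.cost])
      ⟨f - 1, by omega, J + 1, by omega, ?_, ?_⟩
    · simp only [Cmd.ok, NumExpr.val, IdxExpr.val, hT, e13, ← pow_succ, Cmd.ev, Store.setNum_idx, hJ]
      exact ⟨hpow _ hJL, by omega⟩
    · simp [Cmd.ev, IdxExpr.val, Store.setIdx_idx, hJ]
    · simp [Cmd.ev, NumExpr.val, IdxExpr.val, Store.setNum_num, hT, e13, pow_succ]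
  · rintro f s' hf ⟨J, hJf, hJ, hT⟩ hb
    have e17 : s'.num 17 0 = (m : ℚ) ^ K := by rw [hf.2.1 17 rfl, h17₃]
    simp only [Test.holds, NumExpr.val, IdxExpr.val, hT, e17, not_lt] at hb
    exact ⟨J, by omega, hJ, hT, hb⟩
  · simp only [Test.cost, NumExpr.cost, IdxExpr.cost]; omega
  rintro s₄ hf₄ ⟨J, hJL, hJ, hT, hle⟩
  have hm₄ : s₄.idx 0 0 = m := by rw [hf₄.1 0 rfl, hm₃]
  refine Tri.line ?_ (by simp [Cmd.fee, IdxExpr.cost, NumExpr.cost]) ⟨J, hJL, ?_, ?_, hle, ?_, ?_⟩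
  · simp only [Cmd.ok, NumExpr.val, IdxExpr.val, hm₄]
    exact ⟨(rs_natCast_le m).trans hβm, Nat.zero_le _⟩
  all_goals simp [Cmd.ev, NumExpr.val, IdxExpr.val, Store.setNum_num, Store.setIdx_idx, hJ, hT, hm₄]

/-- Compute the smallest capacity of the elements of the set in `idx 1`. -/
def bottleneck : Cmd :=
  .seq (.setNum 14 (.const 0) (.const 0))
  (forC 24 0 (.ite (.and (.idxLt (.const 0) (.get 1 (V 24)))
      (.not (.and (.numLt (.const 0) (X 14)) (.not (.numLt (.get 1 (V 24)) (X 14))))))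
    (.setNum 14 (.const 0) (.get 1 (V 24))) .skip))

theorem bottleneck_tri {E : Env} {m : ℕ} {s : Store} (hs : s.Bdd E.N E.β) (hsm : s.idx 0 0 = m)
    {U : Fin m → ℕ} (hU : ∀ i, 0 < U i) (hu : ∀ i : Fin m, s.num 1 i = U i)
    (hne : (s.outputSet m).Nonempty) :
    Tri E bottleneck s (m * 50 + 20) fun s' => (∀ i ∈ s.outputSet m, s'.num 14 0 ≤ U i) ∧
      ∃ i ∈ s.outputSet m, s'.num 14 0 = U i := by
  set I := s.outputSet m with hI
  have hβ : 2 ≤ E.β := (two_le_rs _).trans (hs.2 0 0)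
  refine Tri.seq (T₁ := 3) (T₂ := m * 50 + 9) (Q₁ := fun s' => s'.num 14 0 = 0)
    (Tri.line ?_ (by simp [Cmd.fee, IdxExpr.cost, NumExpr.cost])
      (by simp [Cmd.ev, NumExpr.val, IdxExpr.val, Store.setNum_num])) ?_ (by omega)
  · simp only [Cmd.ok, NumExpr.val, rs_zero]; exact hβ
  rintro s₁ hf₁ h14
  -- The value 0 marks that no element of the set has been seen yet; it cannot be confused with a
  -- capacity, as these are positive.
  refine Tri.forLoop (T₁ := 30) (n := m) (fun k s' => (s'.num 14 0 = 0 ∧ below k I = ∅) ∨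
    ((∀ i ∈ below k I, s'.num 14 0 ≤ U i) ∧ ∃ i ∈ below k I, s'.num 14 0 = U i))
    (by rw [hf₁.1 0 rfl, hsm]) (hsm ▸ hs.1 0 0) (by decide) rfl rfl
    (.inl ⟨h14, below_zero I⟩) ?_ ?_ (by omega)
  · rintro k s' hk hf hi hb h
    have hs' := hf.2.2 (hf₁.2.2 hs)
    have e1 : s'.idx 1 = s.idx 1 := by rw [hf.1 1 rfl, hf₁.1 1 rfl]
    have eu : s'.num 1 k = U ⟨k, hk⟩ := by rw [hf.2.1 1 rfl, hf₁.2.1 1 rfl, ← hu]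
    have hUk : (0 : ℚ) < U ⟨k, hk⟩ := by exact_mod_cast hU ⟨k, hk⟩
    have hmem : (⟨k, hk⟩ : Fin m) ∈ I ↔ s.idx 1 k ≠ 0 := Store.mem_outputSet
    have hpos : (∃ i ∈ below k I, s'.num 14 0 = U i) → 0 < s'.num 14 0 := by
      rintro ⟨i, -, hi⟩
      rw [hi]; exact_mod_cast hU i
    refine Tri.ite (T₁ := 6) (fun ht => ?_) (fun ht => ?_)
      (by simp [Test.cost, IdxExpr.cost, NumExpr.cost])
    · simp only [Test.holds, IdxExpr.val, NumExpr.val, hi, e1, eu] at ht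
      have hkI := hmem.2 ht.1.ne'
      refine Tri.line ?_ (by simp [Cmd.fee, IdxExpr.cost, NumExpr.cost]) (.inr ?_)
      · simp only [Cmd.ok, NumExpr.val]; exact hs'.2 _ _
      · simp only [Cmd.ev, NumExpr.val, IdxExpr.val, hi, eu, Store.setIdx_num, Store.setNum_num,
          if_true, Function.update_self, below_succ_of_mem hk hkI]
        refine ⟨fun i hi => ?_, _, Finset.mem_insert_self _ _, rfl⟩
        rcases Finset.mem_insert.1 hi with rfl | hi
        · exact le_rfl
        · rcases h with ⟨-, h⟩ | ⟨h1, h2⟩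
          · simp [h] at hi
          · have h3 : (U ⟨k, hk⟩ : ℚ) < s'.num 14 0 := by
              by_contra h4
              exact ht.2 ⟨hpos h2, h4⟩
            exact h3.le.trans (h1 i hi)
    · simp only [Test.holds, IdxExpr.val, NumExpr.val, hi, e1, eu] at ht
      refine Tri.line trivial (by simp [Cmd.fee]) ?_
      simp only [Cmd.ev, Store.setIdx_num]
      by_cases hkI : (⟨k, hk⟩ : Fin m) ∈ I
      · rw [below_succ_of_mem hk hkI]
        rw [not_and, not_not] at ht
        obtain ⟨g1, g2⟩ := ht (Nat.pos_of_ne_zero (hmem.1 hkI))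
        rcases h with ⟨h, -⟩ | ⟨h1, i, h2, h3⟩
        · rw [h] at g1; exact absurd g1 (lt_irrefl _)
        · refine .inr ⟨fun i hi => ?_, i, Finset.mem_insert_of_mem h2, h3⟩
          rcases Finset.mem_insert.1 hi with rfl | hi
          · exact not_lt.1 g2
          · exact h1 i hi
      · rwa [below_succ_of_notMem hk hkI]
  · rintro s' hf h
    rw [below_self] at h
    exact h.resolve_left fun h => hne.ne_empty h.2

/-- Append the set in `idx 1` to the output and increase the lengths of its elements. -/
def appendRow : Cmd :=
  forC 24 0 (.seq (.setIdx 2 (.add (.mul (V 23) (V 0)) (V 24)) (.get 1 (V 24)))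
    (.ite (.idxLt (.const 0) (.get 1 (V 24)))
      (.setNum 4 (V 24) (.mul (.get 4 (V 24)) (.add (.const 1) (.mul (X 13)
        (.div (X 14) (.get 1 (V 24))))))) .skip))

theorem appendRow_tri {E : Env} {m R b : ℕ} {s : Store} (hs : s.Bdd E.N E.β) (hsm : s.idx 0 0 = m)
    (hR : s.idx 23 0 = R)
    (hb : ∀ i < m, rs (s.num 4 i * (1 + s.num 13 0 * (s.num 14 0 / s.num 1 i))) ≤ b)
    (hβ : b ≤ E.β) :
    Tri E appendRow s (m * 80 + 9) fun s' =>
      (∀ i : Fin m, i ∈ s.outputSet m →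
        s'.num 4 i = s.num 4 i * (1 + s.num 13 0 * (s.num 14 0 / s.num 1 i))) ∧
      (∀ i : Fin m, i ∉ s.outputSet m → s'.num 4 i = s.num 4 i) ∧
      (∀ l < R, s'.outputRow m l = s.outputRow m l) ∧ s'.outputRow m R = s.outputSet m := by
  set I := s.outputSet m with hI
  refine Tri.forLoop (T₁ := 60) (n := m) (fun k s' =>
    (∀ i : Fin m, i ∈ below k I →
      s'.num 4 i = s.num 4 i * (1 + s.num 13 0 * (s.num 14 0 / s.num 1 i))) ∧
    (∀ i : Fin m, i ∉ below k I → s'.num 4 i = s.num 4 i) ∧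
    (∀ l < R, ∀ i < m, s'.idx 2 (l * m + i) = s.idx 2 (l * m + i)) ∧
    ∀ i < k, s'.idx 2 (R * m + i) = s.idx 1 i) hsm (hsm ▸ hs.1 0 0) (by decide) rfl rfl
    (by simp [below_zero, Store.setIdx_idx]) ?_ ?_ (by omega)
  · rintro k s' hk hf hi hb' ⟨h1, h2, h3, h4⟩
    have hs' := hf.2.2 hs
    have e1 : s'.idx 1 = s.idx 1 := hf.1 1 rfl
    have eR : s'.idx 23 0 = R := by rw [hf.1 23 rfl, hR]
    have eu : s'.num 1 = s.num 1 := hf.2.1 1 rfl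
    have e13 : s'.num 13 = s.num 13 := hf.2.1 13 rfl
    have e14 : s'.num 14 = s.num 14 := hf.2.1 14 rfl
    have e4 : s'.num 4 k = s.num 4 k := h2 ⟨k, hk⟩ (by simp [mem_below])
    have hmem : (⟨k, hk⟩ : Fin m) ∈ I ↔ s.idx 1 k ≠ 0 := Store.mem_outputSet
    -- Writing at column `k` of row `R` touches neither earlier rows nor earlier columns, by
    -- uniqueness of the matrix position.
    have hrow : ∀ l i, i < m → (l < R ∨ l = R ∧ i < k) → R * m + k ≠ l * m + i := by
      intro l i hi hl h
      obtain ⟨rfl, rfl⟩ := mul_add_inj hk hi h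
      omega
    refine Tri.seq (T₁ := 14) (T₂ := 40) (Q₁ := fun s'' =>
      s'' = s'.setIdx 2 (R * m + k) (s.idx 1 k)) (Tri.line ?_ (by simp [Cmd.fee, IdxExpr.cost])
      (by simp [Cmd.ev, IdxExpr.val, hi, hb', eR, e1])) ?_ (by omega)
    · simp only [Cmd.ok, IdxExpr.val]; exact hs'.1 _ _
    rintro _ - rfl
    have hr1 : ∀ l < R, ∀ i < m, Function.update (s'.idx 2) (R * m + k) (s.idx 1 k) (l * m + i) =
        s.idx 2 (l * m + i) := fun l hl i hi => by
      rw [Function.update_of_ne (hrow l i hi (.inl hl)).symm, h3 l hl i hi]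
    have hr2 : ∀ i < k + 1, Function.update (s'.idx 2) (R * m + k) (s.idx 1 k) (R * m + i) =
        s.idx 1 i := fun i hi => by
      rcases Nat.lt_succ_iff_lt_or_eq.1 hi with hi | rfl
      · rw [Function.update_of_ne (hrow R i (by omega) (.inr ⟨rfl, hi⟩)).symm, h4 i hi]
      · rw [Function.update_self]
    refine Tri.ite (T₁ := 20) (fun ht => ?_) (fun ht => ?_)
      (by simp [Test.cost, IdxExpr.cost])
    · have hkI := hmem.2 (by
        simp [Test.holds, IdxExpr.val, Store.setIdx_idx, hi, e1] at ht
        omega)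
      refine Tri.line ?_ (by simp [Cmd.fee, IdxExpr.cost, NumExpr.cost]) ?_
      · simp only [Cmd.ok, NumExpr.val, IdxExpr.val, Store.setIdx_num, Store.setIdx_idx,
          show ¬ (24 = 2) by decide, if_false, hi, e4, e13, e14, eu]
        exact (hb k hk).trans hβ
      · simp only [Cmd.ev, NumExpr.val, IdxExpr.val, Store.setIdx_num, Store.setIdx_idx,
          Store.setNum_num, Store.setNum_idx, show ¬ (24 = 2) by decide, show ¬ (2 = 24) by decide,
          if_false, if_true, hi, e4, e13, e14, eu, below_succ_of_mem hk hkI]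
        refine ⟨fun i hi => ?_, fun i hi => ?_, hr1, hr2⟩
        · rcases Finset.mem_insert.1 hi with rfl | hi
          · rw [Function.update_self]
          · rw [Function.update_of_ne (mem_below.1 hi).2.ne, h1 i hi]
        · rw [Finset.mem_insert, not_or] at hi
          rw [Function.update_of_ne (fun h => hi.1 (Fin.ext h)), h2 i hi.2]
    · have hkI : (⟨k, hk⟩ : Fin m) ∉ I := fun h => hmem.1 h (by
        simpa [Test.holds, IdxExpr.val, Store.setIdx_idx, hi, e1] using ht)
      refine Tri.line trivial (by simp [Cmd.fee]) ?_
      simp only [Cmd.ev, Store.setIdx_num, Store.setIdx_idx, if_true, if_false,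
        show ¬ (2 = 24) by decide, below_succ_of_notMem hk hkI]
      exact ⟨h1, h2, hr1, hr2⟩
  · rintro s' hf ⟨h1, h2, h3, h4⟩
    rw [below_self] at h1 h2
    refine ⟨h1, h2, fun l hl => ?_, ?_⟩
    · ext i; simp [Store.outputRow, h3 l hl i i.2]
    · ext i; simp [Store.outputRow, hI, Store.outputSet, h4 i i.2]

/-- Add the base in `idx 1` to the packing. -/
def augment : Cmd :=
  .seq bottleneck (.seq appendRow
  (.seq (.setNum 3 (V 23) (.div (X 14) (.add (.ofIdx (V 22)) (.const 1))))
  (.seq (.setNum 11 (.const 0) (.add (X 11) (.mul (.mul (X 13) (X 14)) (X 8))))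
  (.setIdx 23 (.const 0) (.add (V 23) (.const 1))))))

/-- Look for a base of small ratio; add it to the packing or increase the lower bound. -/
def packStep : Cmd :=
  .seq (.setNum 7 (.const 0) (.mul (.add (.const 1) (X 13)) (X 10)))
  (.seq minBase
  (.ite (.numLt (X 8) (.mul (X 7) (X 9))) augment (.setNum 10 (.const 0) (X 7))))

/-- Augment the packing until the threshold is reached. -/
def packLoop : Cmd := .while (.numLt (X 11) (X 12)) packStep

section Pack

variable {m : ℕ} {M : Matroid (Fin m)} {F N β b : ℕ} {s : Store} {U : Fin m → ℕ} {c : ℕ → ℚ}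
  {J K R p : ℕ} {α₀ α : ℚ}

theorem Store.outputRow_setNum (s : Store) (a i : ℕ) (v : ℚ) :
    (s.setNum a i v).outputRow m = s.outputRow m := rfl

theorem Store.outputRow_setIdx (s : Store) {a : ℕ} (h : a ≠ 2) (i v : ℕ) :
    (s.setIdx a i v).outputRow m = s.outputRow m := by
  funext l
  simp only [Store.outputRow, Store.setIdx_idx, if_neg h.symm]

/-- One augmentation enlarges the size of a length by at most `b`. Since `R ≤ m * J`, all lengths
stay polynomially bounded although they are kept exactly. -/
theorem augment_tri (hs : s.Bdd N β) (hm : 1 ≤ m) (hsm : s.idx 0 0 = m) (hK : 1 ≤ K)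
    (he : s.num 13 0 = 1 / K) (hJ : s.idx 22 0 = J) (hR : s.idx 23 0 = R)
    (hU : ∀ i, 0 < U i) (hu : ∀ i : Fin m, s.num 1 i = U i)
    (hbu : ∀ i : Fin m, 2 * rs (U i) + K + 6 ≤ b) (hmJ : m * J + 1 ≤ N)
    (hβ : (m + 4) * ((m * J + J + 4) * b) ≤ β) (hα : 0 < α)
    (hInv : PackInv M U c (1 / K) α₀ J (s.num 4) (s.num 11 0) α R p (s.outputRow m) (s.num 3))
    (hy : ∀ i < m, rs (s.num 4 i) ≤ (R + 1) * b)
    (hD : s.num 11 0 < (1 + 1 / K) ^ J) (hI : M.IsBase (s.outputSet m : Set (Fin m)))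
    (hY : s.num 8 0 = tot (s.num 4) (s.outputSet m))
    (hlt : tot (s.num 4) (s.outputSet m) < (1 + 1 / K) * α * tot c (s.outputSet m)) :
    Tri ⟨indepOracle M, F, N, β⟩ augment s (m * 150 + 80) fun s' => s'.idx 23 0 = R + 1 ∧
      (∀ i < m, rs (s'.num 4 i) ≤ (R + 2) * b) ∧
      PackInv M U c (1 / K) α₀ J (s'.num 4) (s'.num 11 0) α (R + 1) p (s'.outputRow m)
        (s'.num 3) := by
  have he0 : (0 : ℚ) < 1 / K := by positivity
  have hRle := hInv.R_le he0
  have hR2 : (R + 2) * b ≤ (m * J + J + 3) * b := Nat.mul_le_mul_right _ (by omega)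
  have hb2 : (m * J + J + 4) * b = (m * J + J + 3) * b + b := by ring
  have hβ' : m * ((m * J + J + 4) * b) + 4 * ((m * J + J + 4) * b) ≤ β := by rwa [← add_mul]
  have hbJ : J * 1 + b ≤ (m * J + J + 3) * b := by
    have h1 : 1 ≤ b := by have := hbu ⟨0, hm⟩; omega
    have h2 : J * 1 ≤ J * b := Nat.mul_le_mul_left _ h1
    have h3 : (J + 1) * b ≤ (m * J + J + 3) * b := Nat.mul_le_mul_right _ (by omega)
    rw [add_mul] at h3
    omega
  have hne : (s.outputSet m).Nonempty := by
    rw [Finset.nonempty_iff_ne_empty]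
    intro h
    rw [h] at hlt
    simp [tot] at hlt
  refine Tri.seq (T₂ := m * 80 + 9 + 40) (bottleneck_tri hs hsm hU hu hne) ?_ (by omega)
  rintro s₁ hf₁ ⟨hv, i₀, hi₀, hv₀⟩
  have hs₁ := hf₁.2.2 hs
  have eI₁ : s₁.outputSet m = s.outputSet m := by simp [Store.outputSet, hf₁.1 1 rfl]
  have e4₁ : s₁.num 4 = s.num 4 := hf₁.2.1 4 rfl
  have e13₁ : s₁.num 13 0 = 1 / K := by rw [hf₁.2.1 13 rfl, he]
  have eu₁ : ∀ i : Fin m, s₁.num 1 i = U i := fun i => by rw [hf₁.2.1 1 rfl, hu]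
  set v := s₁.num 14 0 with hvdef
  have hvb : rs v + K + 6 ≤ b := by
    rw [hv₀]
    have := hbu i₀
    omega
  -- The factor `1 + (1 / K) * (v / u i)` has size at most `rs v + rs (u i) + K + 6`, and `v` is
  -- itself a capacity; this explains the shape of `hbu`.
  have hfac : ∀ i < m, rs (s₁.num 4 i * (1 + s₁.num 13 0 * (s₁.num 14 0 / s₁.num 1 i))) ≤
      (R + 2) * b := by
    intro i hi
    rw [e4₁, e13₁, ← hvdef, eu₁ ⟨i, hi⟩]
    have h1 := hy i hi
    have h2 := rs_mul_le (s.num 4 i) (1 + 1 / K * (v / U ⟨i, hi⟩))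
    have h3 := rs_add_le 1 (1 / K * (v / (U ⟨i, hi⟩ : ℚ)))
    have h4 := rs_mul_le (1 / (K : ℚ)) (v / U ⟨i, hi⟩)
    have h5 := rs_div_le v (U ⟨i, hi⟩ : ℚ)
    have h6 := rs_div_le 1 (K : ℚ)
    have h7 := rs_natCast_le K
    have h8 := hbu ⟨i, hi⟩
    have h9 := hbu i₀
    rw [← hv₀] at h9
    rw [rs_one] at h3 h6
    have e1 : (R + 2) * b = (R + 1) * b + b := by ring
    omega
  refine Tri.seq (appendRow_tri (m := m) (R := R) (b := (R + 2) * b) hs₁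
    (by rw [hf₁.1 0 rfl, hsm]) (by rw [hf₁.1 23 rfl, hR]) hfac (show _ ≤ β by omega)) ?_ le_rfl
  rintro s₂ hf₂ ⟨a1, a2, a3, a4⟩
  have hs₂ := hf₂.2.2 hs₁
  rw [e4₁, e13₁, eI₁] at a1
  rw [e4₁, eI₁] at a2
  rw [eI₁] at a4
  have erow₁ : ∀ l, s₁.outputRow m l = s.outputRow m l := fun l => by
    simp [Store.outputRow, hf₁.1 2 rfl]
  have e3 : s₂.num 3 = s.num 3 := by rw [hf₂.2.1 3 rfl, hf₁.2.1 3 rfl]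
  have e11 : s₂.num 11 0 = s.num 11 0 := by rw [hf₂.2.1 11 rfl, hf₁.2.1 11 rfl]
  have e14 : s₂.num 14 0 = v := by rw [hf₂.2.1 14 rfl]
  have e13 : s₂.num 13 0 = 1 / K := by rw [hf₂.2.1 13 rfl, e13₁]
  have e8 : s₂.num 8 0 = tot (s.num 4) (s.outputSet m) := by
    rw [hf₂.2.1 8 rfl, hf₁.2.1 8 rfl, hY]
  have eR : s₂.idx 23 0 = R := by rw [hf₂.1 23 rfl, hf₁.1 23 rfl, hR]
  have eJ : s₂.idx 22 0 = J := by rw [hf₂.1 22 rfl, hf₁.1 22 rfl, hJ]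
  have inv := hInv.augment he0 hα hU hD hI hlt (v := v) hv ⟨i₀, hi₀, hv₀⟩ (y' := s₂.num 4)
    (row' := s₂.outputRow m) (wt' := Function.update (s.num 3) R (v / (J + 1)))
    (fun i hi => by rw [a1 i hi, eu₁]) a2 (fun l hl => by rw [a3 l hl, erow₁]) a4
    (fun l hl => Function.update_of_ne hl.ne _ _) (Function.update_self _ _ _)
  have hyb : ∀ i < m, rs (s₂.num 4 i) ≤ (R + 2) * b := by
    intro i hi
    by_cases hmem : (⟨i, hi⟩ : Fin m) ∈ s.outputSet m
    · have := hfac i hi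
      rw [e4₁, e13₁] at this
      rwa [a1 ⟨i, hi⟩ hmem]
    · rw [a2 ⟨i, hi⟩ hmem]
      exact (hy i hi).trans (Nat.mul_le_mul_right _ (by omega))
  -- The size of `D` is bounded through `D = ∑ u i * y i` and not through the recursion by which it
  -- is updated, which would add up the sizes of all steps.
  have hDb : rs (s.num 11 0 + 1 / K * v * tot (s.num 4) (s.outputSet m)) ≤ β := by
    rw [inv.D_eq]
    refine (rs_sum_le _ _ ((m * J + J + 4) * b) fun i _ => ?_).trans ?_
    · have h1 := rs_mul_le (U i : ℚ) (s₂.num 4 i)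
      have h2 := hyb i i.2
      have h3 := hbu i
      omega
    · rw [Finset.card_univ, Fintype.card_fin]
      have := hbu ⟨0, hm⟩
      omega
  refine Tri.line ?_ (by simp [Cmd.fee, IdxExpr.cost, NumExpr.cost]) ⟨?_, ?_, ?_⟩
  · simp only [Cmd.ok, Cmd.ev, NumExpr.val, IdxExpr.val, Store.setNum_num, Store.setNum_idx, e14, eR,
      eJ, e11, e13, e8, if_false, show ¬ (11 = 3) by decide, show ¬ (13 = 3) by decide,
      show ¬ (14 = 3) by decide, show ¬ (8 = 3) by decide]
    refine ⟨?_, hDb, by omega⟩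
    have h1 := rs_div_le v (J + 1)
    have h2 := rs_add_le (J : ℚ) 1
    have h3 := rs_natCast_le J
    rw [rs_one] at h2
    omega
  · simp [Cmd.ev, IdxExpr.val, Store.setIdx_idx, eR]
  · simpa [Cmd.ev, Store.setNum_num] using hyb
  · simpa [Cmd.ev, NumExpr.val, IdxExpr.val, Store.setNum_num, e14, eR, eJ, e11, e13, e8, e3,
      Store.outputRow_setNum, Store.outputRow_setIdx] using inv

/-- Exactly one of the two counters `R` and `p` grows in each step. Their sum is the measure for
termination, and each of them also bounds the size of the numbers it multiplies. -/
theorem packStep_tri (hs : s.Bdd N β) (hm : 1 ≤ m) (hN : 2 * m ≤ N) (hsm : s.idx 0 0 = m)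
    (hK : 1 ≤ K) (hμ : s.num 6 0 = 1)
    (he : s.num 13 0 = 1 / K) (hJ : s.idx 22 0 = J) (hR : s.idx 23 0 = R)
    (hU : ∀ i, 0 < U i) (hu : ∀ i : Fin m, s.num 1 i = U i) (hc : s.num 2 = c)
    (hbu : ∀ i : Fin m, 2 * rs (U i) + K + 6 ≤ b) (hbc : ∀ i < m, rs (c i) ≤ b)
    (hmJ : m * J + 1 ≤ N)
    (hβ : (m + 4) * ((m * J + J + 4) * b) ≤ β) (hα : 0 < s.num 10 0) (hpJ : p ≤ J)
    (hInv : PackInv M U c (1 / K) α₀ J (s.num 4) (s.num 11 0) (s.num 10 0) R p (s.outputRow m)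
      (s.num 3))
    (hy : ∀ i < m, rs (s.num 4 i) ≤ (R + 1) * b) (hαb : rs (s.num 10 0) ≤ (p + 1) * b)
    (hD : s.num 11 0 < (1 + 1 / K) ^ J) :
    Tri ⟨indepOracle M, F, N, β⟩ packStep s (1100 * (m * F + m * Nat.size m)) fun s' =>
      ∃ R' p', R' + p' = R + p + 1 ∧ s'.idx 23 0 = R' ∧
      (∀ i < m, rs (s'.num 4 i) ≤ (R' + 1) * b) ∧ rs (s'.num 10 0) ≤ (p' + 1) * b ∧
      0 < s'.num 10 0 ∧
      PackInv M U c (1 / K) α₀ J (s'.num 4) (s'.num 11 0) (s'.num 10 0) R' p' (s'.outputRow m)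
        (s'.num 3) := by
  have hsz : 1 ≤ Nat.size m := Nat.size_pos.2 hm
  have hm2 : m ≤ m * Nat.size m := Nat.le_mul_of_pos_right _ hsz
  have he0 : (0 : ℚ) < 1 / K := by positivity
  have hRle := hInv.R_le he0
  have hR1 : (R + 1) * b ≤ (m * J + J + 4) * b := Nat.mul_le_mul_right _ (by omega)
  have hp2 : (p + 2) * b ≤ (m * J + J + 4) * b := Nat.mul_le_mul_right _ (by omega)
  have hb1 : 1 * b ≤ (m * J + J + 4) * b := Nat.mul_le_mul_right _ (by omega)
  have hβ' : m * ((m * J + J + 4) * b) + 4 * ((m * J + J + 4) * b) ≤ β := by rwa [← add_mul]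
  have hl : rs ((1 + 1 / K) * s.num 10 0) ≤ (p + 2) * b := by
    have h1 := rs_mul_le (1 + 1 / (K : ℚ)) (s.num 10 0)
    have h2 := rs_one_add_inv_le K
    have h3 := hbu ⟨0, hm⟩
    have h4 : (p + 2) * b = (p + 1) * b + b := by ring
    omega
  refine Tri.seq (T₁ := 15) (T₂ := 800 * (m * F + m * Nat.size m) + (m * 150 + 80 + 20))
    (Q₁ := fun s' => s'.num 7 0 = (1 + 1 / K) * s.num 10 0)
    (Tri.line ?_ (by simp [Cmd.fee, IdxExpr.cost, NumExpr.cost])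
      (by simp [Cmd.ev, NumExpr.val, IdxExpr.val, Store.setNum_num, he])) ?_ (by omega)
  · simp only [Cmd.ok, NumExpr.val, IdxExpr.val, he]
    exact hl.trans (show _ ≤ β by omega)
  rintro s₁ hf₁ h7
  have e4₁ : s₁.num 4 = s.num 4 := hf₁.2.1 4 rfl
  have e2₁ : s₁.num 2 = c := by rw [hf₁.2.1 2 rfl, hc]
  have e6₁ : s₁.num 6 0 = 1 := by rw [hf₁.2.1 6 rfl, hμ]
  have hs₁ := hf₁.2.2 hs
  refine Tri.seq (minBase_tri (b := (m * J + J + 4) * b) hs₁ hm (by rw [hf₁.1 0 rfl, hsm]) hN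
    (by rw [e4₁]; exact fun i hi => (hy i hi).trans hR1)
    (by rw [e2₁]; exact fun i hi => (hbc i hi).trans (by omega))
    (by rw [e6₁, rs_one]; have := hbu ⟨0, hm⟩; omega) (by rw [h7]; exact hl.trans hp2) hβ) ?_ le_rfl
  rintro s₂ hf₂ ⟨g1, g2, g3⟩
  have hs₂ := hf₂.2.2 hs₁
  rw [e4₁, e2₁, e6₁, h7] at g1
  have hmin := g1.isMinBase (y := s.num 4) (c := c) fun _ _ _ _ h => h
  have e4 : s₂.num 4 = s.num 4 := by rw [hf₂.2.1 4 rfl, e4₁]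
  rw [e4₁, ← e4] at g2
  rw [e2₁] at g3
  have e7 : s₂.num 7 0 = (1 + 1 / K) * s.num 10 0 := by rw [hf₂.2.1 7 rfl, h7]
  have e10 : s₂.num 10 = s.num 10 := by rw [hf₂.2.1 10 rfl, hf₁.2.1 10 rfl]
  have e11 : s₂.num 11 = s.num 11 := by rw [hf₂.2.1 11 rfl, hf₁.2.1 11 rfl]
  have e3 : s₂.num 3 = s.num 3 := by rw [hf₂.2.1 3 rfl, hf₁.2.1 3 rfl]
  have e13 : s₂.num 13 = s.num 13 := by rw [hf₂.2.1 13 rfl, hf₁.2.1 13 rfl]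
  have e1 : s₂.num 1 = s.num 1 := by rw [hf₂.2.1 1 rfl, hf₁.2.1 1 rfl]
  have eR : s₂.idx 23 = s.idx 23 := by rw [hf₂.1 23 rfl, hf₁.1 23 rfl]
  have erow : s₂.outputRow m = s.outputRow m := by
    funext l; simp [Store.outputRow, hf₂.1 2 rfl, hf₁.1 2 rfl]
  have inv : PackInv M U c (1 / K) α₀ J (s₂.num 4) (s₂.num 11 0) (s.num 10 0) R p
      (s₂.outputRow m) (s₂.num 3) := by rw [e4, e11, erow, e3]; exact hInv
  refine Tri.ite (T₁ := m * 150 + 80) (fun ht => ?_) (fun ht => ?_)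
    (by simp [Test.cost, IdxExpr.cost, NumExpr.cost]; omega)
  · simp only [Test.holds, NumExpr.val, IdxExpr.val, g2, g3, e7] at ht
    refine (augment_tri hs₂ hm (by rw [hf₂.1 0 rfl, hf₁.1 0 rfl, hsm]) hK (by rw [e13, he])
      (by rw [hf₂.1 22 rfl, hf₁.1 22 rfl, hJ]) (by rw [eR, hR]) hU (by rwa [e1]) hbu hmJ hβ hα inv
      (by rwa [e4]) (by rwa [e11]) hmin.1 g2 ht).mono le_rfl ?_
    rintro s₃ hf₃ ⟨h1, h2, h3⟩
    have e10' : s₃.num 10 0 = s.num 10 0 := by rw [hf₃.2.1 10 rfl, e10]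
    exact ⟨R + 1, p, by omega, h1, h2, by rwa [e10'], by rwa [e10'], by rwa [e10']⟩
  · simp only [Test.holds, NumExpr.val, IdxExpr.val, g2, g3, e7] at ht
    have hlb : IsLB M (s.num 4) c ((1 + 1 / K) * s.num 10 0) := by
      rw [hmin.isLB_iff, ← e4]; exact ht
    rw [e4] at inv
    have inv' := inv.phase hlb
    refine Tri.line ?_ (by simp [Cmd.fee, IdxExpr.cost, NumExpr.cost])
      ⟨R, p + 1, by omega, ?_, ?_, ?_, ?_, ?_⟩
    · simp only [Cmd.ok, NumExpr.val, IdxExpr.val, e7]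
      exact hl.trans (show _ ≤ β by omega)
    · simp [Cmd.ev, eR, hR]
    · simpa [Cmd.ev, Store.setNum_num, e4] using hy
    · simpa [Cmd.ev, NumExpr.val, IdxExpr.val, Store.setNum_num, e7] using hl
    · simp [Cmd.ev, NumExpr.val, IdxExpr.val, Store.setNum_num, e7]
      exact mul_pos (by positivity) hα
    · simpa [Cmd.ev, NumExpr.val, IdxExpr.val, Store.setNum_num, e7, e4, Store.outputRow_setNum] using inv'

/-- The base `I` attaining the initial `α` is what bounds the number of phases. With `R ≤ m * J` and
`p ≤ J` the fuel `m * J + J` cannot run out. -/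
theorem packLoop_tri (hs : s.Bdd N β) (hm : 1 ≤ m) (hN : 2 * m ≤ N) (hsm : s.idx 0 0 = m)
    (hK : 1 ≤ K) (hμ : s.num 6 0 = 1)
    (he : s.num 13 0 = 1 / K) (hJ : s.idx 22 0 = J) (hR : s.idx 23 0 = 0)
    (hT : s.num 12 0 = (1 + 1 / K) ^ J)
    (hU : ∀ i, 0 < U i) (hu : ∀ i : Fin m, s.num 1 i = U i) (hc : s.num 2 = c)
    (hbu : ∀ i : Fin m, 2 * rs (U i) + K + 6 ≤ b) (hbc : ∀ i < m, rs (c i) ≤ b)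
    (hmJ : m * J + 1 ≤ N) (hβ : (m + 4) * ((m * J + J + 4) * b) ≤ β) (hmJ' : (m : ℚ) ≤ (1 + 1 / K) ^ J)
    (hy : ∀ i : Fin m, s.num 4 i = 1 / U i) (hD : s.num 11 0 = m)
    (hyb : ∀ i < m, rs (s.num 4 i) ≤ b) (hαb : rs (s.num 10 0) ≤ b)
    (hLB : IsLB M (s.num 4) c (s.num 10 0)) {I : Finset (Fin m)} (hI : M.IsBase (I : Set (Fin m)))
    (hcI : 0 < tot c I) (hα : s.num 10 0 = tot (s.num 4) I / tot c I) :
    Tri ⟨indepOracle M, F, N, β⟩ packLoop s ((m * J + J) * (1120 * (m * F + m * Nat.size m)) + 10)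
      fun s' => ∃ (R p : ℕ) (y : ℕ → ℚ) (D α : ℚ), s'.idx 23 0 = R ∧ (1 + 1 / K) ^ J ≤ D ∧
        PackInv M U c (1 / K) (s.num 10 0) J y D α R p (s'.outputRow m) (s'.num 3) := by
  have hsz : 1 ≤ Nat.size m := Nat.size_pos.2 hm
  have hm2 : m ≤ m * Nat.size m := Nat.le_mul_of_pos_right _ hsz
  have he0 : (0 : ℚ) < 1 / K := by positivity
  have hypos : ∀ i < m, 0 < s.num 4 i := fun i hi => by
    have := hU ⟨i, hi⟩
    rw [hy ⟨i, hi⟩]; positivity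
  have hα₀ : 0 < s.num 10 0 := by
    rw [hα]; exact div_pos (tot_pos_of_tot_ne_zero hypos hcI.ne') hcI
  have hαI : tot (s.num 4) I = s.num 10 0 * tot c I := by rw [hα, div_mul_cancel₀ _ hcI.ne']
  have hlt : (m : ℚ) < (1 + 1 / K) ^ (J + 1) :=
    hmJ'.trans_lt (pow_lt_pow_right₀ (by linarith) (Nat.lt_succ_self J))
  refine Tri.whileLoop (T₁ := 1100 * (m * F + m * Nat.size m)) (fun f s' => ∃ R p,
    f + R + p = m * J + J ∧ s'.idx 23 0 = R ∧
    (∀ i < m, rs (s'.num 4 i) ≤ (R + 1) * b) ∧ rs (s'.num 10 0) ≤ (p + 1) * b ∧ 0 < s'.num 10 0 ∧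
    PackInv M U c (1 / K) (s.num 10 0) J (s'.num 4) (s'.num 11 0) (s'.num 10 0) R p
      (s'.outputRow m) (s'.num 3)) (m * J + J)
    ⟨0, 0, rfl, hR, by simpa using hyb, by simpa using hαb, hα₀, by
      rw [hD]; exact .init hU hy hLB hlt⟩ ?_ ?_ ?_
  · rintro f s' hf ⟨R, p, hfr, g1, g2, g3, g4, g5⟩ ht
    have e12 : s'.num 12 0 = (1 + 1 / K) ^ J := by rw [hf.2.1 12 rfl, hT]
    simp only [Test.holds, NumExpr.val, IdxExpr.val, e12] at ht
    refine (packStep_tri (hf.2.2 hs) hm hN (by rw [hf.1 0 rfl, hsm]) hK (by rw [hf.2.1 6 rfl, hμ])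
      (by rw [hf.2.1 13 rfl, he]) (by rw [hf.1 22 rfl, hJ]) g1 hU (by rwa [hf.2.1 1 rfl])
      (by rw [hf.2.1 2 rfl, hc]) hbu hbc hmJ hβ g4 (g5.p_le he0 hU hy hI hcI hα₀ hαI) g5 g2 g3
      ht).mono le_rfl ?_
    rintro s'' - ⟨R', p', k1, k2, k3, k4, k5, k6⟩
    have hR' := k6.R_le he0
    have hp' := k6.p_le he0 hU hy hI hcI hα₀ hαI
    exact ⟨f - 1, by omega, R', p', by omega, k2, k3, k4, k5, k6⟩
  · rintro f s' hf ⟨R, p, hfr, g1, g2, g3, g4, g5⟩ ht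
    have e12 : s'.num 12 0 = (1 + 1 / K) ^ J := by rw [hf.2.1 12 rfl, hT]
    simp only [Test.holds, NumExpr.val, IdxExpr.val, e12, not_lt] at ht
    exact ⟨R, p, s'.num 4, s'.num 11 0, s'.num 10 0, g1, ht, g5⟩
  · simp only [Test.cost, NumExpr.cost, IdxExpr.cost]
    have : (m * J + J) * (1 + 1 + (1 + 1) + 1 + 1100 * (m * F + m * Nat.size m) + 1) ≤
      (m * J + J) * (1120 * (m * F + m * Nat.size m)) := Nat.mul_le_mul_left _ (by omega)
    omega

end Pack

/-! ## The approximation scheme -/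

/-- Compute the minimum ratio, pack the bases and write the length of the list. -/
def packPositive : Cmd :=
  .seq prepareKeys (.seq minRatio (.seq initThreshold (.seq packLoop (.setIdx 1 (.const 0) (V 23)))))

/-- The approximation scheme for the costs in `num 2`; if no base has positive cost then the result
is the empty list. -/
def packBases : Cmd :=
  .seq initK (.seq initLengths
  (.seq (.seq (.setNum 6 (.const 0) (.const 0)) (.setNum 7 (.const 0) (.const 1)))
  (.seq minBase
  (.ite (.numLt (.const 0) (X 9)) packPositive (.setIdx 1 (.const 0) (.const 0))))))

/-- A bound for the numbers in the first memory. -/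
def idxBound (m K : ℕ) : ℕ :=
  2 * (m * m) + m * (K * K * Nat.size m) + K * K * Nat.size m + K + 10

/-- A bound for the encoding lengths of the keys. -/
def keyBound (m x : ℕ) : ℕ := (2 * m + 4) * (x + 3)

/-- A bound for the encoding lengths in the second memory. -/
def numBound (m K x : ℕ) : ℕ :=
  (m + 4) * ((m * (K * K * Nat.size m) + K * K * Nat.size m + 4) * (2 * keyBound m x + K + 10))

section Main

variable {m : ℕ} {M : Matroid (Fin m)} {F N β x : ℕ} {s : Store} {U : Fin m → ℕ} {c : ℕ → ℚ}
  {K : ℕ} {ε : ℚ}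

theorem packPositive_tri (hs : s.Bdd N β) (hm : 2 ≤ m) (hsm : s.idx 0 0 = m) (hε1 : ε < 1)
    (hK : 2 ≤ K) (hKε : 4 ≤ K * ε) (h29 : s.idx 29 0 = K) (h13 : s.num 13 0 = 1 / K)
    (hU : ∀ i, 0 < U i) (hu : ∀ i : Fin m, s.num 1 i = U i) (hc : s.num 2 = c)
    (hy : ∀ i : Fin m, s.num 4 i = 1 / U i)
    (hbu : ∀ i : Fin m, rs (U i) ≤ x) (hbc : ∀ i < m, rs (c i) ≤ x)
    (hN : idxBound m K ≤ N) (hβ : numBound m K x ≤ β)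
    {I : Finset (Fin m)} (hI : M.IsBase (I : Set (Fin m))) (h8 : s.num 8 0 = tot (s.num 4) I)
    (h9 : s.num 9 0 = tot c I) (hcI : 0 < tot c I) :
    Tri ⟨indepOracle M, F, N, β⟩ packPositive s
      (7000 * (m * (K * K * Nat.size m) * (m * F + m * Nat.size m))) fun s' =>
        IsApproxBasePacking M U (fun I => (tot c I : ℝ)) ε (s'.outputPacking m) := by
  set G := m * F + m * Nat.size m with hG
  set L := K * K * Nat.size m with hL
  set k := keyBound m x with hk
  unfold numBound at hβ
  unfold idxBound at hN
  rw [← hL] at hN hβ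
  rw [← hk] at hβ
  have hsz : 1 ≤ Nat.size m := Nat.size_pos.2 (by omega)
  have hkx : 2 * (m * (x + 2)) + 4 * (x + 3) + 2 * m = k := by rw [hk, keyBound]; ring
  have hmx : x + 2 ≤ m * (x + 2) := Nat.le_mul_of_pos_left _ (by omega)
  have hKL : K ≤ L := by
    rw [hL, mul_assoc]; exact Nat.le_mul_of_pos_right _ (by positivity)
  have hmm : m ≤ m * m := Nat.le_mul_of_pos_left _ (by omega)
  have hB0 : (2 * k + K + 10) * (m + 4) ≤ β := by
    refine le_trans ?_ hβ
    rw [mul_comm]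
    exact Nat.mul_le_mul_left _ (Nat.le_mul_of_pos_left _ (by omega))
  have hB1 : 2 * k + K + 10 ≤ β := (Nat.le_mul_of_pos_right _ (by omega)).trans hB0
  have hyb : ∀ i < m, rs (s.num 4 i) ≤ x + 2 := fun i hi => by
    have h1 := rs_div_le 1 (U ⟨i, hi⟩ : ℚ)
    have h2 := hbu ⟨i, hi⟩
    rw [rs_one] at h1
    rw [hy ⟨i, hi⟩]
    omega
  have hypos : ∀ i < m, 0 < s.num 4 i := fun i hi => by
    have := hU ⟨i, hi⟩
    rw [hy ⟨i, hi⟩]; positivity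
  have htot : ∀ J : Finset (Fin m), rs (tot (s.num 4) J) + rs (tot c J) ≤
      2 * (m * (x + 2)) + 4 := fun J => by
    have h1 := rs_tot_le hyb J
    have h2 := rs_tot_le (f := c) (b := x + 2) (fun i hi => (hbc i hi).trans (by omega)) J
    omega
  set hi := s.num 8 0 / s.num 9 0 + 1 with hhi
  have hhik : rs hi ≤ k := by
    have h1 := rs_div_le (s.num 8 0) (s.num 9 0)
    have h2 := rs_add_le (s.num 8 0 / s.num 9 0) 1
    have h3 := htot I
    rw [← h8, ← h9] at h3
    rw [rs_one, ← hhi] at h2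
    omega
  have hY : 0 < tot (s.num 4) I := tot_pos_of_tot_ne_zero hypos hcI.ne'
  -- The number `hi` is the ratio of the known base `I` of positive cost, plus one, so `I` violates
  -- it.
  have hlow : ¬ Low M (s.num 4) c hi := by
    have hhi' : hi * tot c I = tot (s.num 4) I + tot c I := by
      rw [hhi, h8, h9, add_mul, div_mul_cancel₀ _ hcI.ne', one_mul]
    rintro (h | h)
    · have : 0 < hi := by rw [hhi, h8, h9]; positivity
      linarith
    · have := h I hI
      linarith
  refine Tri.seq (T₁ := 500 * (m * m) * Nat.size (m * m))
    (T₂ := (Nat.size (m * m) * (920 * G) + 900 * G) + ((L * 40 + K * 30 + 60) +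
      ((m * L + L) * (1120 * G) + 10 + 5)))
    (prepareKeys_tri (b := x + 2) (B := k) hs hm hsm (by simp only; omega) hyb
    (by rw [hc]; exact fun i hi => (hbc i hi).trans (by omega)) hhik (by omega)
    (by simp only; omega)) ?_ ?_
  -- Time accounting: each part, including the sorting of `m * m` keys and the binary search, is at
  -- most a constant times `m * L * G`.
  swap
  · have hGm : m * Nat.size m ≤ G := by omega
    have hL1 : 1 ≤ L := by omega
    have hG1 : 1 ≤ G := le_trans (by have := Nat.mul_le_mul hm hsz; omega) hGm
    have hmL : 1 ≤ m * L := Nat.mul_pos (by omega) hL1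
    have e1 : G ≤ m * L * G := Nat.le_mul_of_pos_left _ hmL
    have e2 : L ≤ m * L * G := by
      rw [mul_right_comm]; exact Nat.le_mul_of_pos_left _ (Nat.mul_pos (by omega) hG1)
    have e3 : L * G ≤ m * L * G := Nat.mul_le_mul_right _ (Nat.le_mul_of_pos_left _ (by omega))
    have hszm : Nat.size (m * m) ≤ 2 * Nat.size m := by
      have := size_mul_le m m
      omega
    have e4 : m * m * Nat.size (m * m) ≤ 2 * (m * L * G) :=
      calc m * m * Nat.size (m * m) ≤ m * m * (2 * Nat.size m) := Nat.mul_le_mul_left _ hszm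
        _ = 2 * (m * 1 * (m * Nat.size m)) := by ring
        _ ≤ 2 * (m * L * G) := Nat.mul_le_mul_left _
          (Nat.mul_le_mul (Nat.mul_le_mul_left _ hL1) hGm)
    have hszL : Nat.size m ≤ L := by
      rw [hL]; exact Nat.le_mul_of_pos_left _ (by positivity)
    have e5 : Nat.size (m * m) * G ≤ 2 * (m * L * G) := by
      calc Nat.size (m * m) * G ≤ 2 * L * G := Nat.mul_le_mul_right _ (by omega)
        _ = 2 * (L * G) := by ring
        _ ≤ 2 * (m * L * G) := Nat.mul_le_mul_left _ e3
    have e6 : 500 * (m * m) * Nat.size (m * m) = 500 * (m * m * Nat.size (m * m)) := by ring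
    have e7 : Nat.size (m * m) * (920 * G) = 920 * (Nat.size (m * m) * G) := by ring
    have e8 : (m * L + L) * (1120 * G) = 1120 * (m * L * G) + 1120 * (L * G) := by ring
    omega
  rintro s₁ hf₁ ⟨k1, k2, k3, k4, k5, k6, k7, k8⟩
  have hs₁ := hf₁.2.2 hs
  have e4₁ : s₁.num 4 = s.num 4 := hf₁.2.1 4 rfl
  have e2₁ : s₁.num 2 = c := by rw [hf₁.2.1 2 rfl, hc]
  refine Tri.seq (minRatio_tri (N := N) (β := β) (b := 2 * k + 4) (n := m * m) (A := 2 * (m * (x + 2)) + 4) (hi := hi)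
    hs₁ (by omega) (by rw [hf₁.1 0 rfl, hsm]) (by omega) (by omega)
    (by rw [e4₁]; exact fun i hi => (hyb i hi).trans (by omega))
    (by rw [e2₁]; exact fun i hi => (hbc i hi).trans (by omega)) k2 k1 k3
    (fun i hi => by have := k5 i hi; omega)
    (le_trans (by rw [mul_comm]; exact Nat.mul_le_mul_right _ (by omega)) hB0)
    (by rwa [e4₁]) k4 (by rwa [e4₁, e2₁]) (by omega) k6 (by rwa [e4₁, e2₁]) k7
    (by rw [e4₁, e2₁, ← hc]; exact k8)) ?_ le_rfl
  rintro s₂ hf₂ ⟨a1, a2, J₀, a3, a4, a5⟩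
  rw [e4₁, e2₁] at a1 a5
  rw [e2₁] at a4
  have hs₂ := hf₂.2.2 hs₁
  refine Tri.seq (initThreshold_tri (m := m) (K := K) (by omega)
    (by rw [hf₂.1 0 rfl, hf₁.1 0 rfl, hsm])
    (by rw [hf₂.1 29 rfl, hf₁.1 29 rfl, h29]) (by omega)
    (by rw [hf₂.2.1 13 rfl, hf₁.2.1 13 rfl, h13]) (by simp only; omega) (by simp only; omega)
    (show _ ≤ β from ?_) (show _ ≤ β from ?_) (show _ ≤ β from ?_)) ?_ le_rfl
  · refine le_trans ?_ hB0
    have : (K + 10) * (m + 4) ≤ (2 * k + K + 10) * (m + 4) := Nat.mul_le_mul_right _ (by omega)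
    have e1 : (K + 10) * (m + 4) = K * (m + 2) + 2 * K + 10 * m + 40 := by ring
    omega
  · omega
  · have e1 : L * (K + 6) + 2 ≤ (L + 4) * (K + 10) := by
      have : (L + 4) * (K + 10) = L * (K + 6) + 4 * L + 4 * K + 40 := by ring
      omega
    refine e1.trans (le_trans ?_ hβ)
    exact (Nat.mul_le_mul (by omega) (by omega)).trans (Nat.le_mul_of_pos_left _ (by omega))
  rintro s₃ hf₃ ⟨J, j1, j2, j3, j4, j5, j6⟩
  have hs₃ := hf₃.2.2 hs₂
  have e4₃ : s₃.num 4 = s.num 4 := by rw [hf₃.2.1 4 rfl, hf₂.2.1 4 rfl, e4₁]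
  have e2₃ : s₃.num 2 = c := by rw [hf₃.2.1 2 rfl, hf₂.2.1 2 rfl, e2₁]
  have e10₃ : s₃.num 10 = s₂.num 10 := hf₃.2.1 10 rfl
  have hmJ : m * J ≤ m * L := Nat.mul_le_mul_left _ j1
  have hKq : (0 : ℚ) < 1 / K := by positivity
  refine Tri.seq (T₁ := (m * L + L) * (1120 * G) + 10) (T₂ := 5)
    ((packLoop_tri (N := N) (β := β) (M := M) (U := U) (c := c) (J := J) (K := K) (b := 2 * k + K + 10) (I := J₀)
      hs₃ (by omega) (by omega)
      (by rw [hf₃.1 0 rfl, hf₂.1 0 rfl, hf₁.1 0 rfl, hsm]) (by omega)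
      (by rw [hf₃.2.1 6 rfl, hf₂.2.1 6 rfl, k2])
      (by rw [hf₃.2.1 13 rfl, hf₂.2.1 13 rfl, hf₁.2.1 13 rfl, h13]) j2 j6 j3 hU
      (by rwa [hf₃.2.1 1 rfl, hf₂.2.1 1 rfl, hf₁.2.1 1 rfl]) e2₃
      (fun i => by have := hbu i; omega) (fun i hi => by have := hbc i hi; omega) (by omega)
      (le_trans (Nat.mul_le_mul_left _ (Nat.mul_le_mul_right _ (by omega))) hβ)
      (le_trans (le_self_pow₀ (by exact_mod_cast (by omega : 1 ≤ m)) (by omega)) j4)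
      (by rwa [e4₃]) j5 (by rw [e4₃]; exact fun i hi => (hyb i hi).trans (by omega))
      (by rw [e10₃]; omega) (by rwa [e4₃, e10₃]) a3 a4 (by rwa [e4₃, e10₃])).mono
      (by gcongr) fun _ _ h => h) ?_ le_rfl
  rintro s₄ hf₄ ⟨R, p, y, D, α, r1, r2, r3⟩
  have hs₄ := hf₄.2.2 hs₃
  refine Tri.line (by simp only [Cmd.ok, IdxExpr.val]; exact hs₄.1 _ _)
    (by simp [Cmd.fee, IdxExpr.cost]) ?_
  refine PackInv.isApproxBasePacking (R := R) (α₀ := s₃.num 10 0) (y := y) (D := D) (α := α)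
    (p := p) (J := J) ?_ ?_ hU hm hK hKε hε1 j4 r2
  · have : (Cmd.ev ⟨indepOracle M, F, N, β⟩ (.setIdx 1 (.const 0) (V 23)) s₄).outputRow m =
        s₄.outputRow m := Store.outputRow_setIdx _ (by decide) _ _
    rw [this]
    exact r3
  · simp [Cmd.ev, IdxExpr.val, Store.setIdx_idx, r1]

theorem packBases_tri (hs : s.Bdd N β) (hm : 2 ≤ m) (hsm : s.idx 0 0 = m)
    (hε : s.num 0 0 = ε) (hε0 : 0 < ε) (hε1 : ε < 1) (hK : K = ⌈4 / ε⌉₊)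
    (hU : ∀ i, 0 < U i) (hu : ∀ i : Fin m, s.num 1 i = U i) (hc : s.num 2 = c)
    (hbu : ∀ i : Fin m, rs (U i) ≤ x) (hbc : ∀ i < m, rs (c i) ≤ x)
    (hN : idxBound m K ≤ N) (hβ : numBound m K x ≤ β) :
    Tri ⟨indepOracle M, F, N, β⟩ packBases s
      (8000 * (m * (K * K * Nat.size m) * (m * F + m * Nat.size m))) fun s' =>
        IsApproxBasePacking M U (fun I => (tot c I : ℝ)) ε (s'.outputPacking m) := by
  have hK4 : 4 ≤ K * ε := by
    rw [← div_le_iff₀ hε0, hK]; exact Nat.le_ceil _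
  have hK2 : 2 ≤ K := by
    by_contra! h
    have : (K : ℚ) ≤ 1 := by exact_mod_cast Nat.lt_succ_iff.1 h
    nlinarith
  set G := m * F + m * Nat.size m with hG
  set L := K * K * Nat.size m with hL
  have hsz : 1 ≤ Nat.size m := Nat.size_pos.2 (by omega)
  have hKL : K ≤ L := by
    rw [hL, mul_assoc]; exact Nat.le_mul_of_pos_right _ (by positivity)
  have hmm : m ≤ m * m := Nat.le_mul_of_pos_left _ (by omega)
  have hN' : idxBound m K = 2 * (m * m) + m * L + L + K + 10 := rfl
  have hkx : (m + 4) * (x + 2) ≤ keyBound m x := Nat.mul_le_mul (by omega) (by omega)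
  have hB1 : 2 * keyBound m x + K + 10 ≤ β := by
    refine le_trans ?_ hβ
    exact (Nat.le_mul_of_pos_left _ (by omega)).trans (Nat.le_mul_of_pos_left _ (by omega))
  have hx2 : x + 2 ≤ (m + 4) * (x + 2) := Nat.le_mul_of_pos_left _ (by omega)
  refine Tri.seq (T₁ := K * 20 + 40) (T₂ := (m * 30 + 9) + (6 + (800 * G +
    (7000 * (m * L * G) + 20))))
    (initK_tri (K := K) hε hε0 hK (by simp only; omega) (by simp only; omega)) ?_ ?_
  swap
  · have hGm : m * Nat.size m ≤ G := by omega
    have hL1 : 1 ≤ L := by omega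
    have hG1 : 1 ≤ G := le_trans (by have := Nat.mul_le_mul hm hsz; omega) hGm
    have e1 : G ≤ m * L * G := Nat.le_mul_of_pos_left _ (Nat.mul_pos (by omega) hL1)
    have e2 : L ≤ m * L * G := by
      rw [mul_right_comm]; exact Nat.le_mul_of_pos_left _ (Nat.mul_pos (by omega) hG1)
    have e3 : m ≤ m * Nat.size m := Nat.le_mul_of_pos_right _ hsz
    omega
  rintro s₁ hf₁ ⟨h29, h13⟩
  have hs₁ := hf₁.2.2 hs
  have e1₁ : ∀ i : Fin m, s₁.num 1 i = U i := by rwa [hf₁.2.1 1 rfl]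
  refine Tri.seq (initLengths_tri (m := m) (b := x) (by rw [hf₁.1 0 rfl, hsm]) (by simp only; omega)
    (fun i hi => by rw [e1₁ ⟨i, hi⟩]; exact hbu _) (by simp only; omega)) ?_ le_rfl
  rintro s₂ hf₂ h4
  have hs₂ := hf₂.2.2 hs₁
  -- With parameters `μ = 0` and `l = 1` the minimizer is a base of maximum cost. If that cost is
  -- not positive, the empty packing is optimal; otherwise this base supplies the upper end of the
  -- search.
  refine Tri.seq (Q₁ := fun s' => s'.num 6 0 = 0 ∧ s'.num 7 0 = 1) (Tri.line ?_
    (by simp [Cmd.fee, IdxExpr.cost, NumExpr.cost])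
    (by simp [Cmd.ev, NumExpr.val, IdxExpr.val, Store.setNum_num])) ?_ le_rfl
  · simp only [Cmd.ok, NumExpr.val, rs_zero, rs_one]; omega
  rintro s₃ hf₃ ⟨h6, h7⟩
  have hs₃ := hf₃.2.2 hs₂
  have e4₃ : ∀ i : Fin m, s₃.num 4 i = 1 / U i := fun i => by
    rw [hf₃.2.1 4 rfl, h4 i i.2, e1₁]
  have e2₃ : s₃.num 2 = c := by rw [hf₃.2.1 2 rfl, hf₂.2.1 2 rfl, hf₁.2.1 2 rfl, hc]
  refine Tri.seq (minBase_tri (N := N) (β := β) (b := x + 2) hs₃ (by omega)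
    (by rw [hf₃.1 0 rfl, hf₂.1 0 rfl, hf₁.1 0 rfl, hsm]) (by omega) (fun i hi => ?_)
    (by rw [e2₃]; exact fun i hi => (hbc i hi).trans (by omega))
    (by rw [h6, rs_zero]; omega) (by rw [h7, rs_one]; omega) (by omega)) ?_ le_rfl
  · have h1 := rs_div_le 1 (U ⟨i, hi⟩ : ℚ)
    have h2 := hbu ⟨i, hi⟩
    rw [rs_one] at h1
    rw [e4₃ ⟨i, hi⟩]
    omega
  rintro s₄ hf₄ ⟨g1, g2, g3⟩
  have hs₄ := hf₄.2.2 hs₃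
  rw [h6, h7, e2₃] at g1
  rw [e2₃] at g3
  have hmin := g1.isMinBase (y := s₃.num 4) (c := c) fun _ _ _ _ h => h
  have e4₄ : s₄.num 4 = s₃.num 4 := hf₄.2.1 4 rfl
  refine Tri.ite (T₁ := 7000 * (m * L * G)) (fun ht => ?_) (fun ht => ?_)
    (by simp [Test.cost, IdxExpr.cost, NumExpr.cost]; omega)
  · simp only [Test.holds, NumExpr.val, IdxExpr.val, g3] at ht
    exact packPositive_tri hs₄ hm (by rw [hf₄.1 0 rfl, hf₃.1 0 rfl, hf₂.1 0 rfl, hf₁.1 0 rfl, hsm])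
      hε1 hK2 hK4 (by rw [hf₄.1 29 rfl, hf₃.1 29 rfl, hf₂.1 29 rfl, h29])
      (by rw [hf₄.2.1 13 rfl, hf₃.2.1 13 rfl, hf₂.2.1 13 rfl, h13]) hU
      (by rwa [hf₄.2.1 1 rfl, hf₃.2.1 1 rfl, hf₂.2.1 1 rfl]) (by rw [hf₄.2.1 2 rfl, e2₃])
      (by rwa [e4₄]) hbu hbc hN hβ hmin.1 (by rw [e4₄, g2]) g3 ht
  · simp only [Test.holds, NumExpr.val, IdxExpr.val, g3, not_lt] at ht
    refine Tri.line (by simp [Cmd.ok, IdxExpr.val]) ?_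
      (isApproxBasePacking_zero (by simp [Cmd.ev, IdxExpr.val, Store.setIdx_idx]) hε1 fun J hJ => ?_)
    · have hL1 : 1 ≤ L := by omega
      have hG1 : 1 ≤ G := le_trans (by have := Nat.mul_le_mul hm hsz; omega) (Nat.le_add_left _ _)
      have : 1 ≤ m * L * G := Nat.mul_pos (Nat.mul_pos (by omega) hL1) hG1
      simp [Cmd.fee, IdxExpr.cost]; omega
    · have := hmin.2 J hJ
      linarith

end Main

/-! ## Bounds in terms of the input -/

theorem rs_inputStore_le {m : ℕ} (ε : ℚ) (u c : Fin m → ℚ) (a i : ℕ) :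
    rs ((inputStore ε u c).num a i) ≤ inputLength ε u c + 2 := by
  have h : ∀ i, ratSize (u i) + ratSize (c i) ≤ ∑ i, (ratSize (u i) + ratSize (c i)) := fun i =>
    Finset.single_le_sum (f := fun i => ratSize (u i) + ratSize (c i)) (fun _ _ => Nat.zero_le _)
      (Finset.mem_univ i)
  simp only [inputStore, inputLength]
  split_ifs with h1 h2 h3 h4
  · have := rs_le_ratSize ε; omega
  · have := rs_le_ratSize (u ⟨i, h2⟩); have := h ⟨i, h2⟩; omega
  · have := rs_le_ratSize (c ⟨i, h2⟩); have := h ⟨i, h2⟩; omega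
  · rw [rs_zero]; omega
  · rw [rs_zero]; omega

theorem inputStore_bdd {m N β : ℕ} {ε : ℚ} {u c : Fin m → ℚ} (hN : m ≤ N)
    (hβ : inputLength ε u c + 2 ≤ β) : (inputStore ε u c).Bdd N β := by
  refine ⟨fun a i => ?_, fun a i => (rs_inputStore_le ε u c a i).trans hβ⟩
  simp only [inputStore]
  split_ifs <;> omega

theorem inputStore_num_one {m : ℕ} (ε : ℚ) (u c : Fin m → ℚ) (i : Fin m) :
    (inputStore ε u c).num 1 i = u i := by
  simp [inputStore]

theorem inputStore_num_two {m : ℕ} (ε : ℚ) (u c : Fin m → ℚ) (i : Fin m) :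
    (inputStore ε u c).num 2 i = c i := by
  simp [inputStore]

theorem le_inputLength {m : ℕ} (ε : ℚ) (u c : Fin m → ℚ) : m ≤ inputLength ε u c := by
  unfold inputLength; omega

/-- With `Nat.size m = k + 1` and `2 ^ k ≤ m`, both `k * log 2` and `log 2` are at most `log m`;
finally `2 / 0.69 < 3`. -/
theorem size_le_three_mul_log {m : ℕ} (hm : 2 ≤ m) : (Nat.size m : ℝ) ≤ 3 * Real.log m := by
  have hm0 : (0 : ℝ) < m := by positivity
  have h2 := Real.log_two_gt_d9
  have hlog : Real.log 2 ≤ Real.log m := Real.log_le_log (by norm_num) (by exact_mod_cast hm)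
  obtain ⟨k, hk⟩ : ∃ k, Nat.size m = k + 1 :=
    Nat.exists_eq_succ_of_ne_zero (Nat.size_pos.2 (by omega)).ne'
  have hle : 2 ^ k ≤ m := by
    by_contra! h
    have := Nat.size_le.2 h
    omega
  have h : k * Real.log 2 ≤ Real.log m := by
    rw [← Real.log_pow]
    exact Real.log_le_log (by positivity) (by exact_mod_cast hle)
  have h1 : (k : ℝ) * 0.69 ≤ Real.log m := le_trans (by gcongr; linarith) h
  have h3 : ((k + 1 : ℕ) : ℝ) * 0.69 ≤ 2 * Real.log m := by
    push_cast
    linarith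
  rw [hk]
  linarith

theorem ceil_four_div_le {ε : ℚ} (hε0 : 0 < ε) (hε1 : ε < 1) :
    ((⌈4 / ε⌉₊ : ℕ) : ℝ) ≤ 5 * (1 / (ε : ℝ)) := by
  have h1 : ((⌈4 / ε⌉₊ : ℕ) : ℚ) ≤ 4 / ε + 1 := (Nat.ceil_lt_add_one (by positivity)).le
  have h2 : 1 ≤ 1 / ε := by rw [one_le_div hε0]; exact hε1.le
  have h3 : ((⌈4 / ε⌉₊ : ℕ) : ℚ) ≤ 5 * (1 / ε) := by
    have : 4 / ε = 4 * (1 / ε) := by ring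
    linarith
  exact_mod_cast h3

/-- The degree 7 is `1 + 4 + 2`: the factor `m + 4`, the number of steps `m * K * K * Nat.size m`,
and the quadratic `keyBound`. -/
theorem idxBound_add_numBound_le (m K x Z : ℕ) (hm : m ≤ Z) (hK : K ≤ Z) (hx : x ≤ Z)
    (hZ : 1 ≤ Z) : idxBound m K + numBound m K x + 1 ≤ 3000 * Z ^ 7 := by
  have hL : K * K * Nat.size m ≤ Z * Z * Z :=
    Nat.mul_le_mul (Nat.mul_le_mul hK hK) ((size_le_self m).trans hm)
  have hkey : keyBound m x ≤ 24 * Z ^ 2 :=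
    calc keyBound m x ≤ (6 * Z) * (4 * Z) := Nat.mul_le_mul (by omega) (by omega)
      _ = 24 * Z ^ 2 := by ring
  have h1 : Z ≤ Z ^ 2 := le_self_pow₀ hZ (by norm_num)
  have p1 : ∀ k, 1 ≤ Z ^ k := fun k => Nat.one_le_pow _ _ hZ
  have hmL : m * (K * K * Nat.size m) ≤ Z ^ 4 :=
    (Nat.mul_le_mul hm hL).trans (by ring_nf; exact le_rfl)
  have hL' : K * K * Nat.size m ≤ Z ^ 4 :=
    calc K * K * Nat.size m ≤ Z * Z * Z * 1 := by rw [mul_one]; exact hL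
      _ ≤ Z * Z * Z * Z := Nat.mul_le_mul_left _ hZ
      _ = Z ^ 4 := by ring
  have hmm : m * m ≤ Z ^ 2 := (Nat.mul_le_mul hm hm).trans (by ring_nf; exact le_rfl)
  have h27 : Z ^ 2 ≤ Z ^ 7 := Nat.pow_le_pow_right hZ (by norm_num)
  have h47 : Z ^ 4 ≤ Z ^ 7 := Nat.pow_le_pow_right hZ (by norm_num)
  have hidx : idxBound m K ≤ 15 * Z ^ 7 := by
    unfold idxBound
    have := p1 7
    omega
  have hnum : numBound m K x ≤ 1800 * Z ^ 7 := by
    unfold numBound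
    calc _ ≤ (5 * Z) * ((6 * Z ^ 4) * (60 * Z ^ 2)) := by
          refine Nat.mul_le_mul (by omega) (Nat.mul_le_mul ?_ ?_)
          · have := p1 4
            omega
          · have := p1 2
            omega
      _ = 1800 * Z ^ 7 := by ring
  have := p1 7
  omega

theorem cast_time_le {m F : ℕ} (hm : 2 ≤ m) :
    ((m * F + m * Nat.size m : ℕ) : ℝ) ≤ 3 * (m * F + m * Real.log m) := by
  have h := size_le_three_mul_log hm
  have hm0 : (0 : ℝ) ≤ m := by positivity
  have hF : (0 : ℝ) ≤ m * F := by positivity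
  push_cast
  nlinarith

/-- The factor 225 is `25 * 3 * 3`, from `K ≤ 5 / ε`, `Nat.size m ≤ 3 * log m` and the same estimate
in the cost of a greedy run. The constant 9000 leaves room for the loop that writes unit costs. -/
theorem runsWithin_of_tri {m : ℕ} {M : Matroid (Fin m)} {F W : ℕ} {p : Cmd} {ε : ℚ}
    {u c : Fin m → ℚ} {Q : Store → Prop} (hW : ∀ N β, p.Fits (W * (N + β + 1)) N β) (hm : 2 ≤ m)
    (hε0 : 0 < ε) (hε1 : ε < 1)
    (h : ∀ N β K x, K = ⌈4 / ε⌉₊ → x = inputLength ε u c + 2 → N = idxBound m K →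
      β = numBound m K x → (inputStore ε u c).Bdd N β →
      Tri ⟨indepOracle M, F, N, β⟩ p (inputStore ε u c)
        (9000 * (m * (K * K * Nat.size m) * (m * F + m * Nat.size m))) Q) :
    RunsWithin (indepOracle M) F p (inputStore ε u c)
      (9000 * 225 * (1 / (ε : ℝ) ^ 2 * m ^ 2 * Real.log m * (F + Real.log m)))
      ((W * 3000 * 10 ^ 7) * (inputLength ε u c + 1 / (ε : ℝ)) ^ 7) Q := by
  have hεr : (0 : ℝ) < ε := by exact_mod_cast hε0
  have hεr1 : (ε : ℝ) < 1 := by exact_mod_cast hε1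
  have ha : 1 ≤ 1 / (ε : ℝ) := by rw [one_le_div hεr]; exact hεr1.le
  have hK := ceil_four_div_le hε0 hε1
  have hml := le_inputLength ε u c
  set K := ⌈4 / ε⌉₊ with hKdef
  set n := inputLength ε u c with hn
  have hx : n + 2 ≤ numBound m K (n + 2) := by
    refine le_trans ?_ (Nat.le_mul_of_pos_left _ (by omega))
    refine le_trans ?_ (Nat.le_mul_of_pos_left _ (by omega))
    have : 1 * (n + 2 + 3) ≤ keyBound m (n + 2) := Nat.mul_le_mul_right _ (by omega)
    omega
  have hbdd : (inputStore ε u c).Bdd (idxBound m K) (numBound m K (n + 2)) := by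
    refine inputStore_bdd ?_ hx
    have : m ≤ m * m := Nat.le_mul_of_pos_left _ (by omega)
    unfold idxBound
    omega
  have hlog0 : 0 ≤ Real.log m := Real.log_natCast_nonneg m
  refine (h _ _ K (n + 2) rfl rfl rfl rfl hbdd).runsWithin hbdd (hW _ _) ?_ ?_
  · have hsz := size_le_three_mul_log hm
    have hG := cast_time_le (F := F) hm
    rw [Nat.cast_mul, Nat.cast_mul, Nat.cast_mul, Nat.cast_mul, Nat.cast_mul]
    calc ((9000 : ℕ) : ℝ) * (m * (K * K * Nat.size m) * (m * F + m * Nat.size m : ℕ))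
        ≤ 9000 * (m * ((5 * (1 / (ε : ℝ))) * (5 * (1 / (ε : ℝ))) * (3 * Real.log m)) *
          (3 * (m * F + m * Real.log m))) := by
          rw [Nat.cast_ofNat]
          gcongr
      _ = _ := by field_simp; ring
  · have hZ := idxBound_add_numBound_le m K (n + 2) (m + K + (n + 2)) (by omega) (by omega)
      (by omega) (by omega)
    have hZr : ((m + K + (n + 2) : ℕ) : ℝ) ≤ 10 * (n + 1 / (ε : ℝ)) := by
      have : (m : ℝ) ≤ n := by exact_mod_cast hml
      have hn0 : (0 : ℝ) ≤ n := by positivity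
      push_cast
      linarith
    calc ((W * (idxBound m K + numBound m K (n + 2) + 1) : ℕ) : ℝ)
        ≤ ((W * (3000 * (m + K + (n + 2)) ^ 7) : ℕ) : ℝ) := by
          exact_mod_cast Nat.mul_le_mul_left _ hZ
      _ = W * (3000 * ((m + K + (n + 2) : ℕ) : ℝ) ^ 7) := by push_cast; ring
      _ ≤ W * (3000 * (10 * (n + 1 / (ε : ℝ))) ^ 7) := by gcongr
      _ = _ := by ring

theorem RunsWithin.mono {O : (ℕ → ℕ) → Prop} {F : ℕ} {p : Cmd} {s : Store} {T T' B B' : ℝ}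
    {Q Q' : Store → Prop} (h : RunsWithin O F p s T B Q) (hT : T ≤ T') (hB : B ≤ B')
    (hQ : ∀ s, Q s → Q' s) : RunsWithin O F p s T' B' Q' := by
  obtain ⟨b, t, s', h1, h2, h3, h4⟩ := h
  exact ⟨b, t, s', h1, h2.trans hB, h3.trans hT, hQ _ h4⟩

theorem packBases_runsWithin {W : ℕ} (hW : ∀ N β, packBases.Fits (W * (N + β + 1)) N β) (F : ℕ)
    {m : ℕ} (M : Matroid (Fin m)) (u : Fin m → ℕ) (c : Fin m → ℤ) {ε : ℚ} (hm : 2 ≤ m)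
    (hu : ∀ i, 0 < u i) (hε0 : 0 < ε) (hε1 : ε < 1) :
    RunsWithin (indepOracle M) F packBases
      (inputStore ε (fun i => (u i : ℚ)) (fun i => (c i : ℚ)))
      (9000 * 225 * (1 / (ε : ℝ) ^ 2 * m ^ 2 * Real.log m * (F + Real.log m)))
      ((W * 3000 * 10 ^ 7) * (inputLength ε (fun i => (u i : ℚ)) (fun i => (c i : ℚ)) +
        1 / (ε : ℝ)) ^ 7)
      fun s => IsApproxBasePacking M u (fun I => ∑ i ∈ I, (c i : ℝ)) ε (s.outputPacking m) := by
  refine runsWithin_of_tri hW hm hε0 hε1 fun N β K x hK hx hN hβ hs => ?_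
  have hb := rs_inputStore_le ε (fun i => (u i : ℚ)) (fun i => (c i : ℚ))
  refine (packBases_tri (ε := ε) hs hm (by simp [inputStore]) (by simp [inputStore]) hε0 hε1 hK hu
    (inputStore_num_one _ _ _) rfl (fun i => ?_) (fun i _ => hx ▸ hb 2 i) hN.ge hβ.ge).mono
    (Nat.mul_le_mul_right _ (by norm_num)) fun s _ h => ?_
  · have := hb 1 i
    rwa [inputStore_num_one, ← hx] at this
  · have e : ∀ I : Finset (Fin m), ((tot ((inputStore ε (fun i => (u i : ℚ))
        (fun i => (c i : ℚ))).num 2) I : ℚ) : ℝ) = ∑ i ∈ I, (c i : ℝ) := fun I => by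
      simp [tot, inputStore_num_two]
    simpa only [e] using h

/-! ## Unit costs -/

/-- The approximation scheme for the costs `1`. -/
def packUnweighted : Cmd := .seq (forC 24 0 (.setNum 2 (V 24) (.const 1))) packBases

/-- All bases have the same cardinality, positive because the rank is, so the two objectives are
proportional on packings. -/
theorem _root_.IsApproxBasePacking.of_card {m : ℕ} {M : Matroid (Fin m)} [M.RankPos] {u : Fin m → ℕ}
    {ε : ℝ} {x : Finset (Fin m) → ℝ}
    (h : IsApproxBasePacking M u (fun I => (I.card : ℝ)) ε x) :
    IsApproxBasePacking M u (fun _ => 1) ε x := by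
  obtain ⟨B, hB⟩ := M.exists_isBase
  have hr : 0 < B.ncard := (Set.ncard_pos B.toFinite).2 hB.nonempty
  have key : ∀ y, IsBasePacking M u y →
      ∑ I : Finset (Fin m), (I.card : ℝ) * y I = B.ncard * ∑ I : Finset (Fin m), 1 * y I := by
    intro y hy
    rw [Finset.mul_sum]
    refine Finset.sum_congr rfl fun I _ => ?_
    by_cases hI : y I = 0
    · simp [hI]
    · have := (hy.isBase_of_ne_zero I hI).ncard_eq_ncard_of_isBase hB
      rw [Set.ncard_coe_finset] at this
      rw [this, one_mul]
  refine ⟨h.1, fun y hy => ?_⟩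
  have h1 := h.2 y hy
  rw [key y hy, key x h.1] at h1
  refine le_of_mul_le_mul_left ?_ (Nat.cast_pos.2 hr : (0 : ℝ) < B.ncard)
  linarith

theorem packUnweighted_runsWithin {W : ℕ} (hW : ∀ N β, packUnweighted.Fits (W * (N + β + 1)) N β)
    (F : ℕ) {m : ℕ} (M : Matroid (Fin m)) (u : Fin m → ℕ) {ε : ℚ} (hm : 2 ≤ m) (hM : M.RankPos)
    (hu : ∀ i, 0 < u i) (hε0 : 0 < ε) (hε1 : ε < 1) :
    RunsWithin (indepOracle M) F packUnweighted (inputStore ε (fun i => (u i : ℚ)) 0)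
      (9000 * 225 * (1 / (ε : ℝ) ^ 2 * m ^ 2 * Real.log m * (F + Real.log m)))
      ((W * 3000 * 10 ^ 7) * (inputLength ε (fun i => (u i : ℚ)) 0 + 1 / (ε : ℝ)) ^ 7)
      fun s => IsApproxBasePacking M u (fun _ => 1) ε (s.outputPacking m) := by
  refine runsWithin_of_tri hW hm hε0 hε1 fun N β K x hK hx hN hβ hs => ?_
  have hb := rs_inputStore_le ε (fun i => (u i : ℚ)) 0
  set G := m * F + m * Nat.size m with hG
  have hsz : 1 ≤ Nat.size m := Nat.size_pos.2 (by omega)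
  have hK1 : 0 < K := by rw [hK]; exact Nat.ceil_pos.2 (by positivity)
  have hmm : m ≤ m * m := Nat.le_mul_of_pos_left _ (by omega)
  have hβ2 : 2 ≤ β := (two_le_rs _).trans (hs.2 0 0)
  have hGm : m ≤ G := (Nat.le_mul_of_pos_right _ hsz).trans (Nat.le_add_left _ _)
  have hG1 : G ≤ m * (K * K * Nat.size m) * G := Nat.le_mul_of_pos_left _ (by positivity)
  refine Tri.seq (T₁ := m * 20 + 9) (T₂ := 8000 * (m * (K * K * Nat.size m) * G))
    (Q₁ := fun s' => ∀ i < m, s'.num 2 i = 1)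
    (Tri.forLoop (T₁ := 8) (fun k s' => ∀ i < k, s'.num 2 i = 1) (by simp [inputStore])
      (show m ≤ N by rw [hN, idxBound]; omega) (by decide) rfl rfl (by simp) ?_ (fun _ _ h => h)
      (by omega)) ?_ (by omega)
  · intro k s' hk hf hi _ h
    refine Tri.line ?_ (by simp [Cmd.fee, IdxExpr.cost, NumExpr.cost]) fun i hik => ?_
    · simp only [Cmd.ok, NumExpr.val, rs_one]; exact hβ2
    · simp only [Cmd.ev, IdxExpr.val, NumExpr.val, hi, Store.setIdx_num, Store.setNum_num, if_true,
        Function.update_apply]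
      split_ifs with h'
      · rfl
      · exact h i (by omega)
  · intro s₁ hf h2
    refine (packBases_tri (ε := ε) (x := x) (K := K) (U := u) (c := s₁.num 2) (hf.2.2 hs) hm
      (by rw [hf.1 0 rfl]; simp [inputStore]) (by rw [hf.2.1 0 rfl]; simp [inputStore]) hε0 hε1 hK hu
      (by rw [hf.2.1 1 rfl]; exact inputStore_num_one _ _ _) rfl (fun i => ?_)
      (fun i hi => by rw [h2 i hi, rs_one]; omega) hN.ge hβ.ge).mono le_rfl fun s _ h => ?_
    · have := hb 1 i
      rwa [inputStore_num_one, ← hx] at this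
    · have e : ∀ I : Finset (Fin m), ((tot (s₁.num 2) I : ℚ) : ℝ) = I.card := fun I => by
        simp [tot, h2]
      simp only [e] at h
      exact h.of_card

theorem greedy_runsWithin {W : ℕ} (hW : ∀ N β, (greedy 2).Fits (W * (N + β + 1)) N β) (F : ℕ)
    {m : ℕ} (M : Matroid (Fin m)) (d : Fin m → ℚ) (hm : 2 ≤ m) :
    RunsWithin (indepOracle M) F (greedy 2) (inputStore 0 0 d)
      (1800 * (m * F + m * Real.log m)) ((W * 6) * (inputLength 0 0 d : ℝ) ^ 1)
      fun s => ∃ l : List (Fin m), l.Nodup ∧ (∀ i, i ∈ l) ∧ l.Pairwise (fun i j => d i ≤ d j) ∧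
        s.outputSet m = greedySet M l := by
  have hs : (inputStore 0 0 d).Bdd (2 * m) (inputLength 0 0 d + 2) :=
    inputStore_bdd (by omega) le_rfl
  have hml := le_inputLength 0 0 d
  have h := greedy_tri (M := M) (F := F) 2 hs (by omega) (by simp [inputStore]) le_rfl
  simp only [inputStore_num_two] at h
  refine h.runsWithin hs (hW _ _) ?_ ?_
  · have := cast_time_le (F := F) hm
    rw [Nat.cast_mul, Nat.cast_ofNat]
    linarith
  · have : W * (2 * m + (inputLength 0 0 d + 2) + 1) ≤ W * 6 * inputLength 0 0 d := by
      rw [mul_assoc]; exact Nat.mul_le_mul_left _ (by omega)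
    rw [pow_one]
    exact_mod_cast this

/-! ### Comparison of the time bounds and assembly of the claims. -/

theorem weak_time_le {m F L : ℕ} {a : ℝ} (hm : 2 ≤ m) (ha : 1 ≤ a) (hL : m ≤ L) :
    a ^ 2 * m ^ 2 * Real.log m * (F + Real.log m) ≤
      10 * ((m * F + m * Real.log m) * (a ^ 2 * m * Real.log m + Real.log (Real.log L)
        - Real.log a - Real.log m - Real.log (Real.log m))) := by
  have h2 := Real.log_two_gt_d9
  have hm2 : (2 : ℝ) ≤ m := by exact_mod_cast hm
  have hlog : Real.log 2 ≤ Real.log m := Real.log_le_log (by norm_num) hm2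
  -- As `m ≤ L`, the term `log (log L)` pays for `log (log m)`. The terms `log m` and `log a` then
  -- use up only part of `a ^ 2 * m * log m`, and the factor 10 restores the loss.
  have hlog' : Real.log (Real.log m) ≤ Real.log (Real.log L) :=
    Real.log_le_log (by linarith) (Real.log_le_log (by linarith) (by exact_mod_cast hL))
  have hla : 2 * Real.log a ≤ a ^ 2 - 1 := by
    have := Real.log_le_sub_one_of_pos (show 0 < a ^ 2 by positivity)
    rwa [Real.log_pow, Nat.cast_ofNat] at this
  have ha2 : 1 ≤ a ^ 2 := one_le_pow₀ ha
  set l := Real.log m with hl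
  have e1 : 2 * l ≤ m * l := by nlinarith
  have e2 : m * l ≤ a ^ 2 * (m * l) := by nlinarith
  have e3 : 1.38 * a ^ 2 ≤ a ^ 2 * (m * l) := by nlinarith
  have e4 : a ^ 2 * m * l = a ^ 2 * (m * l) := by ring
  have key : a ^ 2 * m * l ≤ 10 * (a ^ 2 * m * l + Real.log (Real.log L) - Real.log a - l -
      Real.log l) := by
    rw [e4]
    linarith
  have hF : (0 : ℝ) ≤ m * F + m * l := by
    have : 0 ≤ l := by linarith
    positivity
  calc a ^ 2 * m ^ 2 * l * (F + l) = (m * F + m * l) * (a ^ 2 * m * l) := by ring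
    _ ≤ (m * F + m * l) * (10 * (a ^ 2 * m * l + Real.log (Real.log L) - Real.log a - l -
      Real.log l)) := mul_le_mul_of_nonneg_left key hF
    _ = _ := by ring

end OracleRAM

theorem mainTheorem11 :
    -- the greedy algorithm as a minimizing oracle
    (∃ (p : OracleRAM.Cmd) (C : ℝ) (k : ℕ),
      ∀ (F : ℕ → ℕ) (m : ℕ) (M : Matroid (Fin m)) (d : Fin m → ℚ),
        2 ≤ m → M.E = Set.univ →
        OracleRAM.RunsWithin (OracleRAM.indepOracle M) (F m) p
          (OracleRAM.inputStore 0 0 d)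
          (C * (m * F m + m * Real.log m))
          (C * (OracleRAM.inputLength 0 0 d : ℝ) ^ k)
          (fun s =>
            (∃ l : List (Fin m), l.Nodup ∧ (∀ i, i ∈ l) ∧ l.Pairwise (fun i j => d i ≤ d j) ∧
              s.outputSet m = greedySet M l) ∧
            M.IsBase (s.outputSet m : Set (Fin m)) ∧
            ∀ I : Finset (Fin m), M.IsBase (I : Set (Fin m)) →
              ∑ i ∈ s.outputSet m, d i ≤ ∑ i ∈ I, d i)) ∧
    -- maximum base packing
    (∃ (p : OracleRAM.Cmd) (C : ℝ) (k : ℕ),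
      ∀ (F : ℕ → ℕ) (m : ℕ) (M : Matroid (Fin m)) (u : Fin m → ℕ) (ε : ℚ),
        2 ≤ m → M.E = Set.univ → M.RankPos → (∀ i, 0 < u i) → 0 < ε → ε < 1 →
        OracleRAM.RunsWithin (OracleRAM.indepOracle M) (F m) p
          (OracleRAM.inputStore ε (fun i => (u i : ℚ)) 0)
          (C * (1 / (ε : ℝ) ^ 2 * m ^ 2 * Real.log m * (F m + Real.log m)))
          (C * (OracleRAM.inputLength ε (fun i => (u i : ℚ)) 0 + 1 / (ε : ℝ)) ^ k)
          (fun s => IsApproxBasePacking M u (fun _ => 1) ε (s.outputPacking m))) ∧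
    -- maximum weighted base packing, weakly polynomial
    (∃ (p : OracleRAM.Cmd) (C : ℝ) (k : ℕ),
      ∀ (F : ℕ → ℕ) (m : ℕ) (M : Matroid (Fin m)) (u : Fin m → ℕ) (c : Fin m → ℤ) (ε : ℚ),
        2 ≤ m → M.E = Set.univ → M.RankPos → (∀ i, 0 < u i) → 0 < ε → ε < 1 →
        OracleRAM.RunsWithin (OracleRAM.indepOracle M) (F m) p
          (OracleRAM.inputStore ε (fun i => (u i : ℚ)) (fun i => (c i : ℚ)))
          (C * ((m * F m + m * Real.log m) *
            (1 / (ε : ℝ) ^ 2 * m * Real.log m + Real.log (Real.log (largestInput u c))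
              - Real.log (1 / (ε : ℝ)) - Real.log m - Real.log (Real.log m))))
          (C * (OracleRAM.inputLength ε (fun i => (u i : ℚ)) (fun i => (c i : ℚ))
            + 1 / (ε : ℝ)) ^ k)
          (fun s => IsApproxBasePacking M u (fun I => ∑ i ∈ I, (c i : ℝ)) ε
            (s.outputPacking m))) ∧
    -- maximum weighted base packing, strongly polynomial
    (∃ (p : OracleRAM.Cmd) (C : ℝ) (k : ℕ),
      ∀ (F : ℕ → ℕ) (m : ℕ) (M : Matroid (Fin m)) (u : Fin m → ℕ) (c : Fin m → ℤ) (ε : ℚ),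
        2 ≤ m → M.E = Set.univ → M.RankPos → (∀ i, 0 < u i) → 0 < ε → ε < 1 →
        OracleRAM.RunsWithin (OracleRAM.indepOracle M) (F m) p
          (OracleRAM.inputStore ε (fun i => (u i : ℚ)) (fun i => (c i : ℚ)))
          (C * (1 / (ε : ℝ) ^ 2 * m ^ 2 * Real.log m * (F m + Real.log m)
            + (m * F m + m * Real.log m) ^ 2))
          (C * (OracleRAM.inputLength ε (fun i => (u i : ℚ)) (fun i => (c i : ℚ))
            + 1 / (ε : ℝ)) ^ k)
          (fun s => IsApproxBasePacking M u (fun I => ∑ i ∈ I, (c i : ℝ)) ε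
            (s.outputPacking m))) := by
  obtain ⟨W₁, hW₁⟩ := (OracleRAM.greedy 2).exists_fits
  obtain ⟨W₂, hW₂⟩ := OracleRAM.packUnweighted.exists_fits
  obtain ⟨W₃, hW₃⟩ := OracleRAM.packBases.exists_fits
  -- The same program serves both weighted claims. The costs of the minimizing oracle are placed
  -- where the packing costs would be, in `num 2`.
  refine ⟨⟨OracleRAM.greedy 2, max 1800 (W₁ * 6), 1, fun F m M d hm _ => ?_⟩,
    ⟨OracleRAM.packUnweighted, max (9000 * 225) (W₂ * 3000 * 10 ^ 7), 7,
      fun F m M u ε hm _ hM hu hε0 hε1 => ?_⟩,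
    ⟨OracleRAM.packBases, max (9000 * 225 * 10) (W₃ * 3000 * 10 ^ 7), 7,
      fun F m M u c ε hm _ _ hu hε0 hε1 => ?_⟩,
    ⟨OracleRAM.packBases, max (9000 * 225) (W₃ * 3000 * 10 ^ 7), 7,
      fun F m M u c ε hm _ _ hu hε0 hε1 => ?_⟩⟩
  · have hlog := Real.log_natCast_nonneg m
    refine (OracleRAM.greedy_runsWithin hW₁ (F m) M d hm).mono
      (mul_le_mul_of_nonneg_right (le_max_left _ _) (by positivity))
      (mul_le_mul_of_nonneg_right (le_max_right _ _) (by positivity)) fun s h => ⟨h, ?_⟩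
    obtain ⟨l, h1, h2, h3, h4⟩ := h
    rw [h4]
    exact ⟨greedySet_isBase h2, fun I hI => greedySet_min d h1 h2 h3 hI⟩
  · have hlog := Real.log_natCast_nonneg m
    have hε : (0 : ℝ) < ε := by exact_mod_cast hε0
    exact (OracleRAM.packUnweighted_runsWithin hW₂ (F m) M u hm hM hu hε0 hε1).mono
      (mul_le_mul_of_nonneg_right (le_max_left _ _) (by positivity))
      (mul_le_mul_of_nonneg_right (le_max_right _ _) (by positivity)) fun s h => h
  · have hlog := Real.log_natCast_nonneg m
    have hε : (0 : ℝ) < ε := by exact_mod_cast hε0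
    have ha : 1 ≤ 1 / (ε : ℝ) := by
      rw [one_le_div hε]; exact_mod_cast hε1.le
    have ht := OracleRAM.weak_time_le (F := F m) hm ha
      (show m ≤ largestInput u c from le_max_left _ _)
    rw [one_div_pow] at ht
    refine (OracleRAM.packBases_runsWithin hW₃ (F m) M u c hm hu hε0 hε1).mono ?_
      (mul_le_mul_of_nonneg_right (le_max_right _ _) (by positivity)) fun s h => h
    refine (mul_le_mul_of_nonneg_left ht (by norm_num)).trans ?_
    rw [← mul_assoc]
    refine mul_le_mul_of_nonneg_right (le_max_left _ _) ?_
    -- The weakly polynomial bound contains subtractions, so its sign is not evident; it is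
    -- nonnegative because it dominates the strongly polynomial one.
    refine nonneg_of_mul_nonneg_right (le_trans ?_ ht) (by norm_num : (0 : ℝ) < 10)
    positivity
  · have hlog := Real.log_natCast_nonneg m
    have hε : (0 : ℝ) < ε := by exact_mod_cast hε0
    refine (OracleRAM.packBases_runsWithin hW₃ (F m) M u c hm hu hε0 hε1).mono ?_
      (mul_le_mul_of_nonneg_right (le_max_right _ _) (by positivity)) fun s h => h
    refine mul_le_mul (le_max_left _ _) (le_add_of_nonneg_right (sq_nonneg _)) (by positivity) ?_
    exact le_max_of_le_left (by norm_num)
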